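/- Let $\Bbbk$ be a principal ideal domain and let $H_*(-)$ denote singular homology with coefficients in $\Bbbk$. Let $G$ be an $H$-group (a pointed space with base point $e$ and a continuous multiplication which is unital, associative and has an inverse up to base point preserving homotopy), let $X$ be a topological space and let $act_X\colon G\times X\to X$ be an action up to homotopy of $G$ on $X$, that is, a continuous map $(g,x)\mapsto g.x$ such that $x\mapsto e.x$ is homotopic to the identity of $X$ and $(g,h,x)\mapsto (gh).x$ is homotopic to $(g,h,x)\mapsto g.(h.x)$. Write $S^1=\mathbb{R}/\mathbb{Z}$, let $LG=\mathrm{map}(S^1,G)$ be the free loop space, $j\colon\Omega G\hookrightarrow LG$ the inclusion of the loops based at $e$, and let $r\colon LG\to\Omega G$ be a continuous map, which exists and is unique up to homotopy, such that $j\circ r$ is homotopic to $l\mapsto (t\mapsto l(t)\,l(0)^{-1})$. The circle acts up to homotopy on $\Omega G$ by $s.w=r(t\mapsto w(t+s))$, and on $\Omega G\times X$ by $s.(w,x)=(s.w,\,w(s).x)$. Let $[S^1]\in H_1(S^1)$ be the fundamental class, and let $B_{\Omega G}$ and $B_{\Omega G\times X}$ be the operators of degree $+1$ on $H_*(\Omega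 G)$ and on $H_*(\Omega G\times X)$ given by the action of $[S^1]$ (cross product with $[S^1]$ on the left, followed by the map induced by the action map). Suppose that $H_*(\Omega G)$ is torsion free. Then the Künneth morphisms $$H_*(\Omega G)\otimes H_*(\Omega G)\to H_*(\Omega G\times\Omega G),\qquad H_*(\Omega G)\otimes H_*(X)\to H_*(\Omega G\times X)$$ are isomorphisms. Let $\Delta a=\sum a_{(1)}\otimes a_{(2)}$ denote the diagonal of $a\in H_*(\Omega G)$, obtained from the diagonal map of $\Omega G$ and the first isomorphism, and identify $H_*(\Omega G\times X)$ with $H_*(\Omega G)\otimes H_*(X)$ by the second one. Then for all $a\in H_*(\Omega G)$ and $x\in H_*(X)$, $$B_{\Omega G\times X}(a\otimes x)=(B_{\Omega G}\,a)\otimes x+\sum(-1)^{|a_{(1)}|}\,a_{(1)}\otimes\bigl(\sigma_*(a_{(2)})\cdot x\bigr).$$ Here $\sigma_*\colon H_q(\Omega G)\to H_{q+1}(G)$ is the homology suspension $\sigma_*(b)=H_*(\sigma)([S^1]\otimes b)$, where $\sigma\colon S^1\times\Omega G\to G$ is the evaluation $(s,w)\mapsto w(s)$, and $g\cdot x=H_*(act_X)(g\otimes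 x)$ for $g\in H_*(G)$ and $x\in H_*(X)$. -/

import Mathlib

open CategoryTheory AlgebraicTopology
universe u w
noncomputable section
set_option linter.unusedSimpArgs false
namespace LoopHomology

/-! ### Shuffles

The `(p, q)`-shuffles are the maximal chains `(0, 0) = v₀ < ⋯ < vₙ = (p, q)`, `n = p + q`, of the
poset `[p] × [q]`. The Eilenberg-Zilber cross product of singular simplices `σ : Δᵖ → X` and
`τ : Δ^q → Y` is the signed sum over all of them of the simplices `(σ ∘ f, τ ∘ g) : Δⁿ → X × Y`
where `f` and `g` are the two coordinates of the chain. -/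

section
open scoped Simplicial
/-- Formal integral combinations of pairs `(f, g)` of monotone maps `[n] → [p]`, `[n] → [q]`. -/
abbrev PairChain (n p q : ℕ) : Type := ((⦋n⦌ ⟶ ⦋p⦌) × (⦋n⦌ ⟶ ⦋q⦌)) →₀ ℤ

/-- Extend the monotone map `f : [n] → [p]` to `[n + 1]` by `n + 1 ↦ p`. -/
def addLast {n p : ℕ} (f : ⦋n⦌ ⟶ ⦋p⦌) : ⦋n + 1⦌ ⟶ ⦋p⦌ :=
  SimplexCategory.mkHom
    ⟨Fin.snoc (α := fun _ => Fin (p + 1)) f.toOrderHom (Fin.last p), by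
      intro i j hij
      induction j using Fin.lastCases with
      | last => simpa using Fin.le_last _
      | cast j =>
        induction i using Fin.lastCases with
        | last => exact absurd (lt_of_le_of_lt hij (Fin.castSucc_lt_last j)) (lt_irrefl _)
        | cast i =>
          simpa only [Fin.snoc_castSucc] using f.toOrderHom.monotone (by simpa using hij)⟩

namespace PairChain

variable {n p q : ℕ}

/-- Composition with monotone maps on the targets. -/
def push {p' q' : ℕ} (a : ⦋p⦌ ⟶ ⦋p'⦌) (b : ⦋q⦌ ⟶ ⦋q'⦌) : PairChain n p q →+ PairChain n p' q' :=
  Finsupp.mapDomain.addMonoidHom fun fg => (fg.1 ≫ a, fg.2 ≫ b)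

/-- Composition with a monotone map on the source. -/
def pull {m : ℕ} (θ : ⦋m⦌ ⟶ ⦋n⦌) : PairChain n p q →+ PairChain m p q :=
  Finsupp.mapDomain.addMonoidHom fun fg => (θ ≫ fg.1, θ ≫ fg.2)

/-- Append the vertex `(p, q)` to every chain. -/
def cone : PairChain n p q →+ PairChain (n + 1) p q :=
  Finsupp.mapDomain.addMonoidHom fun fg => (addLast fg.1, addLast fg.2)

end PairChain

end
open PairChain

/-- The signed sum of all `(p, q)`-shuffles if `n = p + q`, and `0` otherwise, by recursion on the
last step of the chain. If this step is horizontal, i.e. goes from `(p - 1, q)` to `(p, q)`, then it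
lies above the `q` vertical steps, which gives the sign `(-1) ^ q`; a vertical last step gives no
sign. Hence the total sign of a shuffle is `(-1) ^ m`, where `m` is the number of pairs consisting
of a vertical step and of a later horizontal step, i.e. it is the sign of the shuffle. -/
def shuffles : ∀ n p q : ℕ, PairChain n p q
  | 0, 0, 0 => Finsupp.single (𝟙 _, 𝟙 _) 1
  | 0, _ + 1, _ => 0
  | 0, 0, _ + 1 => 0
  | _ + 1, 0, 0 => 0
  | n + 1, p + 1, 0 => cone (push (SimplexCategory.δ (Fin.last (p + 1))) (𝟙 _) (shuffles n p 0))
  | n + 1, 0, q + 1 => cone (push (𝟙 _) (SimplexCategory.δ (Fin.last (q + 1))) (shuffles n 0 q))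
  | n + 1, p + 1, q + 1 =>
      cone ((-1) ^ (q + 1) •
          push (SimplexCategory.δ (Fin.last (p + 1))) (𝟙 _) (shuffles n p (q + 1)) +
        push (𝟙 _) (SimplexCategory.δ (Fin.last (q + 1))) (shuffles n (p + 1) q))

/-! The boundary of the sum of all shuffles. -/

/-- The alternating sum of the faces. -/
def boundary {n p q : ℕ} : PairChain (n + 1) p q →+ PairChain n p q :=
  ∑ i : Fin (n + 2), (-1 : ℤ) ^ (i : ℕ) • pull (SimplexCategory.δ i)

def dLeft {n p q : ℕ} : PairChain n p q →+ PairChain n (p + 1) q :=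
  ∑ i : Fin (p + 2), (-1 : ℤ) ^ (i : ℕ) • push (SimplexCategory.δ i) (𝟙 _)
def dRight {n p q : ℕ} : PairChain n p q →+ PairChain n p (q + 1) :=
  ∑ i : Fin (q + 2), (-1 : ℤ) ^ (i : ℕ) • push (𝟙 _) (SimplexCategory.δ i)
def initLeft {n p q : ℕ} : PairChain n p q →+ PairChain n (p + 1) q :=
  ∑ i : Fin (p + 1), (-1 : ℤ) ^ (i : ℕ) • push (SimplexCategory.δ i.castSucc) (𝟙 _)
def initRight {n p q : ℕ} : PairChain n p q →+ PairChain n p (q + 1) :=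
  ∑ i : Fin (q + 1), (-1 : ℤ) ^ (i : ℕ) • push (𝟙 _) (SimplexCategory.δ i.castSucc)
def lastLeft {n p q : ℕ} : PairChain n p q →+ PairChain n (p + 1) q :=
  push (SimplexCategory.δ (Fin.last (p + 1))) (𝟙 _)
def lastRight {n p q : ℕ} : PairChain n p q →+ PairChain n p (q + 1) :=
  push (𝟙 _) (SimplexCategory.δ (Fin.last (q + 1)))

def bdLeft (n : ℕ) : ∀ p q : ℕ, PairChain n p q
  | 0, _ => 0
  | p + 1, q => dLeft (shuffles n p q)
def bdRight (n : ℕ) : ∀ p q : ℕ, PairChain n p q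
  | _, 0 => 0
  | p, q + 1 => dRight (shuffles n p q)
def stepLeft (n : ℕ) : ∀ p q : ℕ, PairChain n p q
  | 0, _ => 0
  | p + 1, q => lastLeft (shuffles n p q)
def stepRight (n : ℕ) : ∀ p q : ℕ, PairChain n p q
  | _, 0 => 0
  | p, q + 1 => lastRight (shuffles n p q)

section
open scoped Simplicial
variable {n p q : ℕ}

@[simp] lemma push_single {p' q' : ℕ} (a : ⦋p⦌ ⟶ ⦋p'⦌) (b : ⦋q⦌ ⟶ ⦋q'⦌) (x) (c : ℤ) :
    push (n := n) a b (Finsupp.single x c) = Finsupp.single (x.1 ≫ a, x.2 ≫ b) c := by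
  simp [push, Finsupp.mapDomain.addMonoidHom]
@[simp] lemma pull_single {m : ℕ} (θ : ⦋m⦌ ⟶ ⦋n⦌) (x) (c : ℤ) :
    pull (p := p) (q := q) θ (Finsupp.single x c) = Finsupp.single (θ ≫ x.1, θ ≫ x.2) c := by
  simp [pull, Finsupp.mapDomain.addMonoidHom]
@[simp] lemma cone_single (x) (c : ℤ) :
    cone (n := n) (p := p) (q := q) (Finsupp.single x c) =
      Finsupp.single (addLast x.1, addLast x.2) c := by
  simp [cone, Finsupp.mapDomain.addMonoidHom]

lemma push_push {p' q' p'' q'' : ℕ} (a : ⦋p⦌ ⟶ ⦋p'⦌) (b : ⦋q⦌ ⟶ ⦋q'⦌) (a' : ⦋p'⦌ ⟶ ⦋p''⦌)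
    (b' : ⦋q'⦌ ⟶ ⦋q''⦌) (z : PairChain n p q) :
    push a' b' (push a b z) = push (a ≫ a') (b ≫ b') z := by
  induction z using Finsupp.induction_linear with
  | zero => simp
  | add x y hx hy => simp [hx, hy]
  | single x c => simp

lemma pull_push {m p' q' : ℕ} (a : ⦋p⦌ ⟶ ⦋p'⦌) (b : ⦋q⦌ ⟶ ⦋q'⦌) (θ : ⦋m⦌ ⟶ ⦋n⦌)
    (z : PairChain n p q) : pull θ (push a b z) = push a b (pull θ z) := by
  induction z using Finsupp.induction_linear with
  | zero => simp
  | add x y hx hy => simp [hx, hy]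
  | single x c => simp

lemma bd_push {p' q' : ℕ} (a : ⦋p⦌ ⟶ ⦋p'⦌) (b : ⦋q⦌ ⟶ ⦋q'⦌)
    (z : PairChain (n + 1) p q) : boundary (push a b z) = push a b (boundary z) := by
  simp [boundary, AddMonoidHom.finsetSum_apply, pull_push]

@[simp] lemma addLast_castSucc (f : ⦋n⦌ ⟶ ⦋p⦌) (j : Fin (n + 1)) :
    (addLast f).toOrderHom j.castSucc = f.toOrderHom j :=
  Fin.snoc_castSucc (α := fun _ => Fin (p + 1)) _ _ _
@[simp] lemma addLast_last (f : ⦋n⦌ ⟶ ⦋p⦌) :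
    (addLast f).toOrderHom (Fin.last (n + 1)) = Fin.last p :=
  Fin.snoc_last (α := fun _ => Fin (p + 1)) _ _

lemma addLast_comp_δ (f : ⦋n⦌ ⟶ ⦋p⦌) (i : Fin (p + 1)) :
    addLast f ≫ SimplexCategory.δ i.castSucc = addLast (f ≫ SimplexCategory.δ i.castSucc) := by
  ext j : 3
  change (i.castSucc).succAbove ((addLast f).toOrderHom j) = _
  induction j using Fin.lastCases with
  | last =>
    erw [addLast_last, addLast_last, Fin.succAbove_castSucc_of_le _ _ (Fin.le_last i), Fin.succ_last]
  | cast j => erw [addLast_castSucc, addLast_castSucc]; rfl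

lemma δ_comp_addLast (f : ⦋n + 1⦌ ⟶ ⦋p⦌) (i : Fin (n + 2)) :
    SimplexCategory.δ i.castSucc ≫ addLast f = addLast (SimplexCategory.δ i ≫ f) := by
  ext j : 3
  change (addLast f).toOrderHom ((i.castSucc).succAbove j) = _
  induction j using Fin.lastCases with
  | last =>
    erw [Fin.succAbove_castSucc_of_le _ _ (Fin.le_last i), Fin.succ_last, addLast_last, addLast_last]
  | cast j =>
    have : i.castSucc.succAbove (Fin.castSucc (n := n + 1) j) = (i.succAbove j).castSucc :=
      Fin.castSucc_succAbove_castSucc ..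
    erw [this, addLast_castSucc, addLast_castSucc]
    rfl

lemma δ_last_comp_addLast (f : ⦋n⦌ ⟶ ⦋p⦌) :
    SimplexCategory.δ (Fin.last (n + 1)) ≫ addLast f = f := by
  ext j : 3
  change (addLast f).toOrderHom ((Fin.last (n + 1)).succAbove j) = _
  erw [Fin.succAbove_last, addLast_castSucc]

lemma initL_cone (z : PairChain n p q) : initLeft (cone z) = cone (initLeft z) := by
  induction z using Finsupp.induction_linear with
  | zero => simp
  | add x y hx hy => simp [hx, hy]
  | single x c =>
    simp only [initLeft, AddMonoidHom.finsetSum_apply, AddMonoidHom.smul_apply, cone_single,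
      push_single, addLast_comp_δ, map_sum, map_zsmul, Category.comp_id]

lemma initR_cone (z : PairChain n p q) : initRight (cone z) = cone (initRight z) := by
  induction z using Finsupp.induction_linear with
  | zero => simp
  | add x y hx hy => simp [hx, hy]
  | single x c =>
    simp only [initRight, AddMonoidHom.finsetSum_apply, AddMonoidHom.smul_apply, cone_single,
      push_single, addLast_comp_δ, map_sum, map_zsmul, Category.comp_id]

lemma bd_cone (z : PairChain (n + 1) p q) : boundary (cone z) = cone (boundary z) + (-1 : ℤ) ^ n • z := by
  induction z using Finsupp.induction_linear with
  | zero => simp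
  | add x y hx hy => simp only [map_add, hx, hy, smul_add]; abel
  | single x c =>
    simp only [boundary, AddMonoidHom.finsetSum_apply, AddMonoidHom.smul_apply, cone_single, pull_single]
    rw [Fin.sum_univ_castSucc]
    simp only [δ_comp_addLast, δ_last_comp_addLast, map_sum, map_zsmul, cone_single,
      Fin.val_castSucc, Fin.val_last, pow_succ, mul_neg, mul_one, neg_neg, neg_smul]

lemma dL_eq (z : PairChain n p q) : dLeft z = initLeft z + (-1 : ℤ) ^ (p + 1) • lastLeft z := by
  simp [dLeft, initLeft, lastLeft, AddMonoidHom.finsetSum_apply, Fin.sum_univ_castSucc (n := p + 1)]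
lemma dR_eq (z : PairChain n p q) : dRight z = initRight z + (-1 : ℤ) ^ (q + 1) • lastRight z := by
  simp [dRight, initRight, lastRight, AddMonoidHom.finsetSum_apply, Fin.sum_univ_castSucc (n := q + 1)]

lemma initL_lastL (z : PairChain n p q) : initLeft (lastLeft z) = lastLeft (dLeft z) := by
  simp only [initLeft, lastLeft, dLeft, AddMonoidHom.finsetSum_apply, AddMonoidHom.smul_apply, push_push,
    map_sum, map_zsmul]
  refine Finset.sum_congr rfl fun i _ => ?_
  have := SimplexCategory.δ_comp_δ (Fin.le_last i)
  rw [Fin.succ_last] at this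
  rw [this]

lemma initR_lastR (z : PairChain n p q) : initRight (lastRight z) = lastRight (dRight z) := by
  simp only [initRight, lastRight, dRight, AddMonoidHom.finsetSum_apply, AddMonoidHom.smul_apply, push_push,
    map_sum, map_zsmul]
  refine Finset.sum_congr rfl fun i _ => ?_
  have := SimplexCategory.δ_comp_δ (Fin.le_last i)
  rw [Fin.succ_last] at this
  rw [this]

lemma initL_lastR (z : PairChain n p q) : initLeft (lastRight z) = lastRight (initLeft z) := by
  simp [initLeft, lastRight, AddMonoidHom.finsetSum_apply, push_push]
lemma initR_lastL (z : PairChain n p q) : initRight (lastLeft z) = lastLeft (initRight z) := by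
  simp [initRight, lastLeft, AddMonoidHom.finsetSum_apply, push_push]
lemma lastR_lastL (z : PairChain n p q) : lastRight (lastLeft z) = lastLeft (lastRight z) := by
  simp [lastRight, lastLeft, push_push]

end
section
variable {n p q : ℕ}
lemma shuffles_succ (n p q : ℕ) :
    shuffles (n + 1) p q = cone ((-1 : ℤ) ^ q • stepLeft n p q + stepRight n p q) := by
  rcases p with _ | p <;> rcases q with _ | q <;> simp [shuffles, stepLeft, stepRight, lastLeft, lastRight]

lemma initL_w1 (n p q : ℕ) : initLeft (stepLeft n p q) = lastLeft (bdLeft n p q) := by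
  rcases p with _ | p <;> simp [stepLeft, bdLeft, initL_lastL]
lemma initR_w2 (n p q : ℕ) : initRight (stepRight n p q) = lastRight (bdRight n p q) := by
  rcases q with _ | q <;> simp [stepRight, bdRight, initR_lastR]

lemma shuffles_eq_zero : ∀ n p q : ℕ, n ≠ p + q → shuffles n p q = 0
  | 0, 0, 0, h => absurd rfl h
  | 0, _ + 1, _, _ => by simp [shuffles]
  | 0, 0, _ + 1, _ => by simp [shuffles]
  | _ + 1, 0, 0, _ => by simp [shuffles]
  | n + 1, p + 1, 0, h => by simp [shuffles, shuffles_eq_zero n p 0 (by lia)]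
  | n + 1, 0, q + 1, h => by simp [shuffles, shuffles_eq_zero n 0 q (by lia)]
  | n + 1, p + 1, q + 1, h => by
    simp [shuffles, shuffles_eq_zero n p (q + 1) (by lia), shuffles_eq_zero n (p + 1) q (by lia)]

lemma bd_lastL (z : PairChain (n + 1) p q) : boundary (lastLeft z) = lastLeft (boundary z) := bd_push _ _ _
lemma bd_lastR (z : PairChain (n + 1) p q) : boundary (lastRight z) = lastRight (boundary z) := bd_push _ _ _

lemma neg_one_pow_smul (a : ℕ) {A : Type*} [AddCommGroup A] (z : A) :
    (-1 : ℤ) ^ a • (-1 : ℤ) ^ a • z = z := by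
  rw [smul_smul, ← mul_pow]; simp

lemma initL_shuffles (n p q : ℕ) : initLeft (shuffles (n + 1) p q) =
    cone ((-1 : ℤ) ^ q • lastLeft (bdLeft n p q) + initLeft (stepRight n p q)) := by
  rw [shuffles_succ, initL_cone, map_add, map_zsmul, initL_w1]
lemma initR_shuffles (n p q : ℕ) : initRight (shuffles (n + 1) p q) =
    cone ((-1 : ℤ) ^ q • initRight (stepLeft n p q) + lastRight (bdRight n p q)) := by
  rw [shuffles_succ, initR_cone, map_add, map_zsmul, initR_w2]

lemma Lt_zero (n q : ℕ) : bdLeft n 0 q = 0 := rfl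
lemma Lt_succ (n p q : ℕ) : bdLeft n (p + 1) q = dLeft (shuffles n p q) := rfl
lemma Rt_zero (n p : ℕ) : bdRight n p 0 = 0 := by cases p <;> rfl
lemma Rt_succ (n p q : ℕ) : bdRight n p (q + 1) = dRight (shuffles n p q) := by cases p <;> rfl
lemma w1_zero (n q : ℕ) : stepLeft n 0 q = 0 := rfl
lemma w1_succ (n p q : ℕ) : stepLeft n (p + 1) q = lastLeft (shuffles n p q) := rfl
lemma w2_zero (n p : ℕ) : stepRight n p 0 = 0 := by cases p <;> rfl
lemma w2_succ (n p q : ℕ) : stepRight n p (q + 1) = lastRight (shuffles n p q) := by cases p <;> rfl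

lemma Lt_eq_zero (n p q : ℕ) (h : n + 1 ≠ p + q) : bdLeft n p q = 0 := by
  rcases p with _ | p
  · rfl
  · simp [bdLeft, shuffles_eq_zero n p q (by lia)]
lemma Rt_eq_zero (n p q : ℕ) (h : n + 1 ≠ p + q) : bdRight n p q = 0 := by
  rcases q with _ | q
  · cases p <;> rfl
  · simp [bdRight, shuffles_eq_zero n p q (by lia)]

theorem bd_shuffles (n : ℕ) : ∀ p q : ℕ,
    boundary (shuffles (n + 1) p q) = bdLeft n p q + (-1 : ℤ) ^ p • bdRight n p q := by
  induction n with
  | zero =>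
    intro p q
    by_cases h : 1 = p + q
    swap
    · rw [shuffles_eq_zero _ _ _ h, Lt_eq_zero _ _ _ h, Rt_eq_zero _ _ _ h]; simp
    · obtain ⟨rfl, rfl⟩ | ⟨rfl, rfl⟩ : (p = 1 ∧ q = 0) ∨ (p = 0 ∧ q = 1) := by lia
      · have h0 : SimplexCategory.δ (n := 0) 0 ≫ addLast (SimplexCategory.δ (n := 0) 1) =
            SimplexCategory.δ 0 := by
          ext j : 3
          fin_cases j
          exact addLast_last (n := 0) (p := 1) (SimplexCategory.δ 1)
        have h1 : ∀ (f : SimplexCategory.mk 0 ⟶ SimplexCategory.mk 1),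
            SimplexCategory.δ 1 ≫ addLast f = f := fun f => δ_last_comp_addLast f
        have h2 : ∀ (f : SimplexCategory.mk 0 ⟶ SimplexCategory.mk 0), f = 𝟙 _ := fun f =>
          Subsingleton.elim _ _
        simp [shuffles, boundary, bdLeft, bdRight, dLeft, Fin.sum_univ_two]
        rw [h0, h1 (SimplexCategory.δ (n := 0) 1), h2 (SimplexCategory.δ (n := 0) 0 ≫ addLast (𝟙 _)),
          h2 (SimplexCategory.δ (n := 0) 1 ≫ addLast (𝟙 _))]
      · have h0 : SimplexCategory.δ (n := 0) 0 ≫ addLast (SimplexCategory.δ (n := 0) 1) =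
            SimplexCategory.δ 0 := by
          ext j : 3
          fin_cases j
          exact addLast_last (n := 0) (p := 1) (SimplexCategory.δ 1)
        have h1 : ∀ (f : SimplexCategory.mk 0 ⟶ SimplexCategory.mk 1),
            SimplexCategory.δ 1 ≫ addLast f = f := fun f => δ_last_comp_addLast f
        have h2 : ∀ (f : SimplexCategory.mk 0 ⟶ SimplexCategory.mk 0), f = 𝟙 _ := fun f =>
          Subsingleton.elim _ _
        simp [shuffles, boundary, bdLeft, bdRight, dRight, Fin.sum_univ_two]
        rw [h0, h1 (SimplexCategory.δ (n := 0) 1), h2 (SimplexCategory.δ (n := 0) 0 ≫ addLast (𝟙 _)),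
          h2 (SimplexCategory.δ (n := 0) 1 ≫ addLast (𝟙 _))]
  | succ n ih =>
    intro p q
    by_cases h : n + 2 = p + q
    swap
    · rw [shuffles_eq_zero _ _ _ h, Lt_eq_zero _ _ _ h, Rt_eq_zero _ _ _ h]; simp
    rw [shuffles_succ, bd_cone]
    rcases p with _ | p <;> rcases q with _ | q
    · omega
    · have e : (-1 : ℤ) ^ n = -(-1) ^ q := by rw [show q = n + 1 by omega, pow_succ]; simp
      simp only [w1_zero, w1_succ, w2_zero, w2_succ, Lt_zero, Rt_zero, Rt_succ, Lt_succ, map_add, map_zsmul, bd_lastL, bd_lastR, ih, smul_zero, zero_add,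
        map_zero, pow_zero, one_smul]
      rw [dR_eq, initR_shuffles]
      simp only [w1_zero, w1_succ, w2_zero, w2_succ, Lt_zero, Rt_zero, Rt_succ, Lt_succ, smul_zero, map_zero, zero_add, e, pow_succ]
      simp
    · have e : (-1 : ℤ) ^ n = -(-1) ^ p := by rw [show p = n + 1 by omega, pow_succ]; simp
      simp only [w1_zero, w1_succ, w2_zero, w2_succ, Lt_zero, Rt_zero, Rt_succ, Lt_succ, map_add, map_zsmul, bd_lastL, bd_lastR, ih, smul_zero, add_zero,
        map_zero, pow_zero, one_smul]
      rw [dL_eq, initL_shuffles]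
      simp only [w1_zero, w1_succ, w2_zero, w2_succ, Lt_zero, Rt_zero, Rt_succ, Lt_succ, smul_zero, map_zero, zero_add, e, pow_succ]
      simp
    · have e : (-1 : ℤ) ^ n = (-1) ^ p * (-1) ^ q := by
        rw [← pow_add, show p + q = n by omega]
      simp only [w1_succ, w2_succ, map_add, map_zsmul, bd_lastL, bd_lastR, ih]
      rw [Lt_succ (n + 1), Rt_succ (n + 1)]
      rw [dL_eq, dR_eq (shuffles (n + 1) (p + 1) q), initL_shuffles, initR_shuffles]
      simp only [w1_zero, w1_succ, w2_zero, w2_succ, Lt_zero, Rt_zero, Rt_succ, Lt_succ, dL_eq, dR_eq, initL_lastR, initR_lastL, map_add, map_zsmul,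
        lastR_lastL, e, pow_succ]
      obtain e1 | e1 := neg_one_pow_eq_or ℤ p <;> obtain e2 | e2 := neg_one_pow_eq_or ℤ q <;>
        simp only [e1, e2, one_mul, mul_one, mul_neg, neg_mul, neg_neg, one_smul, neg_smul,
          smul_add, map_add, map_neg, smul_neg, neg_add] <;> abel

end

/-! ### Singular chains -/
section Chains
open scoped Simplicial
variable (k : Type w) [CommRing k] (X Y : Type u) [TopologicalSpace X] [TopologicalSpace Y]

/-- The singular chain complex of `X` with coefficients in `k`. -/
abbrev SingularChains : ChainComplex (ModuleCat.{max w u} k) ℕ :=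
  ((singularChainComplexFunctor.{u} (ModuleCat.{max w u} k)).obj
    (ModuleCat.of k (ULift.{u} k))).obj (TopCat.of X)

/-- The singular homology `H_n(X; k)`. -/
abbrev SingularHomology (n : ℕ) : ModuleCat.{max w u} k :=
  ((singularHomologyFunctor.{u} (ModuleCat.{max w u} k) n).obj
    (ModuleCat.of k (ULift.{u} k))).obj (TopCat.of X)

/-- The singular `n`-simplices of `X`. -/
abbrev SingularSimplex (n : ℕ) : Type u := (TopCat.toSSet.{u}.obj (TopCat.of X)) _⦋n⦌

variable {X} in
/-- The basis element of `C_n(X)` given by a singular simplex. -/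
def simplexChain {n : ℕ} (σ : SingularSimplex X n) : (SingularChains k X).X n :=
  ((TopCat.toSSet.obj (TopCat.of X)).ιChainComplex (R := ModuleCat.of k (ULift.{u} k)) σ).hom
    (ULift.up 1)

variable {X} in
/-- The composite of a singular simplex with the affine map given by `θ`. -/
def simplexPull {m n : ℕ} (θ : ⦋m⦌ ⟶ ⦋n⦌) (σ : SingularSimplex X n) : SingularSimplex X m :=
  (TopCat.toSSet.obj (TopCat.of X)).map θ.op σ

variable {X Y} in
/-- The singular simplex `(σ, τ)` of `X × Y`. -/
def simplexPair {n : ℕ} (σ : SingularSimplex X n) (τ : SingularSimplex Y n) :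
    SingularSimplex (X × Y) n :=
  ((TopCat.of (X × Y)).toSSetObjEquiv _).symm
    (((TopCat.of X).toSSetObjEquiv _ σ).prodMk ((TopCat.of Y).toSSetObjEquiv _ τ))

variable {X Y} in
lemma simplexPull_pair {m n : ℕ} (θ : ⦋m⦌ ⟶ ⦋n⦌) (σ : SingularSimplex X n)
    (τ : SingularSimplex Y n) :
    simplexPull θ (simplexPair σ τ) = simplexPair (simplexPull θ σ) (simplexPull θ τ) := rfl

variable {X} {k} in
/-- The linear map on `C_n(X)` with prescribed values on the singular simplices. -/
def chainLift {n : ℕ} {M : Type max w u} [AddCommGroup M] [Module k M]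
    (φ : SingularSimplex X n → M) : (SingularChains k X).X n →ₗ[k] M :=
  (Limits.Sigma.desc (f := fun _ : SingularSimplex X n => ModuleCat.of k (ULift.{u} k))
    fun σ => ModuleCat.ofHom
      ((LinearMap.toSpanSingleton k M (φ σ)).comp ULift.moduleEquiv.toLinearMap)).hom

variable {X} {k} in
lemma chainLift_simplexChain {n : ℕ} {M : Type max w u} [AddCommGroup M] [Module k M]
    (φ : SingularSimplex X n → M) (σ : SingularSimplex X n) :
    chainLift φ (simplexChain k σ) = φ σ := by
  have := congr($(Limits.Sigma.ι_desc (f := fun _ : SingularSimplex X n =>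
    ModuleCat.of k (ULift.{u} k)) (fun σ => ModuleCat.ofHom
      ((LinearMap.toSpanSingleton k M (φ σ)).comp ULift.moduleEquiv.toLinearMap)) σ).hom
      (ULift.up 1))
  refine Eq.trans this ?_
  simp

variable {X} {k} in
lemma chain_ext {n : ℕ} {M : Type max w u} [AddCommGroup M] [Module k M]
    {f g : (SingularChains k X).X n →ₗ[k] M}
    (h : ∀ σ, f (simplexChain k σ) = g (simplexChain k σ)) : f = g := by
  suffices ModuleCat.ofHom f = ModuleCat.ofHom g from congr($(this).hom)
  refine SSet.chainComplex_hom_ext fun σ => ?_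
  ext x
  obtain ⟨x⟩ := x
  have e : (ULift.up x : ULift.{u} k) = x • ULift.up 1 := by ext; simp
  rw [e, map_smul, map_smul]
  exact congrArg (x • ·) (h σ)

variable {X} in
lemma d_simplexChain {n : ℕ} (σ : SingularSimplex X (n + 1)) :
    (SingularChains k X).d (n + 1) n (simplexChain k σ) =
      ∑ i : Fin (n + 2), (-1 : ℤ) ^ (i : ℕ) • simplexChain k (simplexPull (SimplexCategory.δ i) σ) := by
  have := congr($(SSet.ιChainComplex_d (TopCat.toSSet.obj (TopCat.of X))
    (ModuleCat.of k (ULift.{u} k)) σ).hom (ULift.up 1))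
  refine Eq.trans this ?_
  simp [ModuleCat.hom_sum]
  rfl


variable {X Y}

/-- The linear extension of `(f, g) ↦ (σ ∘ f, τ ∘ g)`. -/
def evalPair {n p q : ℕ} (σ : SingularSimplex X p) (τ : SingularSimplex Y q) :
    PairChain n p q →+ (SingularChains k (X × Y)).X n :=
  Finsupp.liftAddHom fun fg =>
    (zmultiplesHom _) (simplexChain k (simplexPair (simplexPull fg.1 σ) (simplexPull fg.2 τ)))

lemma evalPair_single {n p q : ℕ} (σ : SingularSimplex X p) (τ : SingularSimplex Y q) (fg) (c : ℤ) :
    evalPair (n := n) k σ τ (Finsupp.single fg c) =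
      c • simplexChain k (simplexPair (simplexPull fg.1 σ) (simplexPull fg.2 τ)) := by
  simp [evalPair]

lemma simplexPull_comp {m n p : ℕ} (θ : ⦋m⦌ ⟶ ⦋n⦌) (η : ⦋n⦌ ⟶ ⦋p⦌) (σ : SingularSimplex X p) :
    simplexPull (θ ≫ η) σ = simplexPull θ (simplexPull η σ) := by
  simp [simplexPull]

lemma simplexPull_id {p : ℕ} (σ : SingularSimplex X p) :
    simplexPull (𝟙 _) σ = σ := by
  simp [simplexPull]

lemma evalPair_push {n p q p' q' : ℕ} (σ : SingularSimplex X p') (τ : SingularSimplex Y q')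
    (a : ⦋p⦌ ⟶ ⦋p'⦌) (b : ⦋q⦌ ⟶ ⦋q'⦌) (z : PairChain n p q) :
    evalPair k σ τ (push a b z) = evalPair k (simplexPull a σ) (simplexPull b τ) z := by
  induction z using Finsupp.induction_linear with
  | zero => simp
  | add x y hx hy => simp only [map_add, hx, hy]
  | single x c => simp only [push_single, evalPair_single, simplexPull_comp]

lemma d_evalPair {n p q : ℕ} (σ : SingularSimplex X p) (τ : SingularSimplex Y q)
    (z : PairChain (n + 1) p q) :
    (SingularChains k (X × Y)).d (n + 1) n (evalPair k σ τ z) = evalPair k σ τ (boundary z) := by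
  induction z using Finsupp.induction_linear with
  | zero => simp
  | add x y hx hy => simp only [map_add, hx, hy]
  | single x c =>
    simp only [boundary, AddMonoidHom.finsetSum_apply, AddMonoidHom.smul_apply, map_sum, map_zsmul,
      pull_single, evalPair_single, d_simplexChain, simplexPull_pair, simplexPull_comp,
      Finset.smul_sum]
    refine Finset.sum_congr rfl fun i _ => ?_
    rw [smul_comm]

/-- The Eilenberg-Zilber cross product `C_p(X) × C_q(Y) → C_n(X × Y)` of singular chains, where
`n = p + q` (it is zero for the other values of `n`). -/
def chainCross (n p q : ℕ) : (SingularChains k X).X p →ₗ[k]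
    (SingularChains k Y).X q →ₗ[k] (SingularChains k (X × Y)).X n :=
  chainLift fun σ => chainLift fun τ => evalPair k σ τ (shuffles n p q)

lemma chainCross_simplex {n p q : ℕ} (σ : SingularSimplex X p) (τ : SingularSimplex Y q) :
    chainCross k n p q (simplexChain k σ) (simplexChain k τ) = evalPair k σ τ (shuffles n p q) := by
  rw [chainCross, chainLift_simplexChain, chainLift_simplexChain]

/-- The Leibniz rule `∂(a × b) = ∂a × b + (-1) ^ p a × ∂b`. -/
theorem d_chainCross (n p q : ℕ) (a : (SingularChains k X).X p) (b : (SingularChains k Y).X q) :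
    (SingularChains k (X × Y)).d (n + 1) n (chainCross k (n + 1) p q a b) =
      chainCross k n (p - 1) q ((SingularChains k X).d p (p - 1) a) b +
      (-1 : ℤ) ^ p • chainCross k n p (q - 1) a ((SingularChains k Y).d q (q - 1) b) := by
  have key : (chainCross k (n + 1) p q (X := X) (Y := Y)).compr₂
        ((SingularChains k (X × Y)).d (n + 1) n).hom =
      (chainCross k n (p - 1) q).comp ((SingularChains k X).d p (p - 1)).hom +
      (-1 : ℤ) ^ p • (chainCross k n p (q - 1)).compl₂ ((SingularChains k Y).d q (q - 1)).hom := by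
    refine chain_ext fun σ => chain_ext fun τ => ?_
    simp only [LinearMap.compr₂_apply, LinearMap.add_apply, LinearMap.comp_apply,
      LinearMap.smul_apply, LinearMap.compl₂_apply]
    rw [chainCross_simplex]
    refine (d_evalPair k σ τ _).trans ?_
    rw [bd_shuffles, map_add, map_zsmul]
    congr 1
    · rcases p with _ | p
      · have : (SingularChains k X).d 0 (0 - 1) = 0 := (SingularChains k X).shape _ _ (by simp)
        rw [Lt_zero, this]
        simp
      · rw [Lt_succ]
        change _ = chainCross k n p q ((SingularChains k X).d (p + 1) p (simplexChain k σ)) _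
        rw [d_simplexChain]
        simp only [dLeft, AddMonoidHom.finsetSum_apply, AddMonoidHom.smul_apply, map_sum, map_zsmul,
          LinearMap.sum_apply, LinearMap.smul_apply, chainCross_simplex, evalPair_push,
          simplexPull_id]
    · congr 1
      rcases q with _ | q
      · have : (SingularChains k Y).d 0 (0 - 1) = 0 := (SingularChains k Y).shape _ _ (by simp)
        rw [Rt_zero, this]
        simp
      · rw [Rt_succ]
        change _ = chainCross k n p q _ ((SingularChains k Y).d (q + 1) q (simplexChain k τ))
        rw [d_simplexChain]
        simp only [dRight, AddMonoidHom.finsetSum_apply, AddMonoidHom.smul_apply, map_sum, map_zsmul,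
          chainCross_simplex, evalPair_push, simplexPull_id]
  exact congr($key a b)

end Chains

/-! ### Homology classes -/
section Homology
variable {k : Type w} [CommRing k] (K : ChainComplex (ModuleCat.{max w u} k) ℕ)

/-- The module of `n`-cycles; for `n = 0` the differential `K.d 0 0` is zero. -/
abbrev Cycles (n : ℕ) : Submodule k (K.X n) := LinearMap.ker (K.d n (n - 1)).hom

lemma next_down (n : ℕ) : (ComplexShape.down ℕ).next n = n - 1 := by
  cases n with
  | zero => exact ChainComplex.next_nat_zero
  | succ n => exact ChainComplex.next_nat_succ n

/-- The comparison with the cycles of Mathlib. -/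
def cyclesLift (n : ℕ) : ModuleCat.of k (Cycles K n) ⟶ K.cycles n :=
  K.liftCycles (ModuleCat.ofHom (Cycles K n).subtype) (n - 1) (next_down n) (by
    ext x; exact x.2)

/-- The homology class of a cycle. -/
def homologyClass (n : ℕ) : Cycles K n →ₗ[k] K.homology n :=
  (cyclesLift K n ≫ K.homologyπ n).hom

lemma homologyClass_surjective (n : ℕ) : Function.Surjective (homologyClass K n) := by
  intro x
  obtain ⟨z, rfl⟩ := (ModuleCat.epi_iff_surjective (K.homologyπ n)).1 inferInstance x
  have hz : K.d n (n - 1) (K.iCycles n z) = 0 := congr($(K.iCycles_d n (n - 1)).hom z)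
  refine ⟨⟨K.iCycles n z, hz⟩, ?_⟩
  · change K.homologyπ n (cyclesLift K n _) = K.homologyπ n z
    congr 1
    apply (ModuleCat.mono_iff_injective (K.iCycles n)).1 inferInstance
    exact congr($(K.liftCycles_i (ModuleCat.ofHom (Cycles K n).subtype) (n - 1) (next_down n)
      (by ext x; exact x.2)).hom ⟨K.iCycles n z, hz⟩)

lemma boundary_mem (n : ℕ) (a : K.X (n + 1)) : K.d (n + 1) n a ∈ Cycles K n :=
  congr($(K.d_comp_d (n + 1) n (n - 1)).hom a)

lemma homologyClass_eq_zero_iff (n : ℕ) (z : Cycles K n) :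
    homologyClass K n z = 0 ↔ ∃ a, K.d (n + 1) n a = z.1 := by
  have hi : ∀ z, K.iCycles n (cyclesLift K n z) = z.1 := fun z =>
    congr($(K.liftCycles_i (ModuleCat.ofHom (Cycles K n).subtype) (n - 1) (next_down n) _).hom z)
  have hinj := (ModuleCat.mono_iff_injective (K.iCycles n)).1 inferInstance
  have hto : ∀ a, K.iCycles n (K.toCycles (n + 1) n a) = K.d (n + 1) n a := fun a =>
    congr($(K.toCycles_i (n + 1) n).hom a)
  have hex : (ShortComplex.mk _ _ (K.toCycles_comp_homologyπ (n + 1) n)).Exact :=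
    ShortComplex.exact_of_g_is_cokernel _ (K.homologyIsCokernel (n + 1) n (by simp))
  constructor
  · intro h
    obtain ⟨a, ha⟩ := (ShortComplex.moduleCat_exact_iff _).1 hex (cyclesLift K n z) h
    refine ⟨a, ?_⟩
    rw [← hto, ← hi]
    exact congrArg _ ha
  · rintro ⟨a, ha⟩
    have : cyclesLift K n z = K.toCycles (n + 1) n a := hinj (by rw [hi, hto, ha])
    change K.homologyπ n (cyclesLift K n z) = 0
    rw [this]
    exact congr($(K.toCycles_comp_homologyπ (n + 1) n).hom a)

/-- A linear map on cycles which vanishes on boundaries induces a map on homology. -/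
def homologyDesc (n : ℕ) {M : Type*} [AddCommGroup M] [Module k M] (f : Cycles K n →ₗ[k] M)
    (hf : ∀ a, f ⟨K.d (n + 1) n a, boundary_mem K n a⟩ = 0) : K.homology n →ₗ[k] M :=
  ((LinearMap.ker (homologyClass K n)).liftQ f (by
    intro z hz
    obtain ⟨a, ha⟩ := (homologyClass_eq_zero_iff K n z).1 hz
    have : z = ⟨K.d (n + 1) n a, boundary_mem K n a⟩ := Subtype.ext ha.symm
    rw [LinearMap.mem_ker, this, hf])).comp
  ((homologyClass K n).quotKerEquivOfSurjective (homologyClass_surjective K n)).symm.toLinearMap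

lemma homologyDesc_class (n : ℕ) {M : Type*} [AddCommGroup M] [Module k M] (f : Cycles K n →ₗ[k] M)
    (hf) (z) : homologyDesc K n f hf (homologyClass K n z) = f z := by
  have : ((homologyClass K n).quotKerEquivOfSurjective (homologyClass_surjective K n)).symm
      (homologyClass K n z) = Submodule.Quotient.mk z := by
    rw [LinearEquiv.symm_apply_eq]; rfl
  rw [homologyDesc, LinearMap.comp_apply, LinearEquiv.coe_coe, this]
  rfl

/-- A bilinear map on cycles which vanishes when one argument is a boundary induces a bilinear map
on homology. -/
def homologyDesc₂ (L : ChainComplex (ModuleCat.{max w u} k) ℕ) (p q : ℕ) {M : Type*}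
    [AddCommGroup M] [Module k M] (f : Cycles K p →ₗ[k] Cycles L q →ₗ[k] M)
    (hl : ∀ a b, f ⟨K.d (p + 1) p a, boundary_mem K p a⟩ b = 0)
    (hr : ∀ a b, f a ⟨L.d (q + 1) q b, boundary_mem L q b⟩ = 0) :
    K.homology p →ₗ[k] L.homology q →ₗ[k] M :=
  homologyDesc K p
    { toFun := fun a => homologyDesc L q (f a) (hr a)
      map_add' := fun a a' => by
        refine LinearMap.ext fun y => ?_
        obtain ⟨b, rfl⟩ := homologyClass_surjective _ _ y
        simp only [LinearMap.add_apply, homologyDesc_class, map_add]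
      map_smul' := fun c a => by
        refine LinearMap.ext fun y => ?_
        obtain ⟨b, rfl⟩ := homologyClass_surjective _ _ y
        simp only [LinearMap.smul_apply, homologyDesc_class, map_smul, RingHom.id_apply] }
    (fun a => by
      refine LinearMap.ext fun y => ?_
      obtain ⟨b, rfl⟩ := homologyClass_surjective _ _ y
      exact (homologyDesc_class L q _ (hr _) b).trans (hl a b))

lemma homologyDesc₂_class (L : ChainComplex (ModuleCat.{max w u} k) ℕ) (p q : ℕ) {M : Type*}
    [AddCommGroup M] [Module k M] (f : Cycles K p →ₗ[k] Cycles L q →ₗ[k] M) (hl) (hr) (a) (b) :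
    homologyDesc₂ K L p q f hl hr (homologyClass K p a) (homologyClass L q b) = f a b := by
  rw [homologyDesc₂, homologyDesc_class]
  exact homologyDesc_class L q _ (hr _) b
end Homology

section Cross
variable (k : Type w) [CommRing k] (X Y : Type u) [TopologicalSpace X] [TopologicalSpace Y]

variable {X Y} in
lemma chainCross_mem {p q : ℕ} (a : Cycles (SingularChains k X) p)
    (b : Cycles (SingularChains k Y) q) :
    chainCross k (p + q) p q a.1 b.1 ∈ Cycles (SingularChains k (X × Y)) (p + q) := by
  obtain ⟨a, ha⟩ := a
  obtain ⟨b, hb⟩ := b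
  rcases h : p + q with _ | n
  · have : (SingularChains k (X × Y)).d 0 (0 - 1) = 0 := HomologicalComplex.shape _ _ _ (by simp)
    simp [Cycles, this]
  · have ha' : (SingularChains k X).d p (p - 1) a = 0 := ha
    have hb' : (SingularChains k Y).d q (q - 1) b = 0 := hb
    refine (d_chainCross k n p q a b).trans ?_
    rw [ha', hb']; simp

/-- The cross product of cycles. -/
def cycleCross (p q : ℕ) : Cycles (SingularChains k X) p →ₗ[k] Cycles (SingularChains k Y) q →ₗ[k]
    Cycles (SingularChains k (X × Y)) (p + q) :=
  LinearMap.mk₂ k (fun a b => ⟨chainCross k (p + q) p q a.1 b.1, chainCross_mem k a b⟩)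
    (fun _ _ _ => by ext; simp) (fun _ _ _ => by ext; simp) (fun _ _ _ => by ext; simp)
    (fun _ _ _ => by ext; simp)

lemma class_cycleCross_boundary_right (p q : ℕ) (a : Cycles (SingularChains k X) p)
    (b : (SingularChains k Y).X (q + 1)) :
    homologyClass _ _ (cycleCross k X Y p q a
      ⟨(SingularChains k Y).d (q + 1) q b, boundary_mem _ q b⟩) = 0 := by
  rw [homologyClass_eq_zero_iff]
  refine ⟨(-1 : ℤ) ^ p • chainCross k (p + q + 1) p (q + 1) a.1 b, ?_⟩
  have ha : (SingularChains k X).d p (p - 1) a.1 = 0 := a.2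
  have := d_chainCross k (p + q) p (q + 1) a.1 b
  rw [map_zsmul, this, ha, map_zero, LinearMap.zero_apply, zero_add, neg_one_pow_smul]
  rfl

lemma class_cycleCross_boundary_left (p q : ℕ) (a : (SingularChains k X).X (p + 1))
    (b : Cycles (SingularChains k Y) q) :
    homologyClass _ _ (cycleCross k X Y p q
      ⟨(SingularChains k X).d (p + 1) p a, boundary_mem _ p a⟩ b) = 0 := by
  rw [homologyClass_eq_zero_iff]
  refine ⟨chainCross k (p + q + 1) (p + 1) q a b.1, ?_⟩
  have hb : (SingularChains k Y).d q (q - 1) b.1 = 0 := b.2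
  have := d_chainCross k (p + q) (p + 1) q a b.1
  rw [this, hb, map_zero, smul_zero, add_zero]
  rfl

/-- The cross product in homology. -/
def homologyCross (p q : ℕ) : SingularHomology k X p →ₗ[k] SingularHomology k Y q →ₗ[k]
    SingularHomology k (X × Y) (p + q) :=
  homologyDesc₂ (SingularChains k X) (SingularChains k Y) p q
    ((cycleCross k X Y p q).compr₂ (homologyClass (SingularChains k (X × Y)) (p + q)))
    (class_cycleCross_boundary_left k X Y p q) (class_cycleCross_boundary_right k X Y p q)

/-- The cross product of the classes of two cycles is the class of their cross product. -/
theorem homologyCross_class (p q : ℕ) (a : Cycles (SingularChains k X) p)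
    (b : Cycles (SingularChains k Y) q) :
    homologyCross k X Y p q (homologyClass _ p a) (homologyClass _ q b) =
      homologyClass _ (p + q)
        ⟨chainCross k (p + q) p q a.1 b.1, chainCross_mem k a b⟩ :=
  homologyDesc₂_class ..

open scoped DirectSum TensorProduct

/-- The total singular homology `H_*(X)`. -/
abbrev TotalHomology : Type max w u := ⨁ n : ℕ, SingularHomology k X n

variable {X Y} in
/-- The map induced in homology by a continuous map. -/
def homologyMap (f : C(X, Y)) : TotalHomology k X →ₗ[k] TotalHomology k Y :=
  DirectSum.lmap fun n =>
    (((singularHomologyFunctor.{u} (ModuleCat.{max w u} k) n).obj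
      (ModuleCat.of k (ULift.{u} k))).map (TopCat.ofHom f)).hom

/-- The Künneth morphism `H_*(X) ⊗ H_*(Y) → H_*(X × Y)`, i.e. the cross product. -/
def kunneth : TotalHomology k X ⊗[k] TotalHomology k Y →ₗ[k] TotalHomology k (X × Y) :=
  TensorProduct.lift <| DirectSum.toModule k ℕ _ fun p => LinearMap.flip <|
    DirectSum.toModule k ℕ _ fun q => LinearMap.flip <|
      (homologyCross k X Y p q).compr₂ (DirectSum.lof k ℕ (fun n => SingularHomology k (X × Y) n) (p + q))

theorem kunneth_lof (p q : ℕ) (a : SingularHomology k X p) (b : SingularHomology k Y q) :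
    kunneth k X Y (DirectSum.lof k ℕ _ p a ⊗ₜ DirectSum.lof k ℕ _ q b) =
      DirectSum.lof k ℕ (fun n => SingularHomology k (X × Y) n) (p + q)
        (homologyCross k X Y p q a b) := by
  simp [kunneth]

/-- The diagonal `Δ : H_*(X) → H_*(X) ⊗ H_*(X)`, the map induced by `x ↦ (x, x)` followed by the
inverse of the Künneth isomorphism. -/
def diagonal (h : Function.Bijective (kunneth k X X)) :
    TotalHomology k X →ₗ[k] TotalHomology k X ⊗[k] TotalHomology k X :=
  (LinearEquiv.ofBijective _ h).symm.toLinearMap.comp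
    (homologyMap k ((ContinuousMap.id X).prodMk (ContinuousMap.id X)))

/-- The linear map `a ↦ (-1) ^ |a| a`. -/
def degreeSign : TotalHomology k X →ₗ[k] TotalHomology k X :=
  DirectSum.lmap fun n => (-1 : k) ^ n • LinearMap.id

/-! ### The circle -/

/-- The circle `S¹ = ℝ / ℤ`. -/
abbrev Circle1 : Type u := ULift.{u} UnitAddCircle

/-- The singular simplex `Δ¹ → S¹` given by `[0, 1] → ℝ / ℤ`. -/
def circleSimplex : SingularSimplex Circle1.{u} 1 :=
  ((TopCat.of Circle1.{u}).toSSetObjEquiv _).symm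
    ⟨fun v => ULift.up ((v.1 1 : ℝ) : UnitAddCircle), by
      refine continuous_uliftUp.comp ((AddCircle.continuous_mk' _).comp ?_)
      exact (continuous_apply (1 : Fin 2)).comp continuous_subtype_val⟩

lemma circleSimplex_mem :
    simplexChain k circleSimplex.{u} ∈ Cycles (SingularChains k Circle1.{u}) 1 := by
  change (SingularChains k Circle1.{u}).d (0 + 1) 0 (simplexChain k circleSimplex.{u}) = 0
  rw [d_simplexChain]
  have : simplexPull (SimplexCategory.δ (n := 0) 0) circleSimplex.{u} =
      simplexPull (SimplexCategory.δ (n := 0) 1) circleSimplex.{u} := by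
    apply ((TopCat.of Circle1.{u}).toSSetObjEquiv _).injective
    refine ContinuousMap.ext fun v => ?_
    obtain rfl : v = stdSimplex.vertex (S := ℝ) (0 : Fin 1) :=
      Subsingleton.elim (α := stdSimplex ℝ (Fin 1)) _ _
    change ULift.up (((stdSimplex.map (SimplexCategory.δ (n := 0) 0).toOrderHom
        (stdSimplex.vertex (S := ℝ) (0 : Fin 1))).1 1 : ℝ) : UnitAddCircle) =
      ULift.up (((stdSimplex.map (SimplexCategory.δ (n := 0) 1).toOrderHom
        (stdSimplex.vertex (S := ℝ) (0 : Fin 1))).1 1 : ℝ) : UnitAddCircle)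
    have h0 : (SimplexCategory.δ (n := 0) 0).toOrderHom (0 : Fin 1) = (1 : Fin 2) := rfl
    have h1 : (SimplexCategory.δ (n := 0) 1).toOrderHom (0 : Fin 1) = (0 : Fin 2) := rfl
    rw [stdSimplex.map_vertex, stdSimplex.map_vertex, h0, h1]
    simp [stdSimplex.vertex]
  simp [Fin.sum_univ_two, this]

/-- The fundamental class `[S¹] ∈ H_1(S¹)`. -/
def circleClass : TotalHomology k Circle1.{u} :=
  DirectSum.lof k ℕ (fun n => SingularHomology k Circle1.{u} n) 1
    (homologyClass (SingularChains k Circle1.{u}) 1 ⟨simplexChain k circleSimplex, circleSimplex_mem k⟩)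

/-- For a continuous map `φ : S¹ × Y → Z`, the operator `H_*(Y) → H_{* + 1}(Z)`,
`a ↦ φ_*([S¹] × a)`. If `φ` is an action of the circle on `Y` up to homotopy, this is the operator
`B` given by the action of `H_*(S¹)` on `H_*(Y)`. -/
def circleOperator {Y Z : Type u} [TopologicalSpace Y] [TopologicalSpace Z]
    (φ : C(Circle1.{u} × Y, Z)) : TotalHomology k Y →ₗ[k] TotalHomology k Z :=
  (homologyMap k φ).comp ((kunneth k Circle1.{u} Y).comp
    (TensorProduct.mk k _ _ (circleClass k)))

end Cross

/-! ### Loop spaces of `H`-groups -/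

section Loops
open scoped unitInterval

/-- An `H`-group: a pointed space with a continuous multiplication for which the base point is a
homotopy unit, which is homotopy associative and has a homotopy inverse, all homotopies being
relative to the base point. -/
class HGroup (G : Type u) [TopologicalSpace G] extends HSpace G where
  hinv : C(G, G)
  hinv_e : hinv e = e
  hmul_assoc : ContinuousMap.HomotopicRel
    (⟨fun p => hmul (hmul (p.1, p.2.1), p.2.2), by fun_prop⟩ : C(G × G × G, G))
    ⟨fun p => hmul (p.1, hmul (p.2.1, p.2.2)), by fun_prop⟩ {(e, e, e)}
  hmul_hinv : ContinuousMap.HomotopicRel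
    (⟨fun g => hmul (g, hinv g), by fun_prop⟩ : C(G, G)) (.const G e) {e}
  hinv_hmul : ContinuousMap.HomotopicRel
    (⟨fun g => hmul (hinv g, g), by fun_prop⟩ : C(G, G)) (.const G e) {e}

/-- A (left) action up to homotopy of an `H`-group `G` on a space `X`. -/
structure HomotopyAction (G X : Type u) [TopologicalSpace G] [TopologicalSpace X] [HGroup G] where
  act : C(G × X, X)
  unit_act : ContinuousMap.Homotopic
    (⟨fun x => act (HSpace.e, x), by fun_prop⟩ : C(X, X)) (.id X)
  mul_act : ContinuousMap.Homotopic
    (⟨fun p => act (HSpace.hmul (p.1, p.2.1), p.2.2), by fun_prop⟩ : C(G × G × X, X))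
    ⟨fun p => act (p.1, act (p.2.1, p.2.2)), by fun_prop⟩

/-- The free loop space `LX`, with the compact-open topology. -/
abbrev FreeLoops (X : Type u) [TopologicalSpace X] : Type u := C(UnitAddCircle, X)

/-- The space `ΩX` of loops based at `x₀`, a subspace of `LX`. -/
abbrev BasedLoops (X : Type u) [TopologicalSpace X] (x₀ : X) : Type u :=
  {w : FreeLoops X // w 0 = x₀}

/-- The space `ΩG` of loops at the base point of an `H`-group. -/
abbrev Loops (G : Type u) [TopologicalSpace G] [HGroup G] : Type u :=
  BasedLoops G HSpace.e

/-- The circle action on `LX` by rotation, `(s, l) ↦ (t ↦ l (t + s))`. -/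
def rotation (X : Type u) [TopologicalSpace X] : C(Circle1.{u} × FreeLoops X, FreeLoops X) :=
  ContinuousMap.curry ⟨fun p => p.1.2 (p.2 + p.1.1.down), by fun_prop⟩

/-- The evaluation map `σ : S¹ × ΩX → X`, `(s, w) ↦ w s`. -/
def evalLoop (X : Type u) [TopologicalSpace X] (x₀ : X) : C(Circle1.{u} × BasedLoops X x₀, X) :=
  ⟨fun p => p.2.1 p.1.down, by fun_prop⟩

variable (G : Type u) [TopologicalSpace G] [HGroup G]

/-- The self map of `LG` which sends a loop `l` to the loop `t ↦ l(t) l(0)⁻¹`. -/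
def translateLoop : C(FreeLoops G, FreeLoops G) :=
  ContinuousMap.curry ⟨fun p => HSpace.hmul (p.1 p.2, HGroup.hinv (p.1 0)), by fun_prop⟩

variable {G}

/-- The property that characterises the retraction `r : LG → ΩG` of the inclusion `j : ΩG → LG` up to
homotopy: `j ∘ r` is homotopic to the map `l ↦ (t ↦ l(t) l(0)⁻¹)`. -/
def IsLoopRetraction (r : C(FreeLoops G, Loops G)) : Prop :=
  ContinuousMap.Homotopic ((⟨Subtype.val, continuous_subtype_val⟩ : C(Loops G, FreeLoops G)).comp r)
    (translateLoop G)

/-- A homotopy, for `s ∈ [0, 1]`, from the identity of the circle to a map which is constant near the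
base point. -/
def collapse (s : ℝ) (θ : UnitAddCircle) : UnitAddCircle :=
  θ + ((s * (‖θ - ((1 / 4 : ℝ) : UnitAddCircle)‖ - 1 / 4) : ℝ) : UnitAddCircle)

@[fun_prop] lemma continuous_coe_circle : Continuous fun x : ℝ => (x : UnitAddCircle) :=
  AddCircle.continuous_mk' _

lemma continuous_collapse : Continuous fun p : ℝ × UnitAddCircle => collapse p.1 p.2 := by
  unfold collapse
  exact continuous_snd.add (continuous_coe_circle.comp (by fun_prop))

lemma collapse_one {θ : UnitAddCircle} (h : ‖θ‖ ≤ 1 / 4) : collapse 1 θ = 0 := by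
  obtain ⟨x, rfl, hx⟩ : ∃ x : ℝ, (x : UnitAddCircle) = θ ∧ |x| ≤ 1 / 4 := by
    induction θ using QuotientAddGroup.induction_on with
    | H y =>
      refine ⟨y - round y, ?_, ?_⟩
      · rw [AddCircle.coe_sub]
        simp
      · rw [← UnitAddCircle.norm_eq]; exact h
  have hx' := abs_le.1 hx
  have : ‖((x : UnitAddCircle) - ((1 / 4 : ℝ) : UnitAddCircle))‖ = 1 / 4 - x := by
    rw [← AddCircle.coe_sub, (AddCircle.norm_coe_eq_abs_iff (1 : ℝ) one_ne_zero).2]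
    · rw [abs_of_nonpos (by linarith)]; ring
    · rw [abs_le]; constructor <;> norm_num <;> linarith
  rw [collapse, this, ← AddCircle.coe_add]
  simp

lemma collapse_zero (θ : UnitAddCircle) : collapse 0 θ = θ := by simp [collapse]

/-- Such a retraction always exists. -/
theorem exists_isLoopRetraction : ∃ r : C(FreeLoops G, Loops G), IsLoopRetraction r := by
  obtain ⟨h⟩ := (HGroup.hmul_hinv (G := G)).homotopic
  have h0 : ∀ g, h (0, g) = HSpace.hmul (g, HGroup.hinv g) := h.map_zero_left
  have h1 : ∀ g, h (1, g) = HSpace.e := h.map_one_left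
  let v : UnitAddCircle → I := fun θ => Set.projIcc 0 1 zero_le_one (1 - 4 * ‖θ‖)
  have hv : Continuous v := continuous_projIcc.comp (by fun_prop)
  have hv0 : v 0 = 1 := by simp [v]
  have hv1 : ∀ θ, ‖θ‖ = 1 / 4 → v θ = 0 := fun θ h => by simp [v, h]
  let K : C((I × FreeLoops G) × UnitAddCircle, G) :=
    ⟨fun p => if ‖p.2‖ ≤ 1 / 4 then h (p.1.1 * v p.2, p.1.2 0)
      else HSpace.hmul (p.1.2 (collapse 1 p.2), HGroup.hinv (p.1.2 0)), by
      have := continuous_collapse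
      refine Continuous.if_le ?_ ?_ (by fun_prop) (by fun_prop) ?_
      · fun_prop
      · have : Continuous fun p : (I × FreeLoops G) × UnitAddCircle => collapse 1 p.2 :=
          continuous_collapse.comp (continuous_const.prodMk continuous_snd)
        fun_prop
      · intro p hp
        rw [hv1 _ hp, mul_zero, h0, collapse_one hp.le]⟩
  let M : C((I × FreeLoops G) × UnitAddCircle, G) :=
    ⟨fun p => HSpace.hmul (p.1.2 (collapse p.1.1 p.2), HGroup.hinv (p.1.2 0)), by
      have : Continuous fun p : (I × FreeLoops G) × UnitAddCircle => collapse p.1.1 p.2 :=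
        continuous_collapse.comp (f := fun p : (I × FreeLoops G) × UnitAddCircle =>
          ((p.1.1 : ℝ), p.2)) (by fun_prop)
      fun_prop⟩
  refine ⟨⟨fun l => ⟨K.curry (1, l), ?_⟩, ?_⟩, ?_⟩
  · simp [K, hv0, h1]
  · exact Continuous.subtype_mk (by fun_prop) _
  refine ContinuousMap.Homotopic.trans (g := ⟨fun l => M.curry (1, l), by fun_prop⟩)
    (.symm ⟨⟨⟨fun p => K.curry p, by fun_prop⟩, ?_, ?_⟩⟩)
    (.symm ⟨⟨⟨fun p => M.curry p, by fun_prop⟩, ?_, ?_⟩⟩)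
  · intro l
    ext θ
    by_cases hθ : ‖θ‖ ≤ 1 / 4
    · simp only [one_div] at hθ
      simp [K, M, hθ, h0, collapse_one]
    · simp only [one_div] at hθ
      simp [K, M, hθ]
  · intro l; rfl
  · intro l
    ext θ
    simp [M, collapse_zero, translateLoop]
  · intro l; rfl

variable {X : Type u} [TopologicalSpace X]

/-- The circle action up to homotopy on `ΩG`, the composite
`S¹ × ΩG → S¹ × LG → LG → ΩG` of `j`, the rotation of free loops and `r`. -/
def loopAction (r : C(FreeLoops G, Loops G)) : C(Circle1.{u} × Loops G, Loops G) :=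
  (r.comp (rotation G)).comp ⟨fun p => (p.1, p.2.1), by fun_prop⟩

/-- The circle action up to homotopy on `ΩG × X`, `s • (w, x) = (s • w, w(s) x)`. -/
def loopProdAction (r : C(FreeLoops G, Loops G)) (α : HomotopyAction G X) :
    C(Circle1.{u} × (Loops G × X), Loops G × X) :=
  ⟨fun p => (loopAction r (p.1, p.2.1), α.act (evalLoop G HSpace.e (p.1, p.2.1), p.2.2)),
    by fun_prop⟩

end Loops

section Operators
open scoped TensorProduct
variable (k : Type w) [CommRing k]

/-- The homology suspension `σ_* : H_*(ΩX) → H_{* + 1}(X)`, `a ↦ H_*(σ)([S¹] × a)`, where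
`σ : S¹ × ΩX → X` is the evaluation. -/
def suspension (X : Type u) [TopologicalSpace X] (x₀ : X) :
    TotalHomology k (BasedLoops X x₀) →ₗ[k] TotalHomology k X :=
  circleOperator k (evalLoop X x₀)

variable {G X : Type u} [TopologicalSpace G] [HGroup G] [TopologicalSpace X]

/-- The pairing `H_*(G) × H_*(X) → H_*(X)`, `(g, x) ↦ g · x`, given by an action up to homotopy. -/
def homologyAct (α : HomotopyAction G X) :
    TotalHomology k G →ₗ[k] TotalHomology k X →ₗ[k] TotalHomology k X :=
  (TensorProduct.mk k _ _).compr₂ ((homologyMap k α.act).comp (kunneth k G X))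

/-- The operator `B_{ΩG}` on `H_*(ΩG)`. -/
def loopOperator (r : C(FreeLoops G, Loops G)) :
    TotalHomology k (Loops G) →ₗ[k] TotalHomology k (Loops G) :=
  circleOperator k (loopAction r)

/-- The operator `B_{ΩG × X}` on `H_*(ΩG × X)`. -/
def loopProdOperator (r : C(FreeLoops G, Loops G)) (α : HomotopyAction G X) :
    TotalHomology k (Loops G × X) →ₗ[k] TotalHomology k (Loops G × X) :=
  circleOperator k (loopProdAction r α)

/-- The linear map `a₁ ⊗ a₂ ↦ (-1) ^ |a₁| a₁ ⊗ (σ_*(a₂) · x)`. -/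
def suspensionTerm (α : HomotopyAction G X) (x : TotalHomology k X) :
    TotalHomology k (Loops G) ⊗[k] TotalHomology k (Loops G) →ₗ[k]
      TotalHomology k (Loops G) ⊗[k] TotalHomology k X :=
  TensorProduct.map (degreeSign k (Loops G))
    (((homologyAct k α).flip x).comp (suspension k G HSpace.e))

theorem suspensionTerm_lof_tmul (α : HomotopyAction G X) (x : TotalHomology k X) (p : ℕ)
    (a₁ : SingularHomology k (Loops G) p) (a₂ : TotalHomology k (Loops G)) :
    suspensionTerm k α x (DirectSum.lof k ℕ _ p a₁ ⊗ₜ a₂) =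
      ((-1 : k) ^ p • DirectSum.lof k ℕ _ p a₁) ⊗ₜ
        homologyAct k α (suspension k G HSpace.e a₂) x := by
  simp [suspensionTerm, degreeSign]

end Operators
end LoopHomology
end

/-! The circle acts on `ΩG × X` through its diagonal: s.(w, x) is the value at (s, s) of the
two-parameter family Φ((s, t), (w, x)) = (s.w, w(t).x). The class [S¹] is primitive: its image under
the diagonal of the circle is the sum of its images under the two inclusions of S¹ in the torus
(`homologyMap_diag_circleClass`). Hence the operator on `ΩG × X` is the sum of the operators of the
two families obtained by setting t = 0 or s = 0 (`circleOperator_torus`).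

For t = 0 the family is (s.w, e.x), because w is based at e. Since e acts on X by a map homotopic to
the identity, this family contributes (B a) ⊗ x. For s = 0 the first coordinate is r(j(w)), and r ∘
j is homotopic to the identity (`IsLoopRetraction.comp_loopIncl`). What remains is (w, x) ↦ (w,
w(t).x), where w occurs twice. It is the composite of the diagonal of `ΩG` with ((w, w'), x) ↦ (w,
w'(t).x). Here [S¹] has to pass the class carried by w, which gives the sign (-1)^|a₁|, and then it
acts on the class carried by w' through the suspension (`circleOperator_evalActDiag`).

These manipulations need a cross product that is natural, associative, and graded commutative
against [S¹]. The last two hold already for chains, because signed sums of shuffles satisfy the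
matching identities (`compLeft_shuffles`, `swap_shuffles`). The comparison with homotopic maps uses
homotopy invariance of singular homology.

The Künneth isomorphism (`kunneth_bijective`) has two ingredients. The Eilenberg-Zilber theorem, in
the form that the mapping cone of the chain cross product is exact (`exists_coneD`), is proved by
acyclic models: a natural contraction is built degree by degree from its values on products of
simplices, where exactness follows from contractibility. The algebraic Künneth theorem
(`IsHomology.map_eq_zero`, `IsHomology.exists_map_add`) then compares the homology of a tensor
product with the tensor product of homologies. Over a principal ideal domain, torsion freeness of
the homology of the first factor makes the cokernel of its differential flat, so no Tor term
appears. -/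

namespace LoopHomology
noncomputable section

/-! ### The algebraic Künneth theorem for differential modules -/
section Algebra
open TensorProduct

/-- `c : Z → H` exhibits `H` as the homology of the differential module `(M, d)`, where `ι : Z → M`
is the inclusion of the cycles. -/
structure IsHomology {k M Z H : Type*} [CommRing k] [AddCommGroup M] [Module k M] [AddCommGroup Z]
    [Module k Z] [AddCommGroup H] [Module k H] (d : M →ₗ[k] M) (ι : Z →ₗ[k] M) (c : Z →ₗ[k] H) :
    Prop where
  sq : ∀ m, d (d m) = 0
  injective : Function.Injective ι
  d_ι : ∀ z, d (ι z) = 0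
  exists_of_d : ∀ m, d m = 0 → ∃ z, ι z = m
  surjective : Function.Surjective c
  eq_zero_iff : ∀ z, c z = 0 ↔ ∃ m, d m = ι z

variable {k : Type*} [CommRing k] {M N : Type*} [AddCommGroup M] [Module k M]
  [AddCommGroup N] [Module k N]

/-- The differential `d ⊗ 1 + s ⊗ e` of a tensor product. -/
def tensorD (d s : M →ₗ[k] M) (e : N →ₗ[k] N) : M ⊗[k] N →ₗ[k] M ⊗[k] N :=
  TensorProduct.map d LinearMap.id + TensorProduct.map s e

lemma tensorD_tmul (d s : M →ₗ[k] M) (e : N →ₗ[k] N) (m : M) (n : N) :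
    tensorD d s e (m ⊗ₜ n) = d m ⊗ₜ n + s m ⊗ₜ e n := rfl

lemma map_map_apply {M₁ M₂ M₃ N₁ N₂ N₃ : Type*} [AddCommGroup M₁] [AddCommGroup M₂]
    [AddCommGroup M₃] [AddCommGroup N₁] [AddCommGroup N₂] [AddCommGroup N₃] [Module k M₁]
    [Module k M₂] [Module k M₃] [Module k N₁] [Module k N₂] [Module k N₃]
    (f : M₁ →ₗ[k] M₂) (g : M₂ →ₗ[k] M₃) (f' : N₁ →ₗ[k] N₂) (g' : N₂ →ₗ[k] N₃) (x : M₁ ⊗[k] N₁) :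
    TensorProduct.map g g' (TensorProduct.map f f' x) =
      TensorProduct.map (g ∘ₗ f) (g' ∘ₗ f') x := by
  rw [TensorProduct.map_comp]; rfl

/-- The obstruction to injectivity is Tor₁ of the quotient M₃, which vanishes by flatness. The
version for tensoring on the left is transported along the commutativity isomorphism. -/
lemma rTensor_injective_of_exact_of_flat {M₁ M₂ M₃ : Type*} [AddCommGroup M₁] [AddCommGroup M₂]
    [AddCommGroup M₃] [Module k M₁] [Module k M₂] [Module k M₃] [Module.Flat k M₃]
    {f : M₁ →ₗ[k] M₂} {g : M₂ →ₗ[k] M₃} (H : Function.Exact f g) (hf : Function.Injective f)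
    (hg : Function.Surjective g) (P : Type*) [AddCommGroup P] [Module k P] :
    Function.Injective (f.rTensor P) := by
  have h := LinearMap.lTensor_injective_of_exact_of_flat g hg f hf H P
  rw [← LinearMap.comm_comp_lTensor_comp_comm_eq f]
  simpa using h

variable {d s : M →ₗ[k] M} {e : N →ₗ[k] N}

/-- The mixed terms s d ⊗ e and d s ⊗ e cancel because s anticommutes with d. This abstracts the
Koszul sign, so that no grading is needed in the algebraic part. -/
lemma tensorD_tensorD (hd : ∀ m, d (d m) = 0) (he : ∀ n, e (e n) = 0)
    (hsd : ∀ m, s (d m) = - d (s m)) (x : M ⊗[k] N) : tensorD d s e (tensorD d s e x) = 0 := by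
  have : tensorD d s e ∘ₗ tensorD d s e = 0 := by
    refine TensorProduct.ext' fun m n => ?_
    simp [tensorD_tmul, hd, he, hsd, TensorProduct.neg_tmul]
  exact congr($this x)

variable {Z H Z' H' : Type*} [AddCommGroup Z] [Module k Z] [AddCommGroup H] [Module k H]
  [AddCommGroup Z'] [Module k Z'] [AddCommGroup H'] [Module k H']
  {ι : Z →ₗ[k] M} {c : Z →ₗ[k] H} {ι' : Z' →ₗ[k] N} {c' : Z' →ₗ[k] H'}

lemma IsHomology.exact_ι (h : IsHomology d ι c) : Function.Exact ι d.rangeRestrict := by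
  intro m
  constructor
  · intro hm
    exact h.exists_of_d m congr($(hm).1)
  · rintro ⟨z, rfl⟩
    exact Subtype.ext (h.d_ι z)

/-- The inclusion of the homology into the cokernel of the differential. -/
def IsHomology.toCoker (h : IsHomology d ι c) : H →ₗ[k] M ⧸ LinearMap.range d :=
  ((LinearMap.ker c).liftQ ((LinearMap.range d).mkQ ∘ₗ ι) (by
    intro z hz
    obtain ⟨m, hm⟩ := (h.eq_zero_iff z).1 hz
    simpa using ⟨m, hm⟩)) ∘ₗ (c.quotKerEquivOfSurjective h.surjective).symm.toLinearMap

lemma IsHomology.toCoker_apply (h : IsHomology d ι c) (z : Z) :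
    h.toCoker (c z) = (LinearMap.range d).mkQ (ι z) := by
  have : (c.quotKerEquivOfSurjective h.surjective).symm (c z) = Submodule.Quotient.mk z := by
    rw [LinearEquiv.symm_apply_eq]; rfl
  rw [IsHomology.toCoker, LinearMap.comp_apply, LinearEquiv.coe_coe, this]
  rfl

lemma IsHomology.toCoker_injective (h : IsHomology d ι c) : Function.Injective h.toCoker := by
  rw [injective_iff_map_eq_zero]
  intro x hx
  obtain ⟨z, rfl⟩ := h.surjective x
  rw [h.toCoker_apply, Submodule.mkQ_apply, Submodule.Quotient.mk_eq_zero] at hx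
  exact (h.eq_zero_iff z).2 hx

/-- The map `M / im d → im d` induced by the differential. -/
def IsHomology.ofCoker (h : IsHomology d ι c) : M ⧸ LinearMap.range d →ₗ[k] LinearMap.range d :=
  (LinearMap.range d).liftQ d.rangeRestrict (by
    rintro _ ⟨m, rfl⟩
    exact Subtype.ext (h.sq m))

/-- Together with injectivity on the left and surjectivity on the right this is the short exact
sequence 0 → H → M / im d → im d → 0. It stays exact after tensoring when im d is flat. -/
lemma IsHomology.exact_coker (h : IsHomology d ι c) : Function.Exact h.toCoker h.ofCoker := by
  intro q
  obtain ⟨m, rfl⟩ := Submodule.mkQ_surjective _ q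
  constructor
  · intro hq
    obtain ⟨z, rfl⟩ := h.exists_of_d m congr($(hq).1)
    exact ⟨c z, h.toCoker_apply z⟩
  · rintro ⟨x, hx⟩
    obtain ⟨z, rfl⟩ := h.surjective x
    rw [← hx, h.toCoker_apply]
    exact Subtype.ext (h.d_ι z)

lemma IsHomology.ofCoker_surjective (h : IsHomology d ι c) : Function.Surjective h.ofCoker := by
  rintro ⟨_, m, rfl⟩
  exact ⟨(LinearMap.range d).mkQ m, rfl⟩

lemma tensorD_map_ι (h : IsHomology d ι c) (h' : IsHomology e ι' c') (y : Z ⊗[k] Z') :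
    tensorD d s e (TensorProduct.map ι ι' y) = 0 := by
  suffices tensorD d s e ∘ₗ TensorProduct.map ι ι' = 0 from congr($this y)
  refine TensorProduct.ext' fun z z' => ?_
  simp [tensorD_tmul, h.d_ι, h'.d_ι]

/-- A sum of products of cycles which is a boundary vanishes in the tensor product of the homology
modules. -/
theorem IsHomology.map_eq_zero (h : IsHomology d ι c) (h' : IsHomology e ι' c')
    [Module.Flat k (LinearMap.range d)] [Module.Flat k (M ⧸ LinearMap.range d)]
    (y : Z ⊗[k] Z') (x : M ⊗[k] N) (hy : TensorProduct.map ι ι' y = tensorD d s e x) :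
    TensorProduct.map c c' y = 0 := by
  -- H ⊗ H' embeds in (M / im d) ⊗ (N / im e): `h1` uses flatness of im d, `h2` that of M / im d. It
  -- is thus enough to show that the image there vanishes.
  have h1 : Function.Injective (h.toCoker.rTensor H') :=
    rTensor_injective_of_exact_of_flat h.exact_coker h.toCoker_injective
      h.ofCoker_surjective H'
  have h2 : Function.Injective (h'.toCoker.lTensor (M ⧸ LinearMap.range d)) :=
    Module.Flat.lTensor_preserves_injective_linearMap _ h'.toCoker_injective
  apply h1
  apply h2
  rw [map_zero, map_zero, LinearMap.lTensor, LinearMap.rTensor, map_map_apply, map_map_apply]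
  have e1 : (LinearMap.id ∘ₗ h.toCoker) ∘ₗ c = (LinearMap.range d).mkQ ∘ₗ ι :=
    LinearMap.ext h.toCoker_apply
  have e2 : (h'.toCoker ∘ₗ LinearMap.id) ∘ₗ c' = (LinearMap.range e).mkQ ∘ₗ ι' :=
    LinearMap.ext h'.toCoker_apply
  simp only [LinearMap.comp_assoc] at e1 e2 ⊢
  rw [e1, e2, ← map_map_apply, hy]
  -- Each of the two terms of the differential has a factor in im d or in im e.
  have : TensorProduct.map (LinearMap.range d).mkQ (LinearMap.range e).mkQ ∘ₗ tensorD d s e = 0 := by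
    refine TensorProduct.ext' fun m n => ?_
    have h3 : (LinearMap.range d).mkQ (d m) = 0 := by simp
    have h4 : (LinearMap.range e).mkQ (e n) = 0 := by simp
    rw [LinearMap.comp_apply, tensorD_tmul, map_add, map_tmul, map_tmul, h3, h4]
    simp
  exact congr($this x)

/-- Every cycle of a tensor product is homologous to a sum of products of cycles. -/
theorem IsHomology.exists_map_add (h : IsHomology d ι c) (h' : IsHomology e ι' c')
    (hs : ∀ m, s (s m) = m) (hsd : ∀ m, s (d m) = - d (s m))
    [Module.Flat k M] [Module.Flat k (LinearMap.range d)] [Module.Flat k (M ⧸ LinearMap.range d)]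
    (x : M ⊗[k] N) (hx : tensorD d s e x = 0) :
    ∃ y w, x = TensorProduct.map ι ι' y + tensorD d s e w := by
  set B := LinearMap.range d
  set d' := d.rangeRestrict
  have hdd' : ∀ m, d' (d m) = 0 := fun m => Subtype.ext (h.sq m)
  have hB : ∀ P : Type _, ∀ [AddCommGroup P] [Module k P],
      Function.Injective (B.subtype.rTensor P) := fun P _ _ =>
    rTensor_injective_of_exact_of_flat (LinearMap.exact_subtype_mkQ B)
      B.injective_subtype B.mkQ_surjective P
  -- Modulo im e, the equation for x says that (d ⊗ 1) x is zero. As B ⊗ (N / im e) embeds in M ⊗ (N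
  -- / im e), right exactness puts (d' ⊗ 1) x in the image of 1 ⊗ e.
  obtain ⟨y', hy'⟩ : ∃ y', LinearMap.lTensor B e y' = d'.rTensor N x := by
    refine (lTensor_exact B (LinearMap.exact_map_mkQ_range e)
      (LinearMap.range e).mkQ_surjective _).1 ?_
    apply hB
    rw [map_zero, LinearMap.lTensor, LinearMap.rTensor, LinearMap.rTensor, map_map_apply,
      map_map_apply]
    have h1 := congr(TensorProduct.map LinearMap.id (LinearMap.range e).mkQ $hx)
    rw [map_zero] at h1
    rw [← h1]
    have : TensorProduct.map (B.subtype ∘ₗ LinearMap.id ∘ₗ d')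
          (LinearMap.id ∘ₗ (LinearMap.range e).mkQ ∘ₗ LinearMap.id) =
        TensorProduct.map LinearMap.id (LinearMap.range e).mkQ ∘ₗ tensorD d s e := by
      refine TensorProduct.ext' fun m n => ?_
      have h4 : (LinearMap.range e).mkQ (e n) = 0 := by simp
      rw [LinearMap.comp_apply, tensorD_tmul, map_add, map_tmul, map_tmul, map_tmul, h4]
      simp [d']
    exact congr($this x)
  obtain ⟨w, hw⟩ := LinearMap.rTensor_surjective N (LinearMap.surjective_rangeRestrict d) y'
  -- Because s² = 1, the boundary of (s ⊗ 1) w is (1 ⊗ e) w plus a term in the image of d ⊗ 1, which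
  -- d' kills. Subtracting it therefore cancels (d' ⊗ 1) x.
  set x' := x - tensorD d s e (s.rTensor N w)
  have hx' : d'.rTensor N x' = 0 := by
    have : d'.rTensor N ∘ₗ tensorD d s e ∘ₗ s.rTensor N = LinearMap.lTensor B e ∘ₗ d'.rTensor N := by
      refine TensorProduct.ext' fun m n => ?_
      simp [tensorD_tmul, hs, hdd']
    have := congr($this w)
    simp only [LinearMap.comp_apply] at this
    rw [map_sub, this, hw, hy', sub_self]
  have hDx' : tensorD d s e x' = 0 := by
    rw [map_sub, hx, tensorD_tensorD h.sq h'.sq hsd, sub_zero]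
  -- Both the total differential and d ⊗ 1 kill x', so s ⊗ e does too, and s can be cancelled since
  -- it is an involution.
  have hex' : LinearMap.lTensor M e x' = 0 := by
    have : s.rTensor N ∘ₗ (tensorD d s e - B.subtype.rTensor N ∘ₗ d'.rTensor N) =
        LinearMap.lTensor M e := by
      refine TensorProduct.ext' fun m n => ?_
      simp [tensorD_tmul, hs, d']
    rw [← this]
    simp [hx', hDx']
  -- Flatness of M lifts x' to M ⊗ Z'. Flatness of B makes B ⊗ Z' → B ⊗ N injective, so d' ⊗ 1 kills
  -- the lift already in B ⊗ Z', and the lift comes from Z ⊗ Z'.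
  obtain ⟨u, hu⟩ := (Module.Flat.lTensor_exact M (f := ι') (g := e) (fun n =>
    ⟨h'.exists_of_d n, by rintro ⟨z, rfl⟩; exact h'.d_ι z⟩) x').1 hex'
  obtain ⟨v, hv⟩ := (rTensor_exact Z' h.exact_ι (LinearMap.surjective_rangeRestrict d) u).1 (by
    apply Module.Flat.lTensor_preserves_injective_linearMap (M := B) ι' h'.injective
    rw [map_zero, ← hx', ← hu]
    exact congr($((LinearMap.lTensor_comp_rTensor ..).trans
      (LinearMap.rTensor_comp_lTensor ..).symm) u))
  refine ⟨v, s.rTensor N w, ?_⟩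
  rw [← sub_eq_iff_eq_add]
  refine hu.symm.trans ?_
  rw [← hv]
  exact congr($(LinearMap.lTensor_comp_rTensor ..) v)

variable [IsDomain k] [IsPrincipalIdealRing k]

/-- Over a principal ideal domain flatness follows from torsion freeness. If r m = d n with r ≠ 0,
then r (d m) = 0, so m is a cycle because M is torsion free. Its class is killed by r, hence is
zero, and m is a boundary. -/
lemma IsHomology.flat_coker (h : IsHomology d ι c) [Module.IsTorsionFree k M]
    [Module.IsTorsionFree k H] : Module.Flat k (M ⧸ LinearMap.range d) := by
  have : Module.IsTorsionFree k (M ⧸ LinearMap.range d) := by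
    refine Module.isTorsionFree_iff_smul_eq_zero.2 fun r q hq => ?_
    by_contra! hr
    obtain ⟨hr, hq'⟩ := hr
    obtain ⟨m, rfl⟩ := Submodule.mkQ_surjective _ q
    rw [← map_smul, Submodule.mkQ_apply, Submodule.Quotient.mk_eq_zero] at hq
    obtain ⟨n, hn⟩ := hq
    have hm : d m = 0 := by
      have := h.sq n
      rw [hn, map_smul, smul_eq_zero] at this
      exact this.resolve_left hr
    obtain ⟨z, rfl⟩ := h.exists_of_d m hm
    have hz : c (r • z) = 0 := (h.eq_zero_iff _).2 ⟨n, by rw [hn, map_smul]⟩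
    rw [map_smul, smul_eq_zero] at hz
    obtain ⟨p, hp⟩ := (h.eq_zero_iff _).1 (hz.resolve_left hr)
    exact hq' (by rw [← hp]; simp)
  infer_instance

end Algebra

/-! ### Functoriality of singular chains -/
section Functoriality
open scoped Simplicial
variable (k : Type w) [CommRing k] {X Y Z : Type u} [TopologicalSpace X] [TopologicalSpace Y]
  [TopologicalSpace Z]

/-- The composite of a singular simplex with a continuous map. -/
def simplexMap {n : ℕ} (f : C(X, Y)) (σ : SingularSimplex X n) : SingularSimplex Y n :=
  (TopCat.toSSet.map (TopCat.ofHom f)).app _ σ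

lemma simplexMap_pair {X' Y' : Type u} [TopologicalSpace X'] [TopologicalSpace Y'] (f : C(X, X'))
    (g : C(Y, Y')) {n : ℕ} (σ : SingularSimplex X n) (τ : SingularSimplex Y n) :
    simplexMap (f.prodMap g) (simplexPair σ τ) =
      simplexPair (simplexMap f σ) (simplexMap g τ) := rfl

/-- The morphism of singular chain complexes given by a continuous map. -/
abbrev chainMap (f : C(X, Y)) : SingularChains k X ⟶ SingularChains k Y :=
  ((singularChainComplexFunctor.{u} (ModuleCat.{max w u} k)).obj
    (ModuleCat.of k (ULift.{u} k))).map (TopCat.ofHom f)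

lemma chainMap_simplexChain {n : ℕ} (f : C(X, Y)) (σ : SingularSimplex X n) :
    (chainMap k f).f n (simplexChain k σ) = simplexChain k (simplexMap f σ) :=
  congr($(SSet.ι_chainComplexMap_f _ _ (TopCat.toSSet.map (TopCat.ofHom f))
    (ModuleCat.of k (ULift.{u} k)) σ).hom (ULift.up 1))

lemma chainMap_d {m n : ℕ} (f : C(X, Y)) (a : (SingularChains k X).X m) :
    (chainMap k f).f n ((SingularChains k X).d m n a) =
      (SingularChains k Y).d m n ((chainMap k f).f m a) :=
  congr($((chainMap k f).comm m n).hom a).symm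

lemma chainMap_evalPair {X' Y' : Type u} [TopologicalSpace X'] [TopologicalSpace Y'] (f : C(X, X'))
    (g : C(Y, Y')) {n p q : ℕ} (σ : SingularSimplex X p) (τ : SingularSimplex Y q)
    (z : PairChain n p q) : (chainMap k (f.prodMap g)).f n (evalPair k σ τ z) =
      evalPair k (simplexMap f σ) (simplexMap g τ) z := by
  induction z using Finsupp.induction_linear with
  | zero => simp
  | add x y hx hy => simp only [map_add, hx, hy]
  | single x c =>
    rw [evalPair_single, evalPair_single, map_zsmul, chainMap_simplexChain, simplexMap_pair]
    rfl

/-- The cross product of singular chains is natural. -/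
theorem chainMap_chainCross {X' Y' : Type u} [TopologicalSpace X'] [TopologicalSpace Y']
    (f : C(X, X')) (g : C(Y, Y')) (n p q : ℕ) (a : (SingularChains k X).X p)
    (b : (SingularChains k Y).X q) : (chainMap k (f.prodMap g)).f n (chainCross k n p q a b) =
      chainCross k n p q ((chainMap k f).f p a) ((chainMap k g).f q b) := by
  have key : (chainCross k n p q (X := X) (Y := Y)).compr₂ ((chainMap k (f.prodMap g)).f n).hom =
      (chainCross k n p q).compl₁₂ ((chainMap k f).f p).hom ((chainMap k g).f q).hom := by
    refine chain_ext fun σ => chain_ext fun τ => ?_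
    change (chainMap k (f.prodMap g)).f n (chainCross k n p q _ _) =
      chainCross k n p q ((chainMap k f).f p _) ((chainMap k g).f q _)
    rw [chainCross_simplex, chainMap_simplexChain, chainMap_simplexChain, chainCross_simplex,
      chainMap_evalPair]
  exact congr($key a b)

end Functoriality

/-! ### Total complexes of singular chains -/
section Total
open scoped Simplicial DirectSum TensorProduct
variable (k : Type w) [CommRing k] (X Y : Type u) [TopologicalSpace X] [TopologicalSpace Y]

/-- The total module of singular chains. -/
abbrev TotalChains : Type max w u := ⨁ n : ℕ, (SingularChains k X).X n

variable {k X} in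
abbrev ofDegree (n : ℕ) : (SingularChains k X).X n →ₗ[k] TotalChains k X :=
  DirectSum.lof k ℕ (fun n => (SingularChains k X).X n) n

variable {k X} in
lemma totalChains_ext {M : Type max w u} [AddCommGroup M] [Module k M]
    {f g : TotalChains k X →ₗ[k] M}
    (h : ∀ n (σ : SingularSimplex X n),
      f (ofDegree n (simplexChain k σ)) = g (ofDegree n (simplexChain k σ))) : f = g :=
  DirectSum.linearMap_ext _ fun n => chain_ext (h n)

/-- The differential of `TotalChains`. -/
def totalD : TotalChains k X →ₗ[k] TotalChains k X :=
  DirectSum.toModule k ℕ _ fun n => ofDegree (n - 1) ∘ₗ ((SingularChains k X).d n (n - 1)).hom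

/-- The sign operator `a ↦ (-1) ^ |a| a`. -/
def totalSign : TotalChains k X →ₗ[k] TotalChains k X :=
  DirectSum.lmap fun n => (-1 : k) ^ n • LinearMap.id

variable {X Y} in
/-- The map of total modules of chains given by a continuous map. -/
def totalMap (f : C(X, Y)) : TotalChains k X →ₗ[k] TotalChains k Y :=
  DirectSum.lmap fun n => ((chainMap k f).f n).hom

/-- The cross product of chains. -/
def totalCross : TotalChains k X ⊗[k] TotalChains k Y →ₗ[k] TotalChains k (X × Y) :=
  TensorProduct.lift <| DirectSum.toModule k ℕ _ fun p => LinearMap.flip <|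
    DirectSum.toModule k ℕ _ fun q => LinearMap.flip <|
      (chainCross k (p + q) p q).compr₂ (ofDegree (p + q))

variable {X Y}

@[simp] lemma totalD_ofDegree (n : ℕ) (a : (SingularChains k X).X n) :
    totalD k X (ofDegree n a) = ofDegree (n - 1) ((SingularChains k X).d n (n - 1) a) := by
  simp [totalD]

@[simp] lemma totalSign_ofDegree (n : ℕ) (a : (SingularChains k X).X n) :
    totalSign k X (ofDegree n a) = (-1 : k) ^ n • ofDegree n a := by
  simp [totalSign]

@[simp] lemma totalMap_ofDegree (f : C(X, Y)) (n : ℕ) (a : (SingularChains k X).X n) :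
    totalMap k f (ofDegree n a) = ofDegree n ((chainMap k f).f n a) := by
  simp [totalMap]

@[simp] lemma totalCross_ofDegree (p q : ℕ) (a : (SingularChains k X).X p)
    (b : (SingularChains k Y).X q) :
    totalCross k X Y (ofDegree p a ⊗ₜ ofDegree q b) =
      ofDegree (p + q) (chainCross k (p + q) p q a b) := by
  simp [totalCross]

/-- Truncated subtraction makes this the component from degree 0 to itself, which is zero because it
is not an arrow of the complex shape. Degree 0 is treated separately below for this reason. -/
lemma d_zero_pred (a : (SingularChains k X).X 0) : (SingularChains k X).d 0 (0 - 1) a = 0 := by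
  rw [(SingularChains k X).shape _ _ (by simp)]; rfl

lemma totalD_totalD (a : TotalChains k X) : totalD k X (totalD k X a) = 0 := by
  suffices totalD k X ∘ₗ totalD k X = 0 from congr($this a)
  refine DirectSum.linearMap_ext _ fun n => LinearMap.ext fun a => ?_
  simp only [LinearMap.comp_apply, totalD_ofDegree, LinearMap.zero_apply]
  rw [show (SingularChains k X).d (n - 1) (n - 1 - 1) ((SingularChains k X).d n (n - 1) a) = 0 from
    congr($((SingularChains k X).d_comp_d n (n - 1) (n - 1 - 1)).hom a), map_zero]

lemma totalSign_totalSign (a : TotalChains k X) : totalSign k X (totalSign k X a) = a := by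
  suffices totalSign k X ∘ₗ totalSign k X = LinearMap.id from congr($this a)
  refine DirectSum.linearMap_ext _ fun n => LinearMap.ext fun a => ?_
  simp only [LinearMap.comp_apply, totalSign_ofDegree, map_smul, smul_smul, ← mul_pow]
  simp

lemma totalSign_totalD (a : TotalChains k X) :
    totalSign k X (totalD k X a) = - totalD k X (totalSign k X a) := by
  suffices totalSign k X ∘ₗ totalD k X = - (totalD k X ∘ₗ totalSign k X) from congr($this a)
  refine DirectSum.linearMap_ext _ fun n => LinearMap.ext fun a => ?_
  simp only [LinearMap.comp_apply, totalSign_ofDegree, map_smul, totalD_ofDegree,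
    LinearMap.neg_apply]
  rcases n with _ | n
  · rw [d_zero_pred]; simp
  · simp [pow_succ]

lemma totalMap_totalD (f : C(X, Y)) (a : TotalChains k X) :
    totalMap k f (totalD k X a) = totalD k Y (totalMap k f a) := by
  suffices totalMap k f ∘ₗ totalD k X = totalD k Y ∘ₗ totalMap k f from congr($this a)
  refine DirectSum.linearMap_ext _ fun n => LinearMap.ext fun a => ?_
  simp only [LinearMap.comp_apply, totalMap_ofDegree, totalD_ofDegree, chainMap_d]

lemma totalMap_totalSign (f : C(X, Y)) (a : TotalChains k X) :
    totalMap k f (totalSign k X a) = totalSign k Y (totalMap k f a) := by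
  suffices totalMap k f ∘ₗ totalSign k X = totalSign k Y ∘ₗ totalMap k f from congr($this a)
  refine DirectSum.linearMap_ext _ fun n => LinearMap.ext fun a => ?_
  simp only [LinearMap.comp_apply, totalMap_ofDegree, totalSign_ofDegree, map_smul]

lemma totalMap_id : totalMap k (ContinuousMap.id X) = LinearMap.id := by
  refine totalChains_ext fun n σ => ?_
  rw [totalMap_ofDegree, chainMap_simplexChain]
  rfl

lemma totalMap_comp {Z : Type u} [TopologicalSpace Z] (g : C(Y, Z)) (f : C(X, Y)) :
    totalMap k (g.comp f) = totalMap k g ∘ₗ totalMap k f := by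
  refine totalChains_ext fun n σ => ?_
  simp only [totalMap_ofDegree, chainMap_simplexChain, LinearMap.comp_apply]
  rfl

lemma totalCross_natural {X' Y' : Type u} [TopologicalSpace X'] [TopologicalSpace Y']
    (f : C(X, X')) (g : C(Y, Y')) (x : TotalChains k X ⊗[k] TotalChains k Y) :
    totalMap k (f.prodMap g) (totalCross k X Y x) =
      totalCross k X' Y' (TensorProduct.map (totalMap k f) (totalMap k g) x) := by
  suffices totalMap k (f.prodMap g) ∘ₗ totalCross k X Y =
    totalCross k X' Y' ∘ₗ TensorProduct.map (totalMap k f) (totalMap k g) from congr($this x)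
  refine TensorProduct.ext <| DirectSum.linearMap_ext _ fun p => LinearMap.ext fun a =>
    DirectSum.linearMap_ext _ fun q => LinearMap.ext fun b => ?_
  change totalMap k (f.prodMap g) (totalCross k X Y (ofDegree p a ⊗ₜ ofDegree q b)) =
    totalCross k X' Y' (totalMap k f (ofDegree p a) ⊗ₜ totalMap k g (ofDegree q b))
  simp only [totalCross_ofDegree, totalMap_ofDegree, chainMap_chainCross]

/-- The cross product commutes with the differentials. -/
lemma totalCross_tensorD (x : TotalChains k X ⊗[k] TotalChains k Y) :
    totalCross k X Y (tensorD (totalD k X) (totalSign k X) (totalD k Y) x) =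
      totalD k (X × Y) (totalCross k X Y x) := by
  suffices totalCross k X Y ∘ₗ tensorD (totalD k X) (totalSign k X) (totalD k Y) =
    totalD k (X × Y) ∘ₗ totalCross k X Y from congr($this x)
  refine TensorProduct.ext <| DirectSum.linearMap_ext _ fun p => LinearMap.ext fun a =>
    DirectSum.linearMap_ext _ fun q => LinearMap.ext fun b => ?_
  change totalCross k X Y (tensorD _ _ _ (ofDegree p a ⊗ₜ ofDegree q b)) =
    totalD k _ (totalCross k X Y (ofDegree p a ⊗ₜ ofDegree q b))
  rw [tensorD_tmul, totalCross_ofDegree, map_add, totalD_ofDegree, totalD_ofDegree,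
    totalCross_ofDegree, totalSign_ofDegree, ← TensorProduct.smul_tmul', map_smul,
    totalCross_ofDegree, totalD_ofDegree]
  -- The Leibniz rule starts from a total degree of the form n + 1, and p - 1 + q agrees with p + q
  -- - 1 only for p > 0. In degree 0 the term in question vanishes.
  rcases p with _ | p <;> rcases q with _ | q
  · simp only [Nat.add_zero, d_zero_pred, map_zero, LinearMap.zero_apply, smul_zero, add_zero]
  · rw [d_zero_pred, map_zero, LinearMap.zero_apply, map_zero, zero_add, pow_zero, one_smul]
    have := d_chainCross k (0 + q) 0 (q + 1) a b
    refine Eq.trans ?_ congr(ofDegree (0 + q) $this).symm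
    rw [d_zero_pred, map_zero, LinearMap.zero_apply, pow_zero, one_smul]
    exact congrArg _ (zero_add _).symm
  · rw [d_zero_pred, map_zero, map_zero, smul_zero, add_zero]
    have := d_chainCross k (p + 0) (p + 1) 0 a b
    refine Eq.trans ?_ congr(ofDegree (p + 0) $this).symm
    rw [d_zero_pred, map_zero, smul_zero]
    exact congrArg _ (add_zero _).symm
  · have := d_chainCross k (p + 1 + q) (p + 1) (q + 1) a b
    refine Eq.trans ?_ congr(ofDegree (p + 1 + q) $this).symm
    rw [map_add, map_zsmul]
    congr 1
    · have : p + (q + 1) = p + 1 + q := by omega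
      change ofDegree (p + (q + 1)) (chainCross k (p + (q + 1)) p (q + 1) _ b) =
        ofDegree _ (chainCross k _ p (q + 1) _ b)
      rw [this]
    · rw [← Int.cast_smul_eq_zsmul k]
      simp

end Total

/-! ### Total homology as the homology of the total module of chains -/
section TotalHomology
open scoped Simplicial DirectSum TensorProduct
variable (k : Type w) [CommRing k] (X Y : Type u) [TopologicalSpace X] [TopologicalSpace Y]

/-- The total module of cycles. -/
abbrev TotalCycles : Type max w u := ⨁ n : ℕ, Cycles (SingularChains k X) n

/-- The inclusion of the cycles. -/
def cyclesι : TotalCycles k X →ₗ[k] TotalChains k X :=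
  DirectSum.lmap fun n => (Cycles (SingularChains k X) n).subtype

/-- The homology class of a cycle, with values in the singular homology. -/
def cycleClass (n : ℕ) : Cycles (SingularChains k X) n →ₗ[k] SingularHomology k X n :=
  homologyClass (SingularChains k X) n

/-- The homology class of a cycle of the total module of chains. -/
def totalClass : TotalCycles k X →ₗ[k] TotalHomology k X :=
  DirectSum.lmap fun n => cycleClass k X n

variable {k X Y}

lemma cyclesι_lof (n : ℕ) (z : Cycles (SingularChains k X) n) :
    cyclesι k X (DirectSum.lof k ℕ (fun n => Cycles (SingularChains k X) n) n z) =
      ofDegree n z.1 := by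
  simp [cyclesι]

lemma totalClass_lof (n : ℕ) (z : Cycles (SingularChains k X) n) :
    totalClass k X (DirectSum.lof k ℕ (fun n => Cycles (SingularChains k X) n) n z) =
      DirectSum.lof k ℕ (fun n => SingularHomology k X n) n (cycleClass k X n z) := by
  simp [totalClass]

/-- This separates the degrees: an equation between total chains can be checked one degree at a
time, even though `totalD` is defined by what it does to each summand. -/
lemma totalD_apply (c : TotalChains k X) (n : ℕ) :
    totalD k X c n = (SingularChains k X).d (n + 1) n (c (n + 1)) := by
  suffices DirectSum.component k ℕ _ n ∘ₗ totalD k X = ((SingularChains k X).d (n + 1) n).hom ∘ₗ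
      DirectSum.component k ℕ (fun n => (SingularChains k X).X n) (n + 1) from congr($this c)
  refine DirectSum.linearMap_ext _ fun m => LinearMap.ext fun a => ?_
  simp only [LinearMap.comp_apply, totalD_ofDegree]
  rcases m with _ | m
  · rw [d_zero_pred, map_zero, map_zero, DirectSum.component.of, dif_neg (by omega), map_zero]
  · change DirectSum.component k ℕ _ n (ofDegree m ((SingularChains k X).d (m + 1) m a)) = _
    rw [DirectSum.component.of, DirectSum.component.of]
    by_cases h : m = n
    · subst h; simp
    · rw [dif_neg h, dif_neg (by omega), map_zero]

variable (k X) in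
/-- The total homology is the homology of the total module of chains. -/
theorem isHomology_total : IsHomology (totalD k X) (cyclesι k X) (totalClass k X) where
  sq := totalD_totalD k
  injective := DirectSum.lmap_injective _ |>.2 fun n => Submodule.subtype_injective _
  d_ι z := by
    suffices totalD k X ∘ₗ cyclesι k X = 0 from congr($this z)
    refine DirectSum.linearMap_ext _ fun m => LinearMap.ext fun a => ?_
    simp only [LinearMap.comp_apply, cyclesι_lof, totalD_ofDegree, LinearMap.zero_apply]
    rw [show (SingularChains k X).d m (m - 1) a.1 = 0 from a.2, map_zero]
  exists_of_d m hm := by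
    classical
    have hc : ∀ n, m n ∈ Cycles (SingularChains k X) n := by
      rintro (_ | n)
      · exact d_zero_pred k _
      · refine (totalD_apply m n).symm.trans ?_
        rw [hm]; rfl
    refine ⟨∑ n ∈ DFinsupp.support m,
      DirectSum.lof k ℕ (fun n => Cycles (SingularChains k X) n) n ⟨m n, hc n⟩, ?_⟩
    rw [map_sum]
    simp only [cyclesι_lof]
    exact DirectSum.sum_support_of m
  surjective := DirectSum.lmap_surjective _ |>.2 fun n => homologyClass_surjective _ n
  eq_zero_iff z := by
    classical
    constructor
    · intro h
      have h1 : ∀ n, ∃ a, (SingularChains k X).d (n + 1) n a = (z n).1 := fun n => by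
        rw [← homologyClass_eq_zero_iff]
        have := congr($h n)
        rwa [totalClass, DirectSum.lmap_apply] at this
      choose a ha using h1
      refine ⟨∑ n ∈ DFinsupp.support z, ofDegree (n + 1) (a n), ?_⟩
      conv_rhs => rw [← DirectSum.sum_support_of z]
      rw [map_sum, map_sum]
      refine Finset.sum_congr rfl fun n _ => ?_
      rw [totalD_ofDegree]
      exact congr(ofDegree n $(ha n)).trans (cyclesι_lof n (z n)).symm
    · rintro ⟨m, hm⟩
      refine DFinsupp.ext fun n => ?_
      have h1 : totalClass k X z n = cycleClass k X n (z n) := by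
        rw [totalClass, DirectSum.lmap_apply]
      refine h1.trans ((homologyClass_eq_zero_iff _ n _).2 ⟨m (n + 1), ?_⟩)
      rw [← totalD_apply, hm]
      simp [cyclesι]

/-! ### Computing in homology with representing chains -/

/-- The chain `c` is a cycle with homology class `α`. -/
def IsClass (c : TotalChains k X) (α : TotalHomology k X) : Prop :=
  ∃ z, cyclesι k X z = c ∧ totalClass k X z = α

lemma IsClass.d_eq_zero {c : TotalChains k X} {α : TotalHomology k X} (h : IsClass c α) :
    totalD k X c = 0 := by
  obtain ⟨z, rfl, -⟩ := h
  exact (isHomology_total k X).d_ι z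

lemma exists_isClass (α : TotalHomology k X) : ∃ c, IsClass c α := by
  obtain ⟨z, hz⟩ := (isHomology_total k X).surjective α
  exact ⟨_, z, rfl, hz⟩

lemma exists_isClass_of_d {c : TotalChains k X} (hc : totalD k X c = 0) : ∃ α, IsClass c α := by
  obtain ⟨z, hz⟩ := (isHomology_total k X).exists_of_d c hc
  exact ⟨_, z, hz, rfl⟩

lemma IsClass.add {c c' : TotalChains k X} {α α' : TotalHomology k X} (h : IsClass c α)
    (h' : IsClass c' α') : IsClass (c + c') (α + α') := by
  obtain ⟨z, rfl, rfl⟩ := h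
  obtain ⟨z', rfl, rfl⟩ := h'
  exact ⟨z + z', map_add .., map_add ..⟩

lemma IsClass.smul {c : TotalChains k X} {α : TotalHomology k X} (h : IsClass c α) (r : k) :
    IsClass (r • c) (r • α) := by
  obtain ⟨z, rfl, rfl⟩ := h
  exact ⟨r • z, map_smul .., map_smul ..⟩

lemma IsClass.eq_zero_iff {c : TotalChains k X} {α : TotalHomology k X} (h : IsClass c α) :
    α = 0 ↔ ∃ m, totalD k X m = c := by
  obtain ⟨z, rfl, rfl⟩ := h
  exact (isHomology_total k X).eq_zero_iff z

lemma isClass_d (c : TotalChains k X) : IsClass (totalD k X c) 0 := by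
  obtain ⟨α, hα⟩ := exists_isClass_of_d (totalD_totalD k c)
  rwa [hα.eq_zero_iff.2 ⟨c, rfl⟩] at hα

lemma IsClass.neg {c : TotalChains k X} {α : TotalHomology k X} (h : IsClass c α) :
    IsClass (-c) (-α) := by
  simpa using h.smul (-1)

lemma IsClass.sub {c c' : TotalChains k X} {α α' : TotalHomology k X} (h : IsClass c α)
    (h' : IsClass c' α') : IsClass (c - c') (α - α') := by
  simpa [sub_eq_add_neg] using h.add h'.neg

/-- The standard way to prove an identity in homology below: both sides are represented by one and
the same chain. -/
lemma IsClass.unique {c : TotalChains k X} {α α' : TotalHomology k X} (h : IsClass c α)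
    (h' : IsClass c α') : α = α' := by
  rw [← sub_eq_zero, (h.sub h').eq_zero_iff]
  exact ⟨0, by simp⟩

/-- By naturality of the projection to homology, the equality may be checked on categorical cycles,
and there after the monomorphism to chains, where it is the hypothesis. -/
lemma homologyMap_lof_class (f : C(X, Y)) (n : ℕ) (z : Cycles (SingularChains k X) n)
    (z' : Cycles (SingularChains k Y) n) (h : (chainMap k f).f n z.1 = z'.1) :
    homologyMap k f (DirectSum.lof k ℕ (fun n => SingularHomology k X n) n (cycleClass k X n z)) =
      DirectSum.lof k ℕ (fun n => SingularHomology k Y n) n (cycleClass k Y n z') := by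
  rw [homologyMap, DirectSum.lmap_lof]
  congr 1
  have h1 := congr($(HomologicalComplex.homologyπ_naturality (chainMap k f) n).hom
    (cyclesLift _ n z))
  refine h1.trans ?_
  refine congrArg (HomologicalComplex.homologyπ (SingularChains k Y) n).hom ?_
  apply (ModuleCat.mono_iff_injective ((SingularChains k Y).iCycles n)).1 inferInstance
  have h2 := congr($(HomologicalComplex.cyclesMap_i (chainMap k f) n).hom (cyclesLift _ n z))
  have h3 := congr($((SingularChains k X).liftCycles_i
    (ModuleCat.ofHom (Cycles (SingularChains k X) n).subtype) (n - 1) (next_down n)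
      (by ext x; exact x.2)).hom z)
  have h4 := congr($((SingularChains k Y).liftCycles_i
    (ModuleCat.ofHom (Cycles (SingularChains k Y) n).subtype) (n - 1) (next_down n)
      (by ext x; exact x.2)).hom z')
  refine h2.trans (Eq.trans ?_ h4.symm)
  exact (congrArg ((chainMap k f).f n) h3).trans h

lemma IsClass.map {c : TotalChains k X} {α : TotalHomology k X} (h : IsClass c α) (f : C(X, Y)) :
    IsClass (totalMap k f c) (homologyMap k f α) := by
  obtain ⟨z, rfl, rfl⟩ := h
  induction z using DirectSum.induction_on with
  | zero => simpa using isClass_d (0 : TotalChains k Y)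
  | add x y hx hy => simpa only [map_add] using hx.add hy
  | of n z =>
    refine ⟨DirectSum.lof k ℕ (fun n => Cycles (SingularChains k Y) n) n
      ⟨(chainMap k f).f n z.1, ?_⟩, ?_, ?_⟩
    · change (SingularChains k Y).d _ _ _ = 0
      rw [← chainMap_d, show (SingularChains k X).d n (n - 1) z.1 = 0 from z.2, map_zero]
    · exact (cyclesι_lof ..).trans ((congrArg _ (cyclesι_lof n z)).trans
        (totalMap_ofDegree ..)).symm
    · exact (totalClass_lof ..).trans ((congrArg _ (totalClass_lof n z)).trans
        (homologyMap_lof_class _ _ _ _ rfl)).symm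

lemma IsClass.sign {c : TotalChains k X} {α : TotalHomology k X} (h : IsClass c α) :
    IsClass (totalSign k X c) (degreeSign k X α) := by
  obtain ⟨z, rfl, rfl⟩ := h
  refine ⟨DirectSum.lmap (fun n => (-1 : k) ^ n •
    (LinearMap.id : Cycles (SingularChains k X) n →ₗ[k] _)) z, ?_, ?_⟩
  · induction z using DirectSum.induction_on with
    | zero => simp
    | add x y hx hy => simp only [map_add, hx, hy]
    | of n z =>
      have := cyclesι_lof n z
      rw [DirectSum.lof_eq_of] at this
      rw [this, totalSign_ofDegree]
      erw [DirectSum.lmap_lof]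
      simp [cyclesι_lof]
  · induction z using DirectSum.induction_on with
    | zero => simp
    | add x y hx hy => simp only [map_add, hx, hy]
    | of n z =>
      have := totalClass_lof n z
      rw [DirectSum.lof_eq_of] at this
      rw [this]
      erw [DirectSum.lmap_lof]
      simp [totalClass_lof, degreeSign]

lemma IsClass.cross {a : TotalChains k X} {b : TotalChains k Y} {α : TotalHomology k X}
    {β : TotalHomology k Y} (ha : IsClass a α) (hb : IsClass b β) :
    IsClass (totalCross k X Y (a ⊗ₜ b)) (kunneth k X Y (α ⊗ₜ β)) := by
  obtain ⟨z, rfl, rfl⟩ := ha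
  obtain ⟨z', rfl, rfl⟩ := hb
  induction z using DirectSum.induction_on with
  | zero => simpa using isClass_d (0 : TotalChains k (X × Y))
  | add x y hx hy => simpa only [map_add, TensorProduct.add_tmul] using hx.add hy
  | of p a =>
    induction z' using DirectSum.induction_on with
    | zero => simpa using isClass_d (0 : TotalChains k (X × Y))
    | add x y hx hy => simpa only [map_add, TensorProduct.tmul_add] using hx.add hy
    | of q b =>
      refine ⟨DirectSum.lof k ℕ (fun n => Cycles (SingularChains k (X × Y)) n) (p + q)
        ⟨_, chainCross_mem k a b⟩, ?_, ?_⟩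
      · have h1 := cyclesι_lof p a
        have h2 := cyclesι_lof q b
        rw [DirectSum.lof_eq_of] at h1 h2
        rw [h1, h2, totalCross_ofDegree, cyclesι_lof]
      · have h1 := totalClass_lof p a
        have h2 := totalClass_lof q b
        rw [DirectSum.lof_eq_of] at h1 h2
        rw [h1, h2, kunneth_lof, totalClass_lof]
        exact congrArg _ (homologyCross_class ..).symm

lemma IsClass.cross_map (y : TotalCycles k X ⊗[k] TotalCycles k Y) :
    IsClass (totalCross k X Y (TensorProduct.map (cyclesι k X) (cyclesι k Y) y))
      (kunneth k X Y (TensorProduct.map (totalClass k X) (totalClass k Y) y)) := by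
  induction y using TensorProduct.induction_on with
  | zero => simpa using isClass_d (0 : TotalChains k (X × Y))
  | add x y hx hy => simpa only [map_add] using hx.add hy
  | tmul a b => exact IsClass.cross ⟨a, rfl, rfl⟩ ⟨b, rfl, rfl⟩

lemma homologyMap_id : homologyMap k (ContinuousMap.id X) = LinearMap.id := by
  refine LinearMap.ext fun α => ?_
  obtain ⟨c, hc⟩ := exists_isClass α
  have := hc.map (ContinuousMap.id X)
  rw [totalMap_id] at this
  exact this.unique hc

lemma homologyMap_comp {Z : Type u} [TopologicalSpace Z] (g : C(Y, Z)) (f : C(X, Y)) :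
    homologyMap k (g.comp f) = homologyMap k g ∘ₗ homologyMap k f := by
  refine LinearMap.ext fun α => ?_
  obtain ⟨c, hc⟩ := exists_isClass α
  have := hc.map (g.comp f)
  rw [totalMap_comp] at this
  exact this.unique ((hc.map f).map g)

/-- Homotopic maps induce the same map in homology. -/
theorem homologyMap_congr {f g : C(X, Y)} (h : f.Homotopic g) :
    homologyMap k f = homologyMap k g := by
  obtain ⟨H⟩ := h
  unfold homologyMap
  congr 1
  funext n
  exact congrArg ModuleCat.Hom.hom
    (TopCat.Homotopy.congr_homologyMap_singularChainComplexFunctor (C := ModuleCat.{max w u} k)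
      (f := TopCat.ofHom f) (g := TopCat.ofHom g) H (ModuleCat.of k (ULift.{u} k)) n)

/-- Homotopic maps send a cycle to homologous cycles. -/
lemma exists_totalD_eq_sub {f g : C(X, Y)} (h : f.Homotopic g) {c : TotalChains k X}
    (hc : totalD k X c = 0) : ∃ m, totalD k Y m = totalMap k f c - totalMap k g c := by
  obtain ⟨α, hα⟩ := exists_isClass_of_d hc
  exact ((hα.map f).sub (hα.map g)).eq_zero_iff.1 (by rw [homologyMap_congr h, sub_self])

/-- The Künneth morphism is natural. -/
lemma homologyMap_kunneth {X' Y' : Type u} [TopologicalSpace X'] [TopologicalSpace Y']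
    (f : C(X, X')) (g : C(Y, Y')) (α : TotalHomology k X) (β : TotalHomology k Y) :
    homologyMap k (f.prodMap g) (kunneth k X Y (α ⊗ₜ β)) =
      kunneth k X' Y' (homologyMap k f α ⊗ₜ homologyMap k g β) := by
  obtain ⟨a, ha⟩ := exists_isClass α
  obtain ⟨b, hb⟩ := exists_isClass β
  refine ((ha.cross hb).map (f.prodMap g)).unique ?_
  rw [totalCross_natural]
  exact (ha.map f).cross (hb.map g)

end TotalHomology

/-! ### Chains of contractible spaces -/
section Contractible
open scoped Simplicial DirectSum TensorProduct
variable (k : Type w) [CommRing k] {X Y : Type u} [TopologicalSpace X] [TopologicalSpace Y]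

/-- The singular chains form a free module on the singular simplices. -/
def chainEquiv (n : ℕ) : (SingularChains k X).X n ≃ₗ[k] (SingularSimplex X n →₀ k) :=
  LinearEquiv.ofLinearMap (chainLift fun σ => Finsupp.single σ 1)
    (Finsupp.linearCombination k fun σ => simplexChain k σ)
    (by
      refine Finsupp.lhom_ext' fun σ => LinearMap.ext_ring ?_
      simp [chainLift_simplexChain])
    (by
      refine chain_ext fun σ => ?_
      simp [chainLift_simplexChain])

instance : Module.Flat k (TotalChains k X) := by
  have : ∀ n, Module.Flat k ((SingularChains k X).X n) := fun n => .of_linearEquiv (chainEquiv k n)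
  infer_instance

instance [IsDomain k] : Module.IsTorsionFree k (TotalChains k X) := by
  have : ∀ n, Module.IsTorsionFree k ((SingularChains k X).X n) := fun n =>
    (chainEquiv k n).injective.moduleIsTorsionFree _ fun r x => map_smul _ r x
  refine Module.isTorsionFree_iff_smul_eq_zero.2 fun r x h => or_iff_not_imp_left.2 fun hr => ?_
  refine DFinsupp.ext fun n => ?_
  exact (smul_eq_zero.1 (congr($h n) : r • x n = 0)).resolve_left hr

/-- The constant singular simplex at a point. -/
def constSimplex (x : X) (n : ℕ) : SingularSimplex X n :=
  ((TopCat.of X).toSSetObjEquiv _).symm (.const _ x)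

lemma simplexMap_const_map (y : Y) (n : ℕ) (σ : SingularSimplex X n) :
    simplexMap (.const X y) σ = constSimplex y n := rfl

/-- The `0`-chain given by a point. -/
def pointChain (x : X) : TotalChains k X := ofDegree 0 (simplexChain k (constSimplex x 0))

/-- The augmentation of the singular chains. -/
def augmentation : TotalChains k X →ₗ[k] ULift.{u} k :=
  DirectSum.toModule k ℕ _ fun n => if n = 0 then chainLift fun _ => ULift.up 1 else 0

lemma augmentation_zero (σ : SingularSimplex X 0) :
    augmentation k (ofDegree 0 (simplexChain k σ)) = ULift.up 1 := by
  simp [augmentation, chainLift_simplexChain]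

lemma augmentation_succ (n : ℕ) (c : (SingularChains k X).X (n + 1)) :
    augmentation k (ofDegree (n + 1) c) = 0 := by
  simp [augmentation]

/-- Only 1-simplices matter, and their two faces enter with opposite signs. -/
lemma augmentation_totalD (c : TotalChains k X) : augmentation k (totalD k X c) = 0 := by
  suffices augmentation k ∘ₗ totalD k X = 0 from congr($this c)
  refine totalChains_ext fun n σ => ?_
  rw [LinearMap.comp_apply, totalD_ofDegree]
  rcases n with _ | _ | n
  · rw [d_zero_pred]; simp
  · change augmentation k (ofDegree 0 ((SingularChains k X).d (0 + 1) 0 _)) = 0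
    rw [d_simplexChain]
    simp [Fin.sum_univ_two, augmentation_zero]
  · exact augmentation_succ k n _

lemma simplexPull_const {m n : ℕ} (θ : ⦋m⦌ ⟶ ⦋n⦌) (x : X) :
    simplexPull θ (constSimplex x n) = constSimplex x m := rfl

/-- All n + 2 faces coincide, and their alternating signs add up to 0 or 1 according to the parity
of n. -/
lemma totalD_constSimplex (x : X) (n : ℕ) :
    totalD k X (ofDegree (n + 1) (simplexChain k (constSimplex x (n + 1)))) =
      if Even n then 0 else ofDegree n (simplexChain k (constSimplex x n)) := by
  rw [totalD_ofDegree]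
  change ofDegree n ((SingularChains k X).d (n + 1) n _) = _
  rw [d_simplexChain]
  simp only [simplexPull_const, ← Finset.sum_smul, Fin.sum_neg_one_pow]
  by_cases h : Even n <;> simp [h, Nat.even_add_one]

/-- A contraction of the complex spanned by constant simplices. -/
def constHomotopy (y : Y) : TotalChains k Y →ₗ[k] TotalChains k Y :=
  DirectSum.toModule k ℕ _ fun n => if Even n then 0 else
    chainLift fun _ => ofDegree (n + 1) (simplexChain k (constSimplex y (n + 1)))

lemma constHomotopy_simplex (y : Y) (n : ℕ) (σ : SingularSimplex Y n) :
    constHomotopy k y (ofDegree n (simplexChain k σ)) =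
      if Even n then 0 else ofDegree (n + 1) (simplexChain k (constSimplex y (n + 1))) := by
  by_cases h : Even n <;> simp [constHomotopy, h, chainLift_simplexChain]

/-- The differentials between constant simplices are alternately zero and the identity, so the part
in positive degrees is contractible and only the augmentation in degree 0 survives. -/
lemma totalMap_const (y : Y) (c : TotalChains k Y) : totalMap k (.const Y y) c =
    totalD k Y (constHomotopy k y c) + constHomotopy k y (totalD k Y c) +
      (augmentation k c).down • pointChain k y := by
  suffices totalMap k (.const Y y) = totalD k Y ∘ₗ constHomotopy k y +
    constHomotopy k y ∘ₗ totalD k Y + ((LinearMap.toSpanSingleton k _ (pointChain k y)) ∘ₗ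
      ULift.moduleEquiv.toLinearMap) ∘ₗ augmentation k from congr($this c)
  refine totalChains_ext fun n σ => ?_
  rw [totalMap_ofDegree, chainMap_simplexChain, simplexMap_const_map]
  simp only [LinearMap.add_apply, LinearMap.comp_apply]
  rw [constHomotopy_simplex]
  rcases n with _ | n
  · rw [totalD_ofDegree, d_zero_pred, augmentation_zero]
    simp [pointChain]
  · rw [augmentation_succ, totalD_ofDegree]
    change _ = _ + constHomotopy k y (ofDegree n ((SingularChains k Y).d (n + 1) n _)) + _
    rw [d_simplexChain]
    simp only [map_sum, map_zsmul, constHomotopy_simplex, map_zero, add_zero, ← Finset.sum_smul,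
      Fin.sum_neg_one_pow, Nat.even_add_one, not_not]
    by_cases h : Even n
    · rw [if_neg (by simpa using h), totalD_constSimplex,
        if_neg (by simpa [Nat.even_add_one] using h)]
      simp [h]
    · simp [h]

/-- A cycle of a contractible space is homologous to a multiple of a point. -/
lemma exists_totalD_eq_sub_pointChain {y : Y} (h : (ContinuousMap.id Y).Homotopic (.const Y y))
    {c : TotalChains k Y} (hc : totalD k Y c = 0) :
    ∃ m, totalD k Y m = c - (augmentation k c).down • pointChain k y := by
  obtain ⟨m, hm⟩ := exists_totalD_eq_sub h hc
  -- The homotopy to the constant map bounds c minus its constant image by m. The contraction of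
  -- constant chains bounds the rest, up to a multiple of the point.
  refine ⟨m + constHomotopy k y c, ?_⟩
  rw [totalMap_id, LinearMap.id_apply, totalMap_const, hc, map_zero, add_zero] at hm
  rw [map_add, hm]
  abel

lemma totalD_pointChain (y : Y) : totalD k Y (pointChain k y) = 0 := by
  rw [pointChain, totalD_ofDegree, d_zero_pred, map_zero]

lemma totalSign_pointChain (y : Y) : totalSign k Y (pointChain k y) = pointChain k y := by
  rw [pointChain, totalSign_ofDegree, pow_zero, one_smul]

lemma totalCross_pointChain (x : X) (y : Y) :
    totalCross k X Y (pointChain k x ⊗ₜ pointChain k y) = pointChain k (x, y) := by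
  rw [pointChain, pointChain, totalCross_ofDegree, chainCross_simplex]
  change ofDegree 0 (evalPair k _ _ (shuffles 0 0 0)) = _
  rw [shuffles, evalPair_single, one_smul]
  rfl

lemma augmentation_pointChain (y : Y) : augmentation k (pointChain k y) = ULift.up 1 :=
  augmentation_zero k _

/-- The augmentation detects classes: if r c is a boundary with r ≠ 0, then r ε(c) = 0, so ε(c) = 0
in the domain k, and a cycle of augmentation zero bounds. -/
lemma isTorsionFree_of_contractible [IsDomain k] {y : Y}
    (h : (ContinuousMap.id Y).Homotopic (.const Y y)) :
    Module.IsTorsionFree k (TotalHomology k Y) := by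
  refine Module.isTorsionFree_iff_smul_eq_zero.2 fun r α hα => or_iff_not_imp_left.2 fun hr => ?_
  obtain ⟨c, hc⟩ := exists_isClass α
  obtain ⟨m, hm⟩ := (hc.smul r).eq_zero_iff.1 hα
  have h1 := augmentation_totalD k m
  rw [hm, map_smul] at h1
  have h2 : augmentation k c = 0 := by
    have h3 := congr(ULift.down $h1)
    refine ULift.ext _ _ ((mul_eq_zero.1 (h3 : r * (augmentation k c).down = 0)).resolve_left hr)
  obtain ⟨b, hb⟩ := exists_totalD_eq_sub_pointChain k h hc.d_eq_zero
  refine hc.eq_zero_iff.2 ⟨b, ?_⟩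
  rw [hb, h2]
  simp

/-- First a is replaced by r p using m ⊗ b, and then b by r' q using r (p ⊗ n). The second
replacement needs no sign because s fixes p, which stands for a point. -/
lemma tmul_eq_add_tensorD {M N : Type*} [AddCommGroup M] [Module k M] [AddCommGroup N] [Module k N]
    {d s : M →ₗ[k] M} {e : N →ₗ[k] N} {a m p : M} {b n q : N} {r r' : k} (hp : d p = 0)
    (hs : s p = p) (hb : e b = 0) (hm : d m = a - r • p) (hn : e n = b - r' • q) :
    a ⊗ₜ[k] b = (r * r') • (p ⊗ₜ q) + tensorD d s e (m ⊗ₜ b + r • (p ⊗ₜ n)) := by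
  rw [map_add, tensorD_tmul, map_smul, tensorD_tmul, hb, hm, hn, hp, hs]
  simp only [TensorProduct.sub_tmul, TensorProduct.tmul_sub, TensorProduct.tmul_zero,
    TensorProduct.zero_tmul, TensorProduct.tmul_smul, ← TensorProduct.smul_tmul']
  module

/-- The cycles of the tensor product of the chains of two contractible spaces. -/
lemma exists_tensorD_of_contractible [IsDomain k] [IsPrincipalIdealRing k] {x : X} {y : Y}
    (h : (ContinuousMap.id X).Homotopic (.const X x))
    (h' : (ContinuousMap.id Y).Homotopic (.const Y y)) (c : TotalChains k X ⊗[k] TotalChains k Y)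
    (hc : tensorD (totalD k X) (totalSign k X) (totalD k Y) c = 0) :
    ∃ (r : k) (m : _), c = r • (pointChain k x ⊗ₜ pointChain k y) +
      tensorD (totalD k X) (totalSign k X) (totalD k Y) m := by
  have := isTorsionFree_of_contractible k h
  have := (isHomology_total k X).flat_coker
  -- The homology of X is torsion free, so the algebraic Künneth theorem reduces the claim to
  -- products of cycles.
  obtain ⟨z, m, rfl⟩ := (isHomology_total k X).exists_map_add (isHomology_total k Y)
    (totalSign_totalSign k) (totalSign_totalD k) c hc
  suffices h : ∀ z, ∃ (r : k) (m : _), TensorProduct.map (cyclesι k X) (cyclesι k Y) z =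
      r • (pointChain k x ⊗ₜ pointChain k y) +
        tensorD (totalD k X) (totalSign k X) (totalD k Y) m by
    obtain ⟨r, m', hm⟩ := h z
    exact ⟨r, m' + m, by rw [hm, map_add, add_assoc]⟩
  intro z
  induction z using TensorProduct.induction_on with
  | zero => exact ⟨0, 0, by simp⟩
  | add z z' hz hz' =>
    obtain ⟨r, m, hm⟩ := hz
    obtain ⟨r', m', hm'⟩ := hz'
    exact ⟨r + r', m + m', by rw [map_add, map_add, hm, hm', add_smul, add_add_add_comm]⟩
  | tmul a b =>
    have ha := (isHomology_total k X).d_ι a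
    have hb := (isHomology_total k Y).d_ι b
    obtain ⟨m, hm⟩ := exists_totalD_eq_sub_pointChain k h ha
    obtain ⟨m', hm'⟩ := exists_totalD_eq_sub_pointChain k h' hb
    exact ⟨_, _, tmul_eq_add_tensorD k (totalD_pointChain k x) (totalSign_pointChain k x) hb hm hm'⟩

end Contractible

/-! ### The Eilenberg-Zilber theorem and the Künneth theorem -/
section EilenbergZilber
open scoped DirectSum TensorProduct
variable (k : Type w) [CommRing k] {X Y : Type u} [TopologicalSpace X] [TopologicalSpace Y]

/-- The topological simplex, in a given universe. -/
abbrev TopSimplex (n : ℕ) : Type u := SimplexCategory.toTop.{u}.obj (SimplexCategory.mk n)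

/-- The tautological singular simplex of the topological simplex. -/
def idSimplex (n : ℕ) : SingularSimplex (TopSimplex.{u} n) n := ULift.up (𝟙 _)

/-- A singular simplex, as a continuous map. -/
def classify {n : ℕ} (σ : SingularSimplex X n) : C(TopSimplex.{u} n, X) := σ.down.hom

lemma classify_simplexMap {n : ℕ} (f : C(X, Y)) (σ : SingularSimplex X n) :
    classify (simplexMap f σ) = f.comp (classify σ) := rfl

lemma classify_idSimplex (n : ℕ) : classify (idSimplex.{u} n) = .id _ := rfl

lemma exists_homotopic_const (n : ℕ) :
    ∃ x, (ContinuousMap.id (TopSimplex.{u} n)).Homotopic (.const _ x) := by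
  have h1 : ContractibleSpace (stdSimplex ℝ (Fin (n + 1))) :=
    (convex_stdSimplex ℝ (Fin (n + 1))).contractibleSpace ⟨_, single_mem_stdSimplex ℝ 0⟩
  have h2 : ContractibleSpace (TopSimplex.{u} n) :=
    (Homeomorph.ulift (X := stdSimplex ℝ (Fin (n + 1)))).contractibleSpace
  exact (contractible_iff_id_nullhomotopic _).1 h2

variable (X Y) in
/-- The underlying module of the cone of the cross product. -/
abbrev CrossCone : Type max w u :=
  (TotalChains k X ⊗[k] TotalChains k Y) × TotalChains k (X × Y)

variable (X Y) in
/-- The differential of the cone of the cross product. -/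
def coneD : CrossCone k X Y →ₗ[k] CrossCone k X Y :=
  LinearMap.prod (-(tensorD (totalD k X) (totalSign k X) (totalD k Y) ∘ₗ LinearMap.fst k _ _))
    (totalCross k X Y ∘ₗ LinearMap.fst k _ _ + totalD k (X × Y) ∘ₗ LinearMap.snd k _ _)

lemma coneD_apply (x : TotalChains k X ⊗[k] TotalChains k Y) (y : TotalChains k (X × Y)) :
    coneD k X Y (x, y) = (-tensorD (totalD k X) (totalSign k X) (totalD k Y) x,
      totalCross k X Y x + totalD k (X × Y) y) := rfl

/-- The functoriality of the cone of the cross product. -/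
def coneMap {X' Y' : Type u} [TopologicalSpace X'] [TopologicalSpace Y'] (f : C(X, X'))
    (g : C(Y, Y')) : CrossCone k X Y →ₗ[k] CrossCone k X' Y' :=
  (TensorProduct.map (totalMap k f) (totalMap k g)).prodMap (totalMap k (f.prodMap g))

lemma coneMap_id : coneMap k (.id X) (.id Y) = LinearMap.id := by
  have h : (ContinuousMap.id X).prodMap (ContinuousMap.id Y) = .id (X × Y) := rfl
  rw [coneMap, h, totalMap_id, totalMap_id, totalMap_id, TensorProduct.map_id,
    LinearMap.prodMap_id]

lemma coneMap_comp {X' Y' X'' Y'' : Type u} [TopologicalSpace X'] [TopologicalSpace Y']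
    [TopologicalSpace X''] [TopologicalSpace Y''] (f : C(X, X')) (g : C(Y, Y')) (f' : C(X', X''))
    (g' : C(Y', Y'')) : coneMap k (f'.comp f) (g'.comp g) = coneMap k f' g' ∘ₗ coneMap k f g := by
  have h : (f'.comp f).prodMap (g'.comp g) = (f'.prodMap g').comp (f.prodMap g) := rfl
  rw [coneMap, h, totalMap_comp, totalMap_comp, totalMap_comp, TensorProduct.map_comp]
  rfl

/-- The sign in the first component of `coneD` cancels the two mixed terms, which agree since the
cross product is a chain map. -/
lemma coneD_coneD (z : CrossCone k X Y) : coneD k X Y (coneD k X Y z) = 0 := by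
  obtain ⟨x, y⟩ := z
  rw [coneD_apply, coneD_apply, map_neg, tensorD_tensorD (totalD_totalD k) (totalD_totalD k)
    (totalSign_totalD k), map_neg, map_add, totalCross_tensorD, totalD_totalD]
  simp

lemma coneD_coneMap {X' Y' : Type u} [TopologicalSpace X'] [TopologicalSpace Y'] (f : C(X, X'))
    (g : C(Y, Y')) (z : CrossCone k X Y) :
    coneD k X' Y' (coneMap k f g z) = coneMap k f g (coneD k X Y z) := by
  obtain ⟨x, y⟩ := z
  have h : tensorD (totalD k X') (totalSign k X') (totalD k Y')
      (TensorProduct.map (totalMap k f) (totalMap k g) x) =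
      TensorProduct.map (totalMap k f) (totalMap k g)
        (tensorD (totalD k X) (totalSign k X) (totalD k Y) x) := by
    induction x using TensorProduct.induction_on with
    | zero => simp
    | add x y hx hy => simp only [map_add, hx, hy]
    | tmul x y => simp only [TensorProduct.map_tmul, tensorD_tmul, map_add, totalMap_totalD,
        totalMap_totalSign]
  rw [coneMap, LinearMap.prodMap_apply, coneD_apply, coneD_apply, LinearMap.prodMap_apply, h,
    map_neg, map_add, totalCross_natural, totalMap_totalD]

/-- The cone is exact for contractible spaces. -/
lemma exists_coneD_of_contractible [IsDomain k] [IsPrincipalIdealRing k] {x : X} {y : Y}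
    (h : (ContinuousMap.id X).Homotopic (.const X x))
    (h' : (ContinuousMap.id Y).Homotopic (.const Y y)) (z : CrossCone k X Y)
    (hz : coneD k X Y z = 0) : ∃ t, coneD k X Y t = z := by
  obtain ⟨c, b⟩ := z
  rw [coneD_apply, Prod.mk_eq_zero, neg_eq_zero] at hz
  obtain ⟨hc, hb⟩ := hz
  obtain ⟨r, m, rfl⟩ := exists_tensorD_of_contractible k h h' c hc
  -- The cross product of the two points is a point, of augmentation 1, while boundaries have
  -- augmentation 0. So r is the augmentation of the second component of the cycle equation.
  have hr : r = 0 := by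
    have := congr(augmentation k $hb)
    rw [map_add, augmentation_totalD, map_add, map_add, totalCross_tensorD, augmentation_totalD,
      map_smul, map_smul, totalCross_pointChain, augmentation_pointChain] at this
    simpa using congr(ULift.down $this)
  subst hr
  rw [zero_smul, zero_add] at hb ⊢
  rw [totalCross_tensorD, ← map_add] at hb
  have hP : (ContinuousMap.id (X × Y)).Homotopic (.const _ (x, y)) := h.prodMap h'
  obtain ⟨t, ht⟩ := exists_totalD_eq_sub_pointChain k hP hb
  set r := (augmentation k (totalCross k X Y m + b)).down
  -- The summand -m produces the first component. The cycle × m + b is the boundary of t plus r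
  -- times a point, and the summand r (x ⊗ y) supplies that point.
  refine ⟨(-m + r • (pointChain k x ⊗ₜ pointChain k y), t), ?_⟩
  rw [coneD_apply, ht, map_add, map_neg, map_smul, tensorD_tmul, totalD_pointChain,
    totalD_pointChain, map_add, map_neg, map_smul, totalCross_pointChain]
  simp only [TensorProduct.zero_tmul, TensorProduct.tmul_zero, add_zero, smul_zero, neg_neg]
  congr 1
  abel


end EilenbergZilber

/-! ### The Eilenberg-Zilber theorem and the Künneth theorem -/
section EilenbergZilber
open scoped DirectSum TensorProduct
variable (k : Type w) [CommRing k] {X Y : Type u} [TopologicalSpace X] [TopologicalSpace Y]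

variable {k} in
/-- A generator of the cone. -/
def coneInl {p q : ℕ} (σ : SingularSimplex X p) (τ : SingularSimplex Y q) : CrossCone k X Y :=
  (ofDegree p (simplexChain k σ) ⊗ₜ ofDegree q (simplexChain k τ), 0)

variable {k} in
/-- A generator of the cone. -/
def coneInr {n : ℕ} (ρ : SingularSimplex (X × Y) n) : CrossCone k X Y :=
  (0, ofDegree n (simplexChain k ρ))

lemma coneMap_coneInl {X' Y' : Type u} [TopologicalSpace X'] [TopologicalSpace Y'] (f : C(X, X'))
    (g : C(Y, Y')) {p q : ℕ} (σ : SingularSimplex X p) (τ : SingularSimplex Y q) :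
    coneMap k f g (coneInl σ τ) = coneInl (simplexMap f σ) (simplexMap g τ) := by
  rw [coneMap, coneInl, LinearMap.prodMap_apply, TensorProduct.map_tmul, map_zero,
    totalMap_ofDegree, totalMap_ofDegree, chainMap_simplexChain, chainMap_simplexChain, coneInl]

lemma coneMap_coneInr {X' Y' : Type u} [TopologicalSpace X'] [TopologicalSpace Y'] (f : C(X, X'))
    (g : C(Y, Y')) {n : ℕ} (ρ : SingularSimplex (X × Y) n) :
    coneMap k f g (coneInr ρ) = coneInr (simplexMap (f.prodMap g) ρ) := by
  rw [coneMap, coneInr, LinearMap.prodMap_apply, map_zero, totalMap_ofDegree,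
    chainMap_simplexChain, coneInr]

lemma coneMap_coneMap {X' Y' X'' Y'' : Type u} [TopologicalSpace X'] [TopologicalSpace Y']
    [TopologicalSpace X''] [TopologicalSpace Y''] (f : C(X, X')) (g : C(Y, Y')) (f' : C(X', X''))
    (g' : C(Y', Y'')) (z : CrossCone k X Y) :
    coneMap k f' g' (coneMap k f g z) = coneMap k (f'.comp f) (g'.comp g) z := by
  rw [coneMap_comp]; rfl

lemma crossCone_ext {M : Type max w u} [AddCommGroup M] [Module k M]
    {f g : CrossCone k X Y →ₗ[k] M}
    (h : ∀ p q (σ : SingularSimplex X p) (τ : SingularSimplex Y q),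
      f (coneInl σ τ) = g (coneInl σ τ))
    (h' : ∀ n (ρ : SingularSimplex (X × Y) n), f (coneInr ρ) = g (coneInr ρ)) : f = g := by
  refine LinearMap.prod_ext ?_ (totalChains_ext h')
  exact TensorProduct.ext <| totalChains_ext fun p σ => totalChains_ext fun q τ => h p q σ τ

/-- The linear map on the cone with prescribed values on the generators. -/
def coneLift {M : Type max w u} [AddCommGroup M] [Module k M]
    (φ : ∀ p q (_ : SingularSimplex X p) (_ : SingularSimplex Y q), M)
    (ψ : ∀ n (_ : SingularSimplex (X × Y) n), M) : CrossCone k X Y →ₗ[k] M :=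
  LinearMap.coprod
    (TensorProduct.lift <| DirectSum.toModule k ℕ _ fun p => chainLift fun σ =>
      DirectSum.toModule k ℕ _ fun q => chainLift fun τ => φ p q σ τ)
    (DirectSum.toModule k ℕ _ fun n => chainLift fun ρ => ψ n ρ)

lemma coneLift_left {M : Type max w u} [AddCommGroup M] [Module k M]
    (φ : ∀ p q (_ : SingularSimplex X p) (_ : SingularSimplex Y q), M)
    (ψ : ∀ n (_ : SingularSimplex (X × Y) n), M) (p q σ τ) :
    coneLift k φ ψ (coneInl σ τ) =
      φ p q σ τ := by
  simp [coneInl, coneLift, chainLift_simplexChain]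

lemma coneLift_right {M : Type max w u} [AddCommGroup M] [Module k M]
    (φ : ∀ p q (_ : SingularSimplex X p) (_ : SingularSimplex Y q), M)
    (ψ : ∀ n (_ : SingularSimplex (X × Y) n), M) (n ρ) :
    coneLift k φ ψ (coneInr ρ) = ψ n ρ := by
  simp [coneInr, coneLift, chainLift_simplexChain]


/-! ### Filtration of the cone by the degree of the generators -/

variable (X Y) in
/-- The span of the generators of degree less than `n`. -/
def coneSpan (n : ℕ) : Submodule k (CrossCone k X Y) :=
  Submodule.span k ({z | ∃ (p q : ℕ) (σ : SingularSimplex X p) (τ : SingularSimplex Y q),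
    p + q + 1 < n ∧ coneInl σ τ = z} ∪
    {z | ∃ (m : ℕ) (ρ : SingularSimplex (X × Y) m), m < n ∧ coneInr ρ = z})

lemma coneInl_mem {n p q : ℕ} (h : p + q + 1 < n) (σ : SingularSimplex X p)
    (τ : SingularSimplex Y q) : coneInl σ τ ∈ coneSpan k X Y n :=
  Submodule.subset_span (.inl ⟨p, q, σ, τ, h, rfl⟩)

lemma coneInr_mem {n m : ℕ} (h : m < n) (ρ : SingularSimplex (X × Y) m) :
    coneInr ρ ∈ coneSpan k X Y n :=
  Submodule.subset_span (.inr ⟨m, ρ, h, rfl⟩)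

lemma coneSpan_mono {m n : ℕ} (h : m ≤ n) : coneSpan k X Y m ≤ coneSpan k X Y n := by
  refine Submodule.span_le.2 ?_
  rintro _ (⟨p, q, σ, τ, hp, rfl⟩ | ⟨m, ρ, hm, rfl⟩)
  · exact coneInl_mem k (hp.trans_le h) σ τ
  · exact coneInr_mem k (hm.trans_le h) ρ

lemma coneSpan_eq {n : ℕ} {M : Type*} [AddCommGroup M] [Module k M]
    {f g : CrossCone k X Y →ₗ[k] M}
    (h : ∀ p q (σ : SingularSimplex X p) (τ : SingularSimplex Y q), p + q + 1 < n →
      f (coneInl σ τ) = g (coneInl σ τ))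
    (h' : ∀ m (ρ : SingularSimplex (X × Y) m), m < n → f (coneInr ρ) = g (coneInr ρ))
    {z : CrossCone k X Y} (hz : z ∈ coneSpan k X Y n) : f z = g z := by
  refine LinearMap.eqOn_span (s := _) ?_ hz
  rintro _ (⟨p, q, σ, τ, hp, rfl⟩ | ⟨m, ρ, hm, rfl⟩)
  · exact h p q σ τ hp
  · exact h' m ρ hm

lemma tmul_mem_coneSpan {n p q : ℕ} (h : p + q + 1 < n) (a : (SingularChains k X).X p)
    (b : (SingularChains k Y).X q) :
    ((ofDegree p a ⊗ₜ ofDegree q b, 0) : CrossCone k X Y) ∈ coneSpan k X Y n := by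
  -- Membership is vanishing in the quotient, a bilinear condition that can be tested on simplices.
  let φ : (SingularChains k X).X p →ₗ[k] (SingularChains k Y).X q →ₗ[k]
      CrossCone k X Y ⧸ coneSpan k X Y n :=
    ((TensorProduct.mk k _ _).compl₁₂ (ofDegree p) (ofDegree q)).compr₂
      ((coneSpan k X Y n).mkQ ∘ₗ LinearMap.inl k _ _)
  have : φ = 0 := chain_ext fun σ => chain_ext fun τ =>
    (Submodule.Quotient.mk_eq_zero _).2 (coneInl_mem k h σ τ)
  exact (Submodule.Quotient.mk_eq_zero _).1 congr($this a b)

lemma right_mem_coneSpan {n m : ℕ} (h : m < n) (c : (SingularChains k (X × Y)).X m) :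
    ((0, ofDegree m c) : CrossCone k X Y) ∈ coneSpan k X Y n := by
  have : (coneSpan k X Y n).mkQ ∘ₗ LinearMap.inr k _ _ ∘ₗ ofDegree m = 0 := chain_ext fun ρ =>
    (Submodule.Quotient.mk_eq_zero _).2 (coneInr_mem k h ρ)
  exact (Submodule.Quotient.mk_eq_zero _).1 congr($this c)

lemma exists_mem_coneSpan (z : CrossCone k X Y) : ∃ n, z ∈ coneSpan k X Y n := by
  have : (⨆ n, coneSpan k X Y n).mkQ = 0 := by
    refine crossCone_ext k (fun p q σ τ => ?_) (fun n ρ => ?_)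
    · exact (Submodule.Quotient.mk_eq_zero _).2
        (Submodule.mem_iSup_of_mem (p + q + 2) (coneInl_mem k (by omega) σ τ))
    · exact (Submodule.Quotient.mk_eq_zero _).2
        (Submodule.mem_iSup_of_mem (n + 1) (coneInr_mem k (by omega) ρ))
  refine (Submodule.mem_iSup_of_directed _ ?_).1
    ((Submodule.Quotient.mk_eq_zero _).1 congr($this z))
  exact Monotone.directed_le fun m n h => coneSpan_mono k h

/-- The generator has degree p + q + 1 in the cone, so its differential lies one step lower. This is
what drives the induction in `exists_coneEnd`. -/
lemma coneD_coneInl_mem {p q : ℕ} (σ : SingularSimplex X p) (τ : SingularSimplex Y q) :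
    coneD k X Y (coneInl σ τ) ∈ coneSpan k X Y (p + q + 1) := by
  rw [coneInl, coneD_apply, tensorD_tmul, map_zero, add_zero, totalCross_ofDegree]
  generalize simplexChain k σ = a
  generalize simplexChain k τ = b
  have h1 : ((totalD k _ (ofDegree p a) ⊗ₜ ofDegree q b, 0) : CrossCone k X Y) ∈
      coneSpan k X Y (p + q + 1) := by
    rw [totalD_ofDegree]
    rcases p with _ | p
    · rw [d_zero_pred, map_zero, TensorProduct.zero_tmul]
      exact zero_mem _
    · exact tmul_mem_coneSpan k (by omega) _ _
  have h2 : ((totalSign k _ (ofDegree p a) ⊗ₜ totalD k _ (ofDegree q b), 0) :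
      CrossCone k X Y) ∈ coneSpan k X Y (p + q + 1) := by
    rw [totalD_ofDegree, totalSign_ofDegree, ← map_smul]
    rcases q with _ | q
    · rw [d_zero_pred, map_zero, TensorProduct.tmul_zero]
      exact zero_mem _
    · exact tmul_mem_coneSpan k (by omega) _ _
  have h3 := right_mem_coneSpan k (n := p + q + 1) (by omega) (chainCross k (p + q) p q a b)
  have h4 := add_mem (neg_mem (add_mem h1 h2)) h3
  rwa [Prod.mk_add_mk, Prod.neg_mk, Prod.mk_add_mk, add_zero, add_zero, neg_zero, zero_add] at h4

lemma coneD_coneInr_mem {n : ℕ} (ρ : SingularSimplex (X × Y) n) :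
    coneD k X Y (coneInr ρ) ∈ coneSpan k X Y n := by
  rw [coneInr, coneD_apply, map_zero, map_zero, neg_zero, zero_add, totalD_ofDegree]
  rcases n with _ | n
  · rw [d_zero_pred, map_zero]
    exact zero_mem _
  · exact right_mem_coneSpan k (by omega) _

/-! ### Acyclic models -/

/-- A natural endomorphism of the cone of the cross product. -/
structure ConeEnd where
  app : ∀ (X Y : Type u) [TopologicalSpace X] [TopologicalSpace Y],
    CrossCone k X Y →ₗ[k] CrossCone k X Y
  naturality : ∀ {X Y X' Y' : Type u} [TopologicalSpace X] [TopologicalSpace Y]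
    [TopologicalSpace X'] [TopologicalSpace Y'] (f : C(X, X')) (g : C(Y, Y'))
    (z : CrossCone k X Y), app X' Y' (coneMap k f g z) = coneMap k f g (app X Y z)

/-- The cone is free on the models: a natural endomorphism may have any values on the universal
generators. -/
def ConeEnd.ofValues (v : ∀ p q, CrossCone k (TopSimplex.{u} p) (TopSimplex.{u} q))
    (v' : ∀ n, CrossCone k (TopSimplex.{u} n) (TopSimplex.{u} n)) : ConeEnd.{u} k where
  app X Y _ _ := coneLift k (fun p q σ τ => coneMap k (classify σ) (classify τ) (v p q))
    (fun n ρ => coneMap k (classify (simplexMap .fst ρ)) (classify (simplexMap .snd ρ)) (v' n))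
  naturality {X Y X' Y' _ _ _ _} f g z := by
    refine congr($(crossCone_ext k (f := coneLift k _ _ ∘ₗ coneMap k f g)
      (g := coneMap k f g ∘ₗ coneLift k _ _) ?_ ?_) z)
    · intro p q σ τ
      rw [LinearMap.comp_apply, LinearMap.comp_apply, coneMap_coneInl, coneLift_left,
        coneLift_left, coneMap_coneMap, classify_simplexMap, classify_simplexMap]
    · intro n ρ
      rw [LinearMap.comp_apply, LinearMap.comp_apply, coneMap_coneInr, coneLift_right,
        coneLift_right, coneMap_coneMap]
      rfl

variable {k} in
-- A Yoneda argument: σ ⊗ τ is the image of the tautological generator under the classifying maps.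
lemma ConeEnd.app_coneInl (h : ConeEnd.{u} k) {p q : ℕ} (σ : SingularSimplex X p)
    (τ : SingularSimplex Y q) : h.app X Y (coneInl σ τ) =
      coneMap k (classify σ) (classify τ) (h.app _ _ (coneInl (idSimplex p) (idSimplex q))) := by
  rw [← h.naturality, coneMap_coneInl]; rfl

variable {k} in
lemma ConeEnd.app_coneInr (h : ConeEnd.{u} k) {n : ℕ} (ρ : SingularSimplex (X × Y) n) :
    h.app X Y (coneInr ρ) =
      coneMap k (classify (simplexMap .fst ρ)) (classify (simplexMap .snd ρ))
        (h.app _ _ (coneInr (simplexPair (idSimplex n) (idSimplex n)))) := by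
  rw [← h.naturality, coneMap_coneInr]; rfl

lemma ConeEnd.ofValues_coneInl (v : ∀ p q, CrossCone k (TopSimplex.{u} p) (TopSimplex.{u} q))
    (v' : ∀ n, CrossCone k (TopSimplex.{u} n) (TopSimplex.{u} n)) (p q : ℕ) :
    (ConeEnd.ofValues k v v').app _ _ (coneInl (idSimplex p) (idSimplex q)) = v p q := by
  refine (coneLift_left k _ _ p q (idSimplex p) (idSimplex q)).trans ?_
  rw [classify_idSimplex, classify_idSimplex, coneMap_id, LinearMap.id_apply]

lemma ConeEnd.ofValues_coneInr (v : ∀ p q, CrossCone k (TopSimplex.{u} p) (TopSimplex.{u} q))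
    (v' : ∀ n, CrossCone k (TopSimplex.{u} n) (TopSimplex.{u} n)) (n : ℕ) :
    (ConeEnd.ofValues k v v').app _ _ (coneInr (simplexPair (idSimplex n) (idSimplex n))) =
      v' n := by
  refine (coneLift_right k _ _ n (simplexPair (idSimplex n) (idSimplex n))).trans ?_
  exact congr($(coneMap_id k) _)

/-- The inductive step of the construction of a contraction. -/
lemma ConeEnd.exists_eq (h : ConeEnd.{u} k) {n : ℕ}
    (hh : ∀ z ∈ coneSpan k X Y n, coneD k X Y (h.app X Y z) + h.app X Y (coneD k X Y z) = z)
    (ex : ∀ z, coneD k X Y z = 0 → ∃ t, coneD k X Y t = z) {z : CrossCone k X Y}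
    (hz : coneD k X Y z ∈ coneSpan k X Y n) :
    ∃ y, coneD k X Y y + h.app X Y (coneD k X Y z) = z := by
  -- The identity for h, applied to the cycle `coneD z`, gives d h d z = d z. So z - h d z is a
  -- cycle.
  obtain ⟨y, hy⟩ := ex (z - h.app X Y (coneD k X Y z)) (by
    have := hh _ hz
    rw [coneD_coneD, map_zero, add_zero] at this
    rw [map_sub, this, sub_self])
  exact ⟨y, by rw [hy, sub_add_cancel]⟩

variable [IsDomain k] [IsPrincipalIdealRing k]

/-- Simplices are contractible, so the cone of the model is exact and the inductive step applies to
its tautological generator. -/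
lemma ConeEnd.exists_eq_coneInl (h : ConeEnd.{u} k) {n p q : ℕ} (hn : p + q + 1 = n)
    (hh : ∀ z ∈ coneSpan k (TopSimplex.{u} p) (TopSimplex.{u} q) n,
      coneD k _ _ (h.app _ _ z) + h.app _ _ (coneD k _ _ z) = z) :
    ∃ y, coneD k (TopSimplex.{u} p) (TopSimplex.{u} q) y +
      h.app _ _ (coneD k _ _ (coneInl (idSimplex p) (idSimplex q))) =
        coneInl (idSimplex p) (idSimplex q) := by
  obtain ⟨x, hx⟩ := exists_homotopic_const.{u} p
  obtain ⟨y, hy⟩ := exists_homotopic_const.{u} q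
  subst hn
  have ex := exists_coneD_of_contractible k hx hy
  have hm := coneD_coneInl_mem k (idSimplex.{u} p) (idSimplex.{u} q)
  exact h.exists_eq k hh ex hm

lemma ConeEnd.exists_eq_coneInr (h : ConeEnd.{u} k) {n m : ℕ} (hn : m = n)
    (hh : ∀ z ∈ coneSpan k (TopSimplex.{u} m) (TopSimplex.{u} m) n,
      coneD k _ _ (h.app _ _ z) + h.app _ _ (coneD k _ _ z) = z) :
    ∃ y, coneD k (TopSimplex.{u} m) (TopSimplex.{u} m) y +
      h.app _ _ (coneD k _ _ (coneInr (simplexPair (idSimplex m) (idSimplex m)))) =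
        coneInr (simplexPair (idSimplex m) (idSimplex m)) := by
  obtain ⟨x, hx⟩ := exists_homotopic_const.{u} m
  subst hn
  have ex := exists_coneD_of_contractible k hx hx
  have hm := coneD_coneInr_mem k (simplexPair (idSimplex.{u} m) (idSimplex.{u} m))
  exact h.exists_eq k hh ex hm

/-- Contractions of the cone of the cross product in low degrees. -/
theorem exists_coneEnd (n : ℕ) : ∃ h : ConeEnd.{u} k,
    ∀ (X Y : Type u) [TopologicalSpace X] [TopologicalSpace Y], ∀ z ∈ coneSpan k X Y n,
      coneD k X Y (h.app X Y z) + h.app X Y (coneD k X Y z) = z := by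
  induction n with
  | zero =>
    refine ⟨ConeEnd.ofValues k 0 0, fun X Y _ _ z hz => ?_⟩
    have : z = 0 := by simpa [coneSpan] using hz
    simp [this]
  | succ n ih =>
    obtain ⟨h, hh⟩ := ih
    -- New values are chosen on the generators of degree exactly n. All other values of h are kept,
    -- so that the identity persists below n.
    have hl : ∀ p q, ∃ y, (p + q + 1 = n → coneD k (TopSimplex.{u} p) (TopSimplex.{u} q) y +
        h.app _ _ (coneD k _ _ (coneInl (idSimplex p) (idSimplex q))) =
        coneInl (idSimplex p) (idSimplex q)) ∧
        (p + q + 1 ≠ n → y = h.app _ _ (coneInl (idSimplex p) (idSimplex q))) := by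
      intro p q
      by_cases hn : p + q + 1 = n
      · obtain ⟨y, hy⟩ := h.exists_eq_coneInl k hn (hh (TopSimplex.{u} p) (TopSimplex.{u} q))
        exact ⟨y, fun _ => hy, fun h => absurd hn h⟩
      · exact ⟨_, fun h => absurd h hn, fun _ => rfl⟩
    have hr : ∀ m, ∃ y, (m = n → coneD k (TopSimplex.{u} m) (TopSimplex.{u} m) y +
        h.app _ _ (coneD k _ _ (coneInr (simplexPair (idSimplex m) (idSimplex m)))) =
        coneInr (simplexPair (idSimplex m) (idSimplex m))) ∧
        (m ≠ n → y = h.app _ _ (coneInr (simplexPair (idSimplex m) (idSimplex m)))) := by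
      intro m
      by_cases hn : m = n
      · obtain ⟨y, hy⟩ := h.exists_eq_coneInr k hn (hh (TopSimplex.{u} m) (TopSimplex.{u} m))
        exact ⟨y, fun _ => hy, fun h => absurd hn h⟩
      · exact ⟨_, fun h => absurd h hn, fun _ => rfl⟩
    choose v hv hv' using hl
    choose r hr hr' using hr
    set h' := ConeEnd.ofValues k v r with h'_def
    have agree : ∀ (X Y : Type u) [TopologicalSpace X] [TopologicalSpace Y],
        ∀ z ∈ coneSpan k X Y n, h'.app X Y z = h.app X Y z := by
      intro X Y _ _ z hz
      refine coneSpan_eq k (fun p q σ τ hp => ?_) (fun m ρ hm => ?_) hz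
      · rw [h'.app_coneInl, h.app_coneInl, h'_def, ConeEnd.ofValues_coneInl, hv' p q hp.ne]
      · rw [h'.app_coneInr, h.app_coneInr, h'_def, ConeEnd.ofValues_coneInr, hr' m hm.ne]
    refine ⟨h', fun X Y _ _ z hz => ?_⟩
    refine coneSpan_eq k (f := coneD k X Y ∘ₗ h'.app X Y + h'.app X Y ∘ₗ coneD k X Y)
      (g := LinearMap.id) (fun p q σ τ hp => ?_) (fun m ρ hm => ?_) hz
    · change coneD k X Y (h'.app X Y _) + h'.app X Y (coneD k X Y _) = _
      rw [agree _ _ _ (coneSpan_mono k (Nat.le_of_lt_succ hp) (coneD_coneInl_mem k σ τ))]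
      obtain hp | hp := (Nat.le_of_lt_succ hp).lt_or_eq
      · rw [agree _ _ _ (coneInl_mem k hp σ τ)]
        exact hh _ _ _ (coneInl_mem k hp σ τ)
      -- In degree n the identity holds on the tautological generator by the choice of v, and
      -- naturality carries it to every generator.
      · have e : coneInl σ τ =
            coneMap k (classify σ) (classify τ) (coneInl (idSimplex p) (idSimplex q)) := by
          rw [coneMap_coneInl]; rfl
        rw [h'.app_coneInl, h'_def, ConeEnd.ofValues_coneInl, e, coneD_coneMap, coneD_coneMap,
          h.naturality, ← map_add, hv p q hp]
        rfl
    · change coneD k X Y (h'.app X Y _) + h'.app X Y (coneD k X Y _) = _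
      rw [agree _ _ _ (coneSpan_mono k (Nat.le_of_lt_succ hm) (coneD_coneInr_mem k ρ))]
      obtain hm | hm := (Nat.le_of_lt_succ hm).lt_or_eq
      · rw [agree _ _ _ (coneInr_mem k hm ρ)]
        exact hh _ _ _ (coneInr_mem k hm ρ)
      · have e : coneInr ρ = coneMap k (classify (simplexMap .fst ρ)) (classify (simplexMap .snd ρ))
            (coneInr (simplexPair (idSimplex m) (idSimplex m))) := by
          rw [coneMap_coneInr]; rfl
        rw [h'.app_coneInr, h'_def, ConeEnd.ofValues_coneInr, e, coneD_coneMap, coneD_coneMap,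
          h.naturality, ← map_add, hr m hm]
        rfl

variable (X Y) in
/-- The cone of the cross product is exact. -/
theorem exists_coneD (z : CrossCone k X Y) (hz : coneD k X Y z = 0) :
    ∃ t, coneD k X Y t = z := by
  -- A single element lies in a finite stage of the filtration, so a contraction valid up to that
  -- stage is enough and no limit of contractions is needed.
  obtain ⟨n, hn⟩ := exists_mem_coneSpan k z
  obtain ⟨h, hh⟩ := exists_coneEnd.{u} k n
  refine ⟨h.app X Y z, ?_⟩
  have := hh X Y z hn
  rwa [hz, map_zero, add_zero] at this

/-! ### The Künneth isomorphism -/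

variable (X Y) in
/-- The Künneth theorem, for spaces `X` with torsion free homology. -/
theorem kunneth_bijective (hX : Module.IsTorsionFree k (TotalHomology k X)) :
    Function.Bijective (kunneth k X Y) := by
  have := (isHomology_total k X).flat_coker
  constructor
  · rw [injective_iff_map_eq_zero]
    intro α hα
    obtain ⟨z, rfl⟩ := TensorProduct.map_surjective (isHomology_total k X).surjective
      (isHomology_total k Y).surjective α
    obtain ⟨m, hm⟩ := (IsClass.cross_map z).eq_zero_iff.1 hα
    -- The cross product of the tensor cycle is the boundary of m, so the pair with -m is a cycle of
    -- the cone. The first component of a preimage shows that the tensor cycle is itself a boundary.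
    obtain ⟨⟨t, t'⟩, ht⟩ := exists_coneD k X Y
      (TensorProduct.map (cyclesι k X) (cyclesι k Y) z, -m) (by
        rw [coneD_apply, map_neg, hm, add_neg_cancel, Prod.mk_eq_zero, neg_eq_zero]
        exact ⟨tensorD_map_ι (isHomology_total k X) (isHomology_total k Y) z, rfl⟩)
    refine (isHomology_total k X).map_eq_zero (s := totalSign k X) (isHomology_total k Y) z (-t) ?_
    rw [map_neg]
    exact congr($ht.1).symm
  · intro α
    obtain ⟨c, hc⟩ := exists_isClass α
    -- A preimage of (0, c) is a cycle t of the tensor product whose cross product is homologous to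
    -- c. The algebraic Künneth theorem then replaces t by products of cycles.
    obtain ⟨⟨t, t'⟩, ht⟩ := exists_coneD k X Y (0, c) (by
      rw [coneD_apply, hc.d_eq_zero]; simp)
    rw [coneD_apply, Prod.mk.injEq, neg_eq_zero] at ht
    obtain ⟨ht, rfl⟩ := ht
    obtain ⟨y, m, rfl⟩ := (isHomology_total k X).exists_map_add (isHomology_total k Y)
      (totalSign_totalSign k) (totalSign_totalD k) t ht
    refine ⟨TensorProduct.map (totalClass k X) (totalClass k Y) y, ?_⟩
    refine IsClass.unique (c := _) ?_ hc
    have := (IsClass.cross_map y).add (isClass_d (totalCross k X Y m + t'))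
    rw [add_zero] at this
    convert this using 1
    rw [map_add, totalCross_tensorD, map_add, add_assoc]

end EilenbergZilber

open PairChain

/-! ### Graded commutativity and associativity of shuffles -/

section
open scoped Simplicial

/-- Exchange the coordinates. -/
def PairChain.swap {n p q : ℕ} : PairChain n p q →+ PairChain n q p :=
  Finsupp.mapDomain.addMonoidHom Prod.swap

@[simp] lemma swap_single {n p q : ℕ} (x) (c : ℤ) :
    PairChain.swap (n := n) (p := p) (q := q) (Finsupp.single x c) = Finsupp.single x.swap c := by
  simp [PairChain.swap, Finsupp.mapDomain.addMonoidHom]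

lemma swap_cone {n p q : ℕ} (z : PairChain n p q) : (cone z).swap = cone z.swap := by
  induction z using Finsupp.induction_linear with
  | zero => simp
  | add x y hx hy => simp only [map_add, hx, hy]
  | single x c => simp

lemma swap_lastLeft {n p q : ℕ} (z : PairChain n p q) : (lastLeft z).swap = lastRight z.swap := by
  induction z using Finsupp.induction_linear with
  | zero => simp
  | add x y hx hy => simp only [map_add, hx, hy]
  | single x c => simp [lastLeft, lastRight]

lemma swap_lastRight {n p q : ℕ} (z : PairChain n p q) : (lastRight z).swap = lastLeft z.swap := by
  induction z using Finsupp.induction_linear with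
  | zero => simp
  | add x y hx hy => simp only [map_add, hx, hy]
  | single x c => simp [lastLeft, lastRight]

/-- Formal integral combinations of triples of monotone maps `[n] → [p]`, `[n] → [q]`,
`[n] → [r]`. -/
abbrev TripleChain (n p q r : ℕ) : Type := ((⦋n⦌ ⟶ ⦋p⦌) × (⦋n⦌ ⟶ ⦋q⦌) × (⦋n⦌ ⟶ ⦋r⦌)) →₀ ℤ

namespace TripleChain
variable {n p q r : ℕ}

def push {p' q' r' : ℕ} (a : ⦋p⦌ ⟶ ⦋p'⦌) (b : ⦋q⦌ ⟶ ⦋q'⦌) (c : ⦋r⦌ ⟶ ⦋r'⦌) :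
    TripleChain n p q r →+ TripleChain n p' q' r' :=
  Finsupp.mapDomain.addMonoidHom fun f => (f.1 ≫ a, f.2.1 ≫ b, f.2.2 ≫ c)

/-- Append the vertex `(p, q, r)` to every chain. -/
def cone : TripleChain n p q r →+ TripleChain (n + 1) p q r :=
  Finsupp.mapDomain.addMonoidHom fun f => (addLast f.1, addLast f.2.1, addLast f.2.2)

@[simp] lemma push_single {p' q' r' : ℕ} (a : ⦋p⦌ ⟶ ⦋p'⦌) (b : ⦋q⦌ ⟶ ⦋q'⦌) (c : ⦋r⦌ ⟶ ⦋r'⦌)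
    (x) (i : ℤ) : push (n := n) a b c (Finsupp.single x i) =
      Finsupp.single (x.1 ≫ a, x.2.1 ≫ b, x.2.2 ≫ c) i := by
  simp [push, Finsupp.mapDomain.addMonoidHom]

@[simp] lemma cone_single (x) (i : ℤ) :
    cone (n := n) (p := p) (q := q) (r := r) (Finsupp.single x i) =
      Finsupp.single (addLast x.1, addLast x.2.1, addLast x.2.2) i := by
  simp [cone, Finsupp.mapDomain.addMonoidHom]

end TripleChain

variable {m n p q r : ℕ}

/-- Subdivide the first factor of `[m] × [r]` by chains of `[p] × [q]`. -/
def compLeft : PairChain m p q →+ PairChain n m r →+ TripleChain n p q r :=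
  Finsupp.liftAddHom fun f => zmultiplesHom _ <|
    Finsupp.mapDomain.addMonoidHom fun g => (g.1 ≫ f.1, g.1 ≫ f.2, g.2)

/-- Subdivide the second factor of `[p] × [m]` by chains of `[q] × [r]`. -/
def compRight : PairChain m q r →+ PairChain n p m →+ TripleChain n p q r :=
  Finsupp.liftAddHom fun f => zmultiplesHom _ <|
    Finsupp.mapDomain.addMonoidHom fun g => (g.1, g.2 ≫ f.1, g.2 ≫ f.2)

lemma compLeft_single (f) (g) (i j : ℤ) :
    compLeft (m := m) (n := n) (p := p) (q := q) (r := r) (Finsupp.single f i)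
      (Finsupp.single g j) = Finsupp.single (g.1 ≫ f.1, g.1 ≫ f.2, g.2) (i * j) := by
  simp [compLeft, Finsupp.mapDomain.addMonoidHom]

lemma compRight_single (f) (g) (i j : ℤ) :
    compRight (m := m) (n := n) (p := p) (q := q) (r := r) (Finsupp.single f i)
      (Finsupp.single g j) = Finsupp.single (g.1, g.2 ≫ f.1, g.2 ≫ f.2) (i * j) := by
  simp [compRight, Finsupp.mapDomain.addMonoidHom]

lemma addLast_comp (f : ⦋n⦌ ⟶ ⦋m⦌) (g : ⦋m⦌ ⟶ ⦋p⦌) (hg : g.toOrderHom (Fin.last m) = Fin.last p) :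
    addLast f ≫ g = addLast (f ≫ g) := by
  ext j : 3
  change g.toOrderHom ((addLast f).toOrderHom j) = _
  induction j using Fin.lastCases with
  | last => erw [addLast_last, addLast_last, hg]
  | cast j => erw [addLast_castSucc, addLast_castSucc]; rfl

lemma pairChain_ext₂ {n' p' q' : ℕ} {A : Type*} [AddCommGroup A]
    (F G : PairChain n p q →+ PairChain n' p' q' →+ A)
    (h : ∀ f g i j, F (Finsupp.single f i) (Finsupp.single g j) =
      G (Finsupp.single f i) (Finsupp.single g j)) (z w) : F z w = G z w := by
  have : F = G := Finsupp.addHom_ext fun f i => Finsupp.addHom_ext fun g j => h f g i j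
  rw [this]

/-- The outer chain ends at (m + 1, r) and the inner one sends m + 1 to (p, q), so the composite
ends at (p, q, r). -/
lemma compLeft_cone_cone (z : PairChain m p q) (w : PairChain n (m + 1) r) :
    compLeft (cone z) (cone w) = TripleChain.cone (compLeft (cone z) w) :=
  pairChain_ext₂ ((compLeft.comp cone).compl₂ cone) ((compLeft.comp cone).compr₂ TripleChain.cone)
    (fun f g i j => by
      simp [-Finsupp.single_mul, compLeft_single, addLast_comp _ _ (addLast_last f.1),
        addLast_comp _ _ (addLast_last f.2)]) z w

lemma compRight_cone_cone (z : PairChain m q r) (w : PairChain n p (m + 1)) :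
    compRight (cone z) (cone w) = TripleChain.cone (compRight (cone z) w) :=
  pairChain_ext₂ ((compRight.comp cone).compl₂ cone) ((compRight.comp cone).compr₂ TripleChain.cone)
    (fun f g i j => by
      simp [-Finsupp.single_mul, compRight_single, addLast_comp _ _ (addLast_last f.1),
        addLast_comp _ _ (addLast_last f.2)]) z w

lemma compLeft_shuffles_cone (w : PairChain n m r) :
    compLeft (shuffles m p q) (cone w) = TripleChain.cone (compLeft (shuffles m p q) w) := by
  rcases m with _ | m
  · rcases p with _ | p <;> rcases q with _ | q <;> try (simp [shuffles]; done)
    induction w using Finsupp.induction_linear with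
    | zero => simp
    | add x y hx hy => simp only [map_add, hx, hy]
    | single x c => simp [shuffles, compLeft_single]
  · rw [shuffles_succ, compLeft_cone_cone]

lemma compRight_shuffles_cone (w : PairChain n p m) :
    compRight (shuffles m q r) (cone w) = TripleChain.cone (compRight (shuffles m q r) w) := by
  rcases m with _ | m
  · rcases q with _ | q <;> rcases r with _ | r <;> try (simp [shuffles]; done)
    induction w using Finsupp.induction_linear with
    | zero => simp
    | add x y hx hy => simp only [map_add, hx, hy]
    | single x c => simp [shuffles, compRight_single]
  · rw [shuffles_succ, compRight_cone_cone]

/-- `lastLeft` makes w avoid the vertex m + 1 of the first factor, and the cone restricted to the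
remaining vertices is z. -/
lemma compLeft_cone_lastLeft (z : PairChain m p q) (w : PairChain n m r) :
    compLeft (cone z) (lastLeft w) = compLeft z w :=
  pairChain_ext₂ ((compLeft.comp cone).compl₂ lastLeft) compLeft
    (fun f g i j => by simp [-Finsupp.single_mul, compLeft_single, lastLeft, δ_last_comp_addLast]) z w

lemma compRight_cone_lastRight (z : PairChain m q r) (w : PairChain n p m) :
    compRight (cone z) (lastRight w) = compRight z w :=
  pairChain_ext₂ ((compRight.comp cone).compl₂ lastRight) compRight
    (fun f g i j => by simp [-Finsupp.single_mul, compRight_single, lastRight, δ_last_comp_addLast]) z w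

namespace TripleChain

def last₁ : TripleChain n p q r →+ TripleChain n (p + 1) q r :=
  push (SimplexCategory.δ (Fin.last (p + 1))) (𝟙 _) (𝟙 _)

def last₂ : TripleChain n p q r →+ TripleChain n p (q + 1) r :=
  push (𝟙 _) (SimplexCategory.δ (Fin.last (q + 1))) (𝟙 _)

def last₃ : TripleChain n p q r →+ TripleChain n p q (r + 1) :=
  push (𝟙 _) (𝟙 _) (SimplexCategory.δ (Fin.last (r + 1)))

end TripleChain

open TripleChain (last₁ last₂ last₃)

lemma compLeft_lastLeft (z : PairChain m p q) (w : PairChain n m r) :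
    compLeft (lastLeft z) w = last₁ (compLeft z w) :=
  pairChain_ext₂ (compLeft.comp lastLeft) (compLeft.compr₂ last₁)
    (fun f g i j => by simp [-Finsupp.single_mul, compLeft_single, lastLeft, last₁]) z w

lemma compLeft_lastRight (z : PairChain m p q) (w : PairChain n m r) :
    compLeft (lastRight z) w = last₂ (compLeft z w) :=
  pairChain_ext₂ (compLeft.comp lastRight) (compLeft.compr₂ last₂)
    (fun f g i j => by simp [-Finsupp.single_mul, compLeft_single, lastRight, last₂]) z w

lemma compLeft_apply_lastRight (z : PairChain m p q) (w : PairChain n m r) :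
    compLeft z (lastRight w) = last₃ (compLeft z w) :=
  pairChain_ext₂ (compLeft.compl₂ lastRight) (compLeft.compr₂ last₃)
    (fun f g i j => by simp [-Finsupp.single_mul, compLeft_single, lastRight, last₃]) z w

lemma compRight_lastLeft (z : PairChain m q r) (w : PairChain n p m) :
    compRight (lastLeft z) w = last₂ (compRight z w) :=
  pairChain_ext₂ (compRight.comp lastLeft) (compRight.compr₂ last₂)
    (fun f g i j => by simp [-Finsupp.single_mul, compRight_single, lastLeft, last₂]) z w

lemma compRight_lastRight (z : PairChain m q r) (w : PairChain n p m) :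
    compRight (lastRight z) w = last₃ (compRight z w) :=
  pairChain_ext₂ (compRight.comp lastRight) (compRight.compr₂ last₃)
    (fun f g i j => by simp [-Finsupp.single_mul, compRight_single, lastRight, last₃]) z w

lemma compRight_apply_lastLeft (z : PairChain m q r) (w : PairChain n p m) :
    compRight z (lastLeft w) = last₁ (compRight z w) :=
  pairChain_ext₂ (compRight.compl₂ lastLeft) (compRight.compr₂ last₁)
    (fun f g i j => by simp [-Finsupp.single_mul, compRight_single, lastLeft, last₁]) z w

end

/-- Induction on the last step: the swap turns a horizontal last step into a vertical one and
conversely. The recursive signs (-1)^q and (-1)^p account for the change of the exponent p q. -/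
theorem swap_shuffles (n : ℕ) : ∀ p q : ℕ,
    (shuffles n p q).swap = (-1 : ℤ) ^ (p * q) • shuffles n q p := by
  induction n with
  | zero =>
    intro p q
    rcases p with _ | p <;> rcases q with _ | q <;> simp [shuffles]
  | succ n ih =>
    have h1 : ∀ p q, (stepLeft n (p + 1) q).swap = (-1 : ℤ) ^ (p * q) • stepRight n q (p + 1) := by
      intro p q
      rw [w1_succ, swap_lastLeft, ih, w2_succ, map_zsmul]
    have h2 : ∀ p q, (stepRight n p (q + 1)).swap = (-1 : ℤ) ^ (p * q) • stepLeft n (q + 1) p := by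
      intro p q
      rw [w2_succ, swap_lastRight, ih, w1_succ, map_zsmul]
    intro p q
    rw [shuffles_succ, shuffles_succ, swap_cone, ← map_zsmul]
    congr 1
    rcases p with _ | p <;> rcases q with _ | q <;>
      simp only [map_add, map_zsmul, h1, h2, w1_zero, w2_zero, smul_zero, map_zero, smul_add,
        smul_smul, add_zero, zero_add, ← pow_add]
    · simp
    · simp
    · refine (add_comm _ _).trans (congrArg₂ (· + ·) ?_ ?_)
      · rw [show (p + 1) * (q + 1) + (p + 1) = (p + 1) * q + 2 * (p + 1) by ring, pow_add, pow_mul _ 2,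
          neg_one_sq, one_pow, mul_one]
      · rw [show q + 1 + p * (q + 1) = (p + 1) * (q + 1) by ring]

/-- A last step in the direction of [m + 1] is refined by the last step of the inner shuffle, which
goes either in the direction of [p] or in that of [q]. -/
lemma compLeft_stepLeft (n m p q r : ℕ) :
    compLeft (shuffles (m + 1) p q) (lastLeft (shuffles n m r)) =
      (-1 : ℤ) ^ q • compLeft (stepLeft m p q) (shuffles n m r) +
        compLeft (stepRight m p q) (shuffles n m r) := by
  rw [shuffles_succ, compLeft_cone_lastLeft, map_add, map_zsmul, AddMonoidHom.add_apply,
    AddMonoidHom.smul_apply]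

lemma compRight_stepRight (n m p q r : ℕ) :
    compRight (shuffles (m + 1) q r) (lastRight (shuffles n p m)) =
      (-1 : ℤ) ^ r • compRight (stepLeft m q r) (shuffles n p m) +
        compRight (stepRight m q r) (shuffles n p m) := by
  rw [shuffles_succ, compRight_cone_lastRight, map_add, map_zsmul, AddMonoidHom.add_apply,
    AddMonoidHom.smul_apply]

/-- Both sides are the signed sum of the maximal chains of [p] × [q] × [r]. They obey the same
recursion on the last step, with sign (-1)^(q + r), (-1)^r or 1 for a step in the first, second or
third direction. -/
theorem compLeft_shuffles (n : ℕ) : ∀ p q r m m' : ℕ, m = p + q → m' = q + r →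
    compLeft (shuffles m p q) (shuffles n m r) =
      compRight (shuffles m' q r) (shuffles n p m') := by
  induction n with
  | zero =>
    intro p q r m m' hm hm'
    by_cases h : m = 0 ∧ r = 0
    · obtain ⟨rfl, rfl⟩ : p = 0 ∧ q = 0 := by omega
      obtain ⟨rfl, rfl⟩ := h
      subst hm'
      simp [-Finsupp.single_mul, shuffles, compLeft_single, compRight_single]
    · rw [shuffles_eq_zero 0 m r (by omega), shuffles_eq_zero 0 p m' (by omega), map_zero, map_zero]
  | succ n ih =>
    intro p q r m m' hm hm'
    have h : ∀ p q r m, m = p + q → compLeft (shuffles m p q) (shuffles n m r) =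
        compRight (shuffles (q + r) q r) (shuffles n p (q + r)) :=
      fun p q r m hm => ih p q r m _ hm rfl
    have h' : ∀ p q r m', m' = q + r → compRight (shuffles m' q r) (shuffles n p m') =
        compRight (shuffles (q + r) q r) (shuffles n p (q + r)) :=
      fun p q r m' hm' => by rw [hm']
    have e : (-1 : ℤ) ^ m' = (-1) ^ r * (-1) ^ q := by rw [hm', add_comm, pow_add]
    rw [shuffles_succ, shuffles_succ, compLeft_shuffles_cone, compRight_shuffles_cone, map_add,
      map_add, map_zsmul, map_zsmul, e]
    -- The recursion has a term only for the directions of positive length. Cases contradicting m =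
    -- p + q, m' = q + r are discarded.
    rcases m with _ | m <;> rcases m' with _ | m' <;> rcases p with _ | p <;>
      rcases q with _ | q <;> rcases r with _ | r <;> first | omega | skip
    all_goals
      simp (disch := omega) only [compLeft_stepLeft, compRight_stepRight, w1_zero, w2_zero, w1_succ,
        w2_succ, compLeft_lastLeft, compLeft_lastRight, compRight_lastLeft, compRight_lastRight,
        compLeft_apply_lastRight, compRight_apply_lastLeft, h, h', map_zero, smul_zero, zero_add,
        add_zero, smul_add, smul_smul, AddMonoidHom.zero_apply, pow_zero, one_smul, mul_one, one_mul,
        add_assoc, map_add, map_zsmul]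

/-! ### Commutativity and associativity of the cross product -/

section
open scoped TensorProduct Simplicial
variable (k : Type w) [CommRing k] {X Y Z : Type u} [TopologicalSpace X] [TopologicalSpace Y]
  [TopologicalSpace Z]

lemma chainMap_swap_evalPair {n p q : ℕ} (σ : SingularSimplex X p) (τ : SingularSimplex Y q)
    (z : PairChain n p q) : (chainMap k ContinuousMap.prodSwap).f n (evalPair k σ τ z) =
      evalPair k τ σ z.swap := by
  induction z using Finsupp.induction_linear with
  | zero => simp
  | add x y hx hy => simp only [map_add, hx, hy]
  | single x c =>
    rw [swap_single, evalPair_single, evalPair_single, map_zsmul, chainMap_simplexChain]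
    rfl

variable (X Y Z) in
/-- The associativity homeomorphism. -/
def prodAssocMap : C((X × Y) × Z, X × Y × Z) := ⟨fun p => (p.1.1, p.1.2, p.2), by fun_prop⟩

/-- The linear extension of `(f, g, h) ↦ (ρ ∘ f, σ ∘ g, τ ∘ h)`. -/
def evalTriple {n p q r : ℕ} (ρ : SingularSimplex X p) (σ : SingularSimplex Y q)
    (τ : SingularSimplex Z r) : TripleChain n p q r →+ (SingularChains k (X × Y × Z)).X n :=
  Finsupp.liftAddHom fun f => (zmultiplesHom _) (simplexChain k
    (simplexPair (simplexPull f.1 ρ) (simplexPair (simplexPull f.2.1 σ) (simplexPull f.2.2 τ))))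

lemma evalTriple_single {n p q r : ℕ} (ρ : SingularSimplex X p) (σ : SingularSimplex Y q)
    (τ : SingularSimplex Z r) (f) (c : ℤ) :
    evalTriple (n := n) k ρ σ τ (Finsupp.single f c) = c • simplexChain k (simplexPair
      (simplexPull f.1 ρ) (simplexPair (simplexPull f.2.1 σ) (simplexPull f.2.2 τ))) := by
  simp [evalTriple]

lemma chainMap_assoc_chainCross {n m p q r : ℕ} (ρ : SingularSimplex X p) (σ : SingularSimplex Y q)
    (τ : SingularSimplex Z r) (z : PairChain m p q) :
    (chainMap k (prodAssocMap X Y Z)).f n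
        (chainCross k n m r (evalPair k ρ σ z) (simplexChain k τ)) =
      evalTriple k ρ σ τ (compLeft z (shuffles n m r)) := by
  induction z using Finsupp.induction_linear with
  | zero => simp
  | add x y hx hy => simp only [map_add, LinearMap.add_apply, AddMonoidHom.add_apply, hx, hy]
  | single x c =>
    rw [evalPair_single, map_zsmul, LinearMap.smul_apply, chainCross_simplex]
    induction shuffles n m r using Finsupp.induction_linear with
    | zero => simp
    | add v w hv hw => simp only [map_add, smul_add, hv, hw]
    | single y d =>
      rw [evalPair_single, compLeft_single, evalTriple_single, map_zsmul, map_zsmul,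
        chainMap_simplexChain, smul_smul, simplexPull_comp, simplexPull_comp]
      rfl

lemma chainCross_evalPair {n m p q r : ℕ} (ρ : SingularSimplex X p) (σ : SingularSimplex Y q)
    (τ : SingularSimplex Z r) (z : PairChain m q r) :
    chainCross k n p m (simplexChain k ρ) (evalPair k σ τ z) =
      evalTriple k ρ σ τ (compRight z (shuffles n p m)) := by
  induction z using Finsupp.induction_linear with
  | zero => simp
  | add x y hx hy => simp only [map_add, AddMonoidHom.add_apply, hx, hy]
  | single x c =>
    rw [evalPair_single, map_zsmul, chainCross_simplex]
    induction shuffles n p m using Finsupp.induction_linear with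
    | zero => simp
    | add v w hv hw => simp only [map_add, smul_add, hv, hw]
    | single y d =>
      rw [evalPair_single, compRight_single, evalTriple_single, smul_smul, simplexPull_comp,
        simplexPull_comp]
      rfl

/-- Degrees such as p + q and q + p agree only propositionally. Keeping the target degree of
`chainCross` as a free index allows a change of degree without transport. -/
lemma ofDegree_chainCross {n m p q : ℕ} (h : n = m) (a : (SingularChains k X).X p)
    (b : (SingularChains k Y).X q) :
    ofDegree n (chainCross k n p q a b) = ofDegree m (chainCross k m p q a b) := by
  subst h; rfl

/-- Writing the sign (-1)^(p q) as the p-th power of the sign operator leaves b free to be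
inhomogeneous. -/
lemma totalCross_swap {p : ℕ} (a : (SingularChains k X).X p) (b : TotalChains k Y) :
    totalMap k ContinuousMap.prodSwap (totalCross k X Y (ofDegree p a ⊗ₜ b)) =
      totalCross k Y X (((totalSign k Y) ^ p) b ⊗ₜ ofDegree p a) := by
  suffices ∀ σ : SingularSimplex X p, totalMap k ContinuousMap.prodSwap ∘ₗ totalCross k X Y ∘ₗ
      TensorProduct.mk k _ _ (ofDegree p (simplexChain k σ)) =
      totalCross k Y X ∘ₗ (TensorProduct.mk k _ _).flip (ofDegree p (simplexChain k σ)) ∘ₗ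
        (totalSign k Y) ^ p by
    let F : (SingularChains k X).X p →ₗ[k] TotalChains k Y →ₗ[k] TotalChains k (Y × X) :=
      ((TensorProduct.mk k _ _).compr₂ (totalMap k ContinuousMap.prodSwap ∘ₗ totalCross k X Y)) ∘ₗ
        ofDegree p
    let G : (SingularChains k X).X p →ₗ[k] TotalChains k Y →ₗ[k] TotalChains k (Y × X) :=
      (((TensorProduct.mk k _ _).flip.compr₂ (totalCross k Y X)).compl₂ ((totalSign k Y) ^ p)) ∘ₗ
        ofDegree p
    have : F = G := chain_ext this
    exact congr($this a b)
  intro σ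
  refine totalChains_ext fun q τ => ?_
  have hs : ((totalSign k Y) ^ p) (ofDegree q (simplexChain k τ)) =
      ((-1 : k) ^ (p * q)) • ofDegree q (simplexChain k τ) := by
    clear σ a
    induction p with
    | zero => simp
    | succ p ih =>
      rw [pow_succ', Module.End.mul_apply, ih, map_smul, totalSign_ofDegree, smul_smul, ← pow_add]
      congr 2
      ring
  simp only [LinearMap.comp_apply, TensorProduct.mk_apply, LinearMap.flip_apply, hs,
    totalCross_ofDegree, totalMap_ofDegree, map_smul]
  rw [ofDegree_chainCross k (add_comm q p), chainCross_simplex, chainCross_simplex,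
    chainMap_swap_evalPair, swap_shuffles, map_zsmul, ← Int.cast_smul_eq_zsmul k, map_smul]
  simp

lemma totalCross_assoc (a : TotalChains k X) (b : TotalChains k Y) (c : TotalChains k Z) :
    totalMap k (prodAssocMap X Y Z) (totalCross k (X × Y) Z (totalCross k X Y (a ⊗ₜ b) ⊗ₜ c)) =
      totalCross k X (Y × Z) (a ⊗ₜ totalCross k Y Z (b ⊗ₜ c)) := by
  -- Both sides are packaged as trilinear maps, so that it suffices to compare them on simplices,
  -- where the identity is `compLeft_shuffles`.
  let F : TotalChains k X →ₗ[k] TotalChains k Y →ₗ[k] TotalChains k Z →ₗ[k]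
      TotalChains k (X × Y × Z) :=
    (TensorProduct.mk k _ _).compr₂ <| ((TensorProduct.mk k _ _).compr₂
      (totalMap k (prodAssocMap X Y Z) ∘ₗ totalCross k (X × Y) Z)) ∘ₗ totalCross k X Y
  let G : TotalChains k X →ₗ[k] TotalChains k Y →ₗ[k] TotalChains k Z →ₗ[k]
      TotalChains k (X × Y × Z) :=
    LinearMap.lcomp k _ ((TensorProduct.mk k _ _).compr₂ (totalCross k Y Z)) ∘ₗ
      LinearMap.llcomp k (TotalChains k Z) _ _ ∘ₗ
      (TensorProduct.mk k _ _).compr₂ (totalCross k X (Y × Z))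
  suffices F = G from congr($this a b c)
  refine totalChains_ext fun p ρ => totalChains_ext fun q σ => totalChains_ext fun r τ => ?_
  suffices totalMap k (prodAssocMap X Y Z) (totalCross k (X × Y) Z (totalCross k X Y
      (ofDegree p (simplexChain k ρ) ⊗ₜ ofDegree q (simplexChain k σ)) ⊗ₜ
        ofDegree r (simplexChain k τ))) =
      totalCross k X (Y × Z) (ofDegree p (simplexChain k ρ) ⊗ₜ totalCross k Y Z
        (ofDegree q (simplexChain k σ) ⊗ₜ ofDegree r (simplexChain k τ))) from this
  rw [totalCross_ofDegree, totalCross_ofDegree, totalCross_ofDegree, totalCross_ofDegree,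
    totalMap_ofDegree, ofDegree_chainCross k (add_assoc p q r).symm, chainCross_simplex,
    chainCross_simplex, chainMap_assoc_chainCross, chainCross_evalPair,
    compLeft_shuffles _ p q r _ _ rfl rfl]

/-- The cross product in homology is associative. -/
theorem kunneth_assoc (α : TotalHomology k X) (β : TotalHomology k Y) (γ : TotalHomology k Z) :
    homologyMap k (prodAssocMap X Y Z) (kunneth k (X × Y) Z (kunneth k X Y (α ⊗ₜ β) ⊗ₜ γ)) =
      kunneth k X (Y × Z) (α ⊗ₜ kunneth k Y Z (β ⊗ₜ γ)) := by
  obtain ⟨a, ha⟩ := exists_isClass α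
  obtain ⟨b, hb⟩ := exists_isClass β
  obtain ⟨c, hc⟩ := exists_isClass γ
  refine (((ha.cross hb).cross hc).map (prodAssocMap X Y Z)).unique ?_
  rw [totalCross_assoc]
  exact ha.cross (hb.cross hc)

lemma isClass_lof {n : ℕ} (z : Cycles (SingularChains k X) n) :
    IsClass (ofDegree n z.1)
      (DirectSum.lof k ℕ (fun n => SingularHomology k X n) n (homologyClass _ n z)) :=
  ⟨_, cyclesι_lof n z, totalClass_lof n z⟩

/-- The cross product with the fundamental class of the circle is graded commutative. -/
theorem kunneth_circleClass_swap (β : TotalHomology k Y) :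
    homologyMap k ContinuousMap.prodSwap (kunneth k Circle1.{u} Y (circleClass k ⊗ₜ β)) =
      kunneth k Y Circle1.{u} (degreeSign k Y β ⊗ₜ circleClass k) := by
  obtain ⟨b, hb⟩ := exists_isClass β
  have h := isClass_lof k ⟨simplexChain k circleSimplex.{u}, circleSimplex_mem k⟩
  refine ((h.cross hb).map ContinuousMap.prodSwap).unique ?_
  rw [totalCross_swap, pow_one]
  exact hb.sign.cross h

end

/-! ### Loops of an `H`-group -/

section
open scoped unitInterval

variable {G : Type u} [TopologicalSpace G] [HGroup G]

variable (G) in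
/-- The inclusion `j : ΩG → LG`. -/
abbrev loopIncl : C(Loops G, FreeLoops G) := ⟨Subtype.val, continuous_subtype_val⟩

/-- The reparametrization fixes the base point at every stage, so it deforms based loops through
based loops. -/
lemma collapse_base (s : ℝ) : collapse s 0 = 0 := by
  have : ‖(0 : UnitAddCircle) - ((1 / 4 : ℝ) : UnitAddCircle)‖ = 1 / 4 := by
    rw [zero_sub, norm_neg, (AddCircle.norm_coe_eq_abs_iff (1 : ℝ) one_ne_zero).2] <;> norm_num
  rw [collapse, this]
  simp

/-- A homotopy of self maps of `ΩG`, from a homotopy of maps `LG → LG` which preserves based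
loops. -/
lemma homotopic_of_curry {f g : C(Loops G, Loops G)} (H : C((I × Loops G) × UnitAddCircle, G))
    (hb : ∀ p, H (p, 0) = HSpace.e) (h0 : ∀ w θ, H ((0, w), θ) = (f w).1 θ)
    (h1 : ∀ w θ, H ((1, w), θ) = (g w).1 θ) : f.Homotopic g :=
  ⟨⟨⟨fun p => ⟨H.curry p, hb p⟩, Continuous.subtype_mk (by fun_prop) _⟩,
    fun w => Subtype.ext (ContinuousMap.ext (h0 w)),
    fun w => Subtype.ext (ContinuousMap.ext (h1 w))⟩⟩

lemma continuous_collapse_loop :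
    Continuous fun p : (I × Loops G) × UnitAddCircle => collapse p.1.1 p.2 :=
  continuous_collapse.comp (f := fun p : (I × Loops G) × UnitAddCircle =>
    ((p.1.1 : ℝ), p.2)) (by fun_prop)

/-- Multiplication by the base point of `G` on `ΩG` is homotopic to the identity, also after
reparametrization. -/
lemma homotopic_id_of_eq {f : C(Loops G, Loops G)}
    (hf : ∀ w θ, (f w).1 θ = HSpace.hmul (w.1 (collapse 1 θ), HSpace.e)) :
    f.Homotopic (.id _) := by
  have := continuous_collapse_loop (G := G)
  let g : C(Loops G, Loops G) :=
    ⟨fun w => ⟨⟨fun θ => HSpace.hmul (w.1 θ, HSpace.e), by fun_prop⟩, by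
      change HSpace.hmul (w.1 0, HSpace.e) = _
      rw [w.2, HSpace.hmul_e_e]⟩, by
      refine Continuous.subtype_mk ?_ _
      exact (ContinuousMap.curry ⟨fun p : Loops G × UnitAddCircle =>
        HSpace.hmul (p.1.1 p.2, HSpace.e), by fun_prop⟩).continuous⟩
  refine ContinuousMap.Homotopic.trans (g := g) (.symm ?_) ?_
  -- The first homotopy undoes the collapse. The second one is the unit homotopy of G, which is
  -- relative to e and hence keeps loops based.
  · refine homotopic_of_curry ⟨fun p => HSpace.hmul (p.1.2.1 (collapse p.1.1 p.2), HSpace.e),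
      by fun_prop⟩ ?_ ?_ ?_
    · intro p
      simp [collapse_base, p.2.2, HSpace.hmul_e_e]
    · intro w θ
      simp [collapse_zero, g]
    · intro w θ
      simp [hf]
  · refine homotopic_of_curry ⟨fun p => HSpace.hmulE (p.1.1, p.1.2.1 p.2), by fun_prop⟩ ?_ ?_ ?_
    · intro p
      change HSpace.hmulE (p.1, p.2.1 0) = _
      rw [p.2.2]
      exact HSpace.hmulE.eq_snd p.1 rfl
    · intro w θ
      exact HSpace.hmulE.map_zero_left _
    · intro w θ
      exact HSpace.hmulE.map_one_left _

/-- The inclusion of the based loops has a homotopy retraction. -/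
lemma exists_homotopy_retraction :
    ∃ r : C(FreeLoops G, Loops G), (r.comp (loopIncl G)).Homotopic (.id _) := by
  obtain ⟨h⟩ := HGroup.hmul_hinv (G := G)
  have h0 : ∀ g, h (0, g) = HSpace.hmul (g, HGroup.hinv g) := h.map_zero_left
  have h1 : ∀ g, h (1, g) = HSpace.e := h.map_one_left
  -- The homotopy from g g⁻¹ to e is relative to e, so the path inserted near the base point in `K`
  -- is constant for based loops.
  have he : ∀ t, h (t, HSpace.e) = HSpace.e := fun t => h.eq_snd t rfl
  let v : UnitAddCircle → I := fun θ => Set.projIcc 0 1 zero_le_one (1 - 4 * ‖θ‖)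
  have hv : Continuous v := continuous_projIcc.comp (by fun_prop)
  have hv0 : v 0 = 1 := by simp [v]
  have hv1 : ∀ θ, ‖θ‖ = 1 / 4 → v θ = 0 := fun θ h => by simp [v, h]
  let K : C(FreeLoops G × UnitAddCircle, G) :=
    ⟨fun p => if ‖p.2‖ ≤ 1 / 4 then h (v p.2, p.1 0)
      else HSpace.hmul (p.1 (collapse 1 p.2), HGroup.hinv (p.1 0)), by
      refine Continuous.if_le (by fun_prop) ?_ (by fun_prop) (by fun_prop) ?_
      · have : Continuous fun p : FreeLoops G × UnitAddCircle => collapse 1 p.2 :=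
          continuous_collapse.comp (continuous_const.prodMk continuous_snd)
        fun_prop
      · intro p hp
        rw [hv1 _ hp, h0, collapse_one hp.le]⟩
  have hK : ∀ l, K.curry l 0 = HSpace.e := fun l => by simp [K, hv0, h1]
  let r : C(FreeLoops G, Loops G) :=
    ⟨fun l => ⟨K.curry l, hK l⟩, Continuous.subtype_mk K.curry.continuous _⟩
  refine ⟨r, homotopic_id_of_eq fun w θ => ?_⟩
  · change (if ‖θ‖ ≤ 1 / 4 then h (v θ, w.1 0)
      else HSpace.hmul (w.1 (collapse 1 θ), HGroup.hinv (w.1 0))) = _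
    rw [w.2, he, HGroup.hinv_e]
    split_ifs with hθ
    · rw [collapse_one hθ, w.2, HSpace.hmul_e_e]
    · rfl

/-- For a based loop l(0)⁻¹ = e, so the translation is multiplication by e on the right, and the
unit homotopy applies. -/
lemma translateLoop_comp_loopIncl :
    ((translateLoop G).comp (loopIncl G)).Homotopic (loopIncl G) := by
  refine ⟨⟨ContinuousMap.curry ⟨fun p : (I × Loops G) × UnitAddCircle =>
    HSpace.hmulE (p.1.1, p.1.2.1 p.2), by fun_prop⟩, ?_, ?_⟩⟩
  · intro w
    refine ContinuousMap.ext fun θ => (HSpace.hmulE.map_zero_left _).trans ?_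
    change HSpace.hmul (w.1 θ, HSpace.e) = HSpace.hmul (w.1 θ, HGroup.hinv (w.1 0))
    rw [w.2, HGroup.hinv_e]
  · intro w
    exact ContinuousMap.ext fun θ => HSpace.hmulE.map_one_left _

/-- A loop retraction is a homotopy retraction. -/
theorem IsLoopRetraction.comp_loopIncl {r : C(FreeLoops G, Loops G)} (hr : IsLoopRetraction r) :
    (r.comp (loopIncl G)).Homotopic (.id _) := by
  obtain ⟨r', hr'⟩ := exists_homotopy_retraction (G := G)
  have h1 : ((loopIncl G).comp (r.comp (loopIncl G))).Homotopic (loopIncl G) :=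
    (ContinuousMap.Homotopic.comp hr (.refl (loopIncl G))).trans translateLoop_comp_loopIncl
  have h2 := (ContinuousMap.Homotopic.comp (.refl r') h1).trans hr'
  -- Since j r j ≃ j, any left homotopy inverse r' of j gives r j ≃ r' j r j ≃ r' j ≃ id.
  exact (ContinuousMap.Homotopic.comp hr' (.refl (r.comp (loopIncl G)))).symm.trans h2

end

/-! ### The diagonal of the fundamental class of the circle -/

section
variable (k : Type w) [CommRing k]

/-- The inclusion of the first factor of the torus. -/
abbrev torusLeft : C(Circle1.{u}, Circle1.{u} × Circle1.{u}) := .prodMk (.id _) (.const _ 0)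

/-- The inclusion of the second factor of the torus. -/
abbrev torusRight : C(Circle1.{u}, Circle1.{u} × Circle1.{u}) := .prodMk (.const _ 0) (.id _)

/-- The two ends 0 and 1 of the interval both represent the base point of ℝ / ℤ. -/
lemma simplexPull_δ_circleSimplex (i : Fin 2) :
    simplexPull (SimplexCategory.δ (n := 0) i) circleSimplex.{u} =
      simplexPull (SimplexCategory.δ (n := 0) i)
        (simplexMap (.const _ (0 : Circle1.{u})) circleSimplex.{u}) := by
  apply ((TopCat.of Circle1.{u}).toSSetObjEquiv _).injective
  refine ContinuousMap.ext fun v => ?_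
  obtain rfl : v = stdSimplex.vertex (S := ℝ) (0 : Fin 1) :=
    Subsingleton.elim (α := stdSimplex ℝ (Fin 1)) _ _
  change ULift.up (((stdSimplex.map (SimplexCategory.δ (n := 0) i).toOrderHom
      (stdSimplex.vertex (S := ℝ) (0 : Fin 1))).1 1 : ℝ) : UnitAddCircle) = 0
  rw [stdSimplex.map_vertex]
  generalize (SimplexCategory.δ (n := 0) i).toOrderHom (0 : Fin 1) = j
  fin_cases j
  · simp
    rfl
  · simp only [Fin.mk_one, Pi.single_eq_same]
    exact congrArg ULift.up (AddCircle.coe_period (1 : ℝ))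

/-- The fundamental class of the circle is primitive. -/
theorem homologyMap_diag_circleClass :
    homologyMap k (.prodMk (.id Circle1.{u}) (.id Circle1.{u})) (circleClass k) =
      homologyMap k torusLeft (circleClass k) + homologyMap k torusRight (circleClass k) := by
  have h := isClass_lof k ⟨simplexChain k circleSimplex.{u}, circleSimplex_mem k⟩
  set c := circleSimplex.{u}
  -- The triangle with vertices (0, 0), (0, 1), (1, 1) of the unit square, mapped to the torus. Its
  -- faces, in order, are a copy of the first circle, the diagonal and the second circle.
  let ρ : SingularSimplex (Circle1.{u} × Circle1.{u}) 2 :=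
    simplexPair (simplexPull (SimplexCategory.σ 0) c) (simplexPull (SimplexCategory.σ 1) c)
  have key : totalD k _ (ofDegree 2 (simplexChain k ρ)) =
      totalMap k torusLeft (ofDegree 1 (simplexChain k c)) +
      totalMap k torusRight (ofDegree 1 (simplexChain k c)) -
      totalMap k (.prodMk (.id Circle1.{u}) (.id Circle1.{u})) (ofDegree 1 (simplexChain k c)) := by
    have hδσ : ∀ i : Fin 2, simplexPull (SimplexCategory.σ 0)
        (simplexPull (SimplexCategory.δ (n := 0) i) c) = simplexMap (.const _ 0) c := fun i => by
      rw [simplexPull_δ_circleSimplex]; rfl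
    have e1 : SimplexCategory.δ (n := 1) 2 ≫ SimplexCategory.σ 0 =
        SimplexCategory.σ 0 ≫ SimplexCategory.δ 1 :=
      SimplexCategory.δ_comp_σ_of_gt (n := 0) (i := 1) (j := 0) (by simp)
    have e2 : SimplexCategory.δ (n := 1) 0 ≫ SimplexCategory.σ 1 =
        SimplexCategory.σ 0 ≫ SimplexCategory.δ 0 :=
      SimplexCategory.δ_comp_σ_of_le (n := 0) (i := 0) (j := 0) (by simp)
    have e3 : SimplexCategory.δ (n := 1) 0 ≫ SimplexCategory.σ 0 = 𝟙 _ :=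
      SimplexCategory.δ_comp_σ_self (i := 0)
    have e4 : SimplexCategory.δ (n := 1) 1 ≫ SimplexCategory.σ 0 = 𝟙 _ :=
      SimplexCategory.δ_comp_σ_succ (i := 0)
    have e5 : SimplexCategory.δ (n := 1) 1 ≫ SimplexCategory.σ 1 = 𝟙 _ :=
      SimplexCategory.δ_comp_σ_self (i := 1)
    have e6 : SimplexCategory.δ (n := 1) 2 ≫ SimplexCategory.σ 1 = 𝟙 _ :=
      SimplexCategory.δ_comp_σ_succ (i := 1)
    have f0 : simplexPull (SimplexCategory.δ (n := 1) 0) ρ = simplexMap torusLeft c := by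
      rw [simplexPull_pair, ← simplexPull_comp, ← simplexPull_comp, e3, e2, simplexPull_id,
        simplexPull_comp, hδσ]
      rfl
    have f1 : simplexPull (SimplexCategory.δ (n := 1) 1) ρ =
        simplexMap (.prodMk (.id Circle1.{u}) (.id Circle1.{u})) c := by
      rw [simplexPull_pair, ← simplexPull_comp, ← simplexPull_comp, e4, e5, simplexPull_id]
      rfl
    have f2 : simplexPull (SimplexCategory.δ (n := 1) 2) ρ = simplexMap torusRight c := by
      rw [simplexPull_pair, ← simplexPull_comp, ← simplexPull_comp, e1, e6, simplexPull_id,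
        simplexPull_comp, hδσ]
      rfl
    rw [totalD_ofDegree]
    change ofDegree 1 ((SingularChains k _).d (1 + 1) 1 (simplexChain k ρ)) = _
    rw [d_simplexChain, Fin.sum_univ_three, f0, f1, f2, totalMap_ofDegree, totalMap_ofDegree,
      totalMap_ofDegree, chainMap_simplexChain, chainMap_simplexChain, chainMap_simplexChain]
    rw [Fin.val_zero, Fin.val_one, Fin.val_two, pow_zero, pow_one, neg_one_sq, one_smul, one_smul,
      neg_smul, one_smul, map_add, map_add, map_neg]
    abel
  rw [← sub_eq_zero, ← neg_eq_zero, neg_sub]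
  exact ((((h.map torusLeft).add (h.map torusRight)).sub (h.map _)).eq_zero_iff).2 ⟨_, key⟩

end

/-! ### The circle operators -/

section
open scoped TensorProduct
variable {k : Type w} [CommRing k] {V W Y Z : Type u} [TopologicalSpace V] [TopologicalSpace W]
  [TopologicalSpace Y] [TopologicalSpace Z]

lemma circleOperator_apply (φ : C(Circle1.{u} × Y, Z)) (β : TotalHomology k Y) :
    circleOperator k φ β = homologyMap k φ (kunneth k Circle1.{u} Y (circleClass k ⊗ₜ β)) := rfl

lemma circleOperator_congr {φ ψ : C(Circle1.{u} × Y, Z)} (h : φ.Homotopic ψ) :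
    circleOperator k φ = circleOperator k ψ := by
  rw [circleOperator, circleOperator, homologyMap_congr h]

lemma homologyMap_comp_apply (g : C(Y, Z)) (f : C(W, Y)) (α : TotalHomology k W) :
    homologyMap k (g.comp f) α = homologyMap k g (homologyMap k f α) := by
  rw [homologyMap_comp, LinearMap.comp_apply]

lemma homologyMap_id_apply (α : TotalHomology k W) : homologyMap k (.id W) α = α := by
  rw [homologyMap_id, LinearMap.id_apply]

lemma circleOperator_homologyMap (φ : C(Circle1.{u} × Y, Z)) (f : C(W, Y))
    (β : TotalHomology k W) : circleOperator k φ (homologyMap k f β) =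
      circleOperator k (φ.comp ((ContinuousMap.id _).prodMap f)) β := by
  rw [circleOperator_apply, circleOperator_apply, homologyMap_comp_apply, homologyMap_kunneth,
    homologyMap_id_apply]

/-- The operator of the diagonal circle in a torus. -/
lemma circleOperator_torus (Φ : C((Circle1.{u} × Circle1.{u}) × Y, Z)) (β : TotalHomology k Y) :
    circleOperator k (Φ.comp (.prodMap (.prodMk (.id _) (.id _)) (.id Y))) β =
      circleOperator k (Φ.comp (torusLeft.prodMap (.id Y))) β +
        circleOperator k (Φ.comp (torusRight.prodMap (.id Y))) β := by
  simp only [circleOperator_apply, homologyMap_comp_apply, homologyMap_kunneth,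
    homologyMap_diag_circleClass, TensorProduct.add_tmul, map_add]

/-- The operator of a family of maps which depends on the circle in the first factor only. -/
lemma circleOperator_kunneth_left {φ : C(Circle1.{u} × (Y × W), Z)} {f : C(Circle1.{u} × Y, V)}
    {m : C(V × W, Z)}
    (h : (φ.comp (prodAssocMap _ Y W)).Homotopic (m.comp (f.prodMap (.id W))))
    (β : TotalHomology k Y) (γ : TotalHomology k W) :
    circleOperator k φ (kunneth k Y W (β ⊗ₜ γ)) =
      homologyMap k m (kunneth k V W (circleOperator k f β ⊗ₜ γ)) := by
  rw [circleOperator_apply, ← kunneth_assoc, ← homologyMap_comp_apply, homologyMap_congr h,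
    homologyMap_comp_apply, homologyMap_kunneth, homologyMap_id_apply, circleOperator_apply]

/-- The operator of a family of maps which depends on the circle in the second factor only. -/
lemma circleOperator_kunneth_right {φ : C(Circle1.{u} × (Y × W), Y × V)}
    {χ : C(Circle1.{u} × W, V)} (h : ∀ s y w, φ (s, (y, w)) = (y, χ (s, w)))
    (β : TotalHomology k Y) (γ : TotalHomology k W) :
    circleOperator k φ (kunneth k Y W (β ⊗ₜ γ)) =
      kunneth k Y V (degreeSign k Y β ⊗ₜ circleOperator k χ γ) := by
  -- The circle is moved past Y, where graded commutativity with a class of degree 1 gives the sign,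
  -- and then W is acted on.
  have e : φ.comp (prodAssocMap _ Y W) = ((ContinuousMap.id Y).prodMap χ).comp
      ((prodAssocMap Y _ W).comp (ContinuousMap.prodSwap.prodMap (.id W))) :=
    ContinuousMap.ext fun p => h _ _ _
  rw [circleOperator_apply, ← kunneth_assoc, ← homologyMap_comp_apply, e, homologyMap_comp_apply,
    homologyMap_comp_apply, homologyMap_kunneth, kunneth_circleClass_swap, kunneth_assoc,
    homologyMap_kunneth, homologyMap_id_apply, homologyMap_id_apply, circleOperator_apply]

end

/-! ### The circle action on the product of the loop space with X -/

section
open scoped TensorProduct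
variable {k : Type w} [CommRing k] {G X : Type u} [TopologicalSpace G] [HGroup G]
  [TopologicalSpace X] (α : HomotopyAction G X)

/-- The map `(t, (w, x)) ↦ w(t) x`. -/
def evalAct : C(Circle1.{u} × (Loops G × X), X) :=
  ⟨fun p => α.act (evalLoop G HSpace.e (p.1, p.2.1), p.2.2), by fun_prop⟩

lemma circleOperator_evalAct (a : TotalHomology k (Loops G)) (x : TotalHomology k X) :
    circleOperator k (evalAct α) (kunneth k (Loops G) X (a ⊗ₜ x)) =
      homologyAct k α (suspension k G HSpace.e a) x :=
  circleOperator_kunneth_left (f := evalLoop G HSpace.e) (m := α.act) (.refl _) a x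

/-- The map `(t, ((w, w'), x)) ↦ (w, w'(t) x)`. -/
def evalActSnd : C(Circle1.{u} × ((Loops G × Loops G) × X), Loops G × X) :=
  ⟨fun p => (p.2.1.1, evalAct α (p.1, (p.2.1.2, p.2.2))), by fun_prop⟩

/-- For d = a ⊗ b, after reassociation, the circle affects only the factor carrying b and x. Passing
a gives the sign in `suspensionTerm`. -/
lemma circleOperator_evalActSnd (d : TotalHomology k (Loops G) ⊗[k] TotalHomology k (Loops G))
    (x : TotalHomology k X) : circleOperator k (evalActSnd α)
      (kunneth k (Loops G × Loops G) X (kunneth k (Loops G) (Loops G) d ⊗ₜ x)) =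
      kunneth k (Loops G) X (suspensionTerm k α x d) := by
  induction d using TensorProduct.induction_on with
  | zero => simp
  | add d d' hd hd' => simp only [map_add, TensorProduct.add_tmul, hd, hd']
  | tmul a b =>
    let φ : C(Circle1.{u} × (Loops G × (Loops G × X)), Loops G × X) :=
      ⟨fun p => (p.2.1, evalAct α (p.1, p.2.2)), by fun_prop⟩
    have e : evalActSnd α = φ.comp ((ContinuousMap.id _).prodMap (prodAssocMap _ _ X)) := rfl
    rw [e, ← circleOperator_homologyMap, kunneth_assoc,
      circleOperator_kunneth_right (χ := evalAct α) (fun _ _ _ => rfl), circleOperator_evalAct]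
    rfl

/-- The part of the circle action on `ΩG × X` given by the action on `X`. -/
def evalActDiag : C(Circle1.{u} × (Loops G × X), Loops G × X) :=
  .prodMk ⟨fun p => p.2.1, by fun_prop⟩ (evalAct α)

/-- Doubling the loop by the diagonal map of `ΩG` separates the loop that is kept from the one that
acts. In homology this doubling is Δ. -/
lemma circleOperator_evalActDiag (hΔ : Function.Bijective (kunneth k (Loops G) (Loops G)))
    (a : TotalHomology k (Loops G)) (x : TotalHomology k X) :
    circleOperator k (evalActDiag α) (kunneth k (Loops G) X (a ⊗ₜ x)) =
      kunneth k (Loops G) X (suspensionTerm k α x (diagonal k (Loops G) hΔ a)) := by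
  have h : kunneth k (Loops G) (Loops G) (diagonal k (Loops G) hΔ a) =
      homologyMap k (.prodMk (.id (Loops G)) (.id (Loops G))) a :=
    (LinearEquiv.ofBijective _ hΔ).apply_symm_apply _
  have e : evalActDiag α = (evalActSnd α).comp ((ContinuousMap.id _).prodMap
      (.prodMap (.prodMk (.id _) (.id _)) (.id X))) := rfl
  rw [← circleOperator_evalActSnd, h, e, ← circleOperator_homologyMap, homologyMap_kunneth,
    homologyMap_id_apply]

variable {r : C(FreeLoops G, Loops G)}

/-- The operator of the circle action on `ΩG × X`. -/
theorem loopProdOperator_kunneth (hr : IsLoopRetraction r)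
    (hΔ : Function.Bijective (kunneth k (Loops G) (Loops G)))
    (a : TotalHomology k (Loops G)) (x : TotalHomology k X) :
    loopProdOperator k r α (kunneth k (Loops G) X (a ⊗ₜ x)) =
      kunneth k (Loops G) X (loopOperator k r a ⊗ₜ x +
        suspensionTerm k α x (diagonal k (Loops G) hΔ a)) := by
  -- The two occurrences of the circle parameter are decoupled; the action is recovered on the
  -- diagonal of the torus.
  let Φ : C((Circle1.{u} × Circle1.{u}) × (Loops G × X), Loops G × X) :=
    ⟨fun p => (loopAction r (p.1.1, p.2.1), evalAct α (p.1.2, p.2)), by fun_prop⟩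
  have h : loopProdAction r α = Φ.comp (.prodMap (.prodMk (.id _) (.id _)) (.id _)) := rfl
  -- With the second parameter 0, the loop is evaluated at its base point and e acts on X.
  have h1 : ((Φ.comp (torusLeft.prodMap (.id _))).comp (prodAssocMap _ _ X)).Homotopic
      ((loopAction r).prodMap (.id X)) := by
    have e : (Φ.comp (torusLeft.prodMap (.id _))).comp (prodAssocMap _ _ X) =
        (loopAction r).prodMap ⟨fun x => α.act (HSpace.e, x), by fun_prop⟩ :=
      ContinuousMap.ext fun p => Prod.ext rfl
        (congrArg (fun g => α.act (g, p.2)) p.1.2.2)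
    rw [e]
    exact .prodMap (.refl _) α.unit_act
  -- With the first parameter 0, the loop is not rotated and only r ∘ j acts on it.
  have h2 : (Φ.comp (torusRight.prodMap (.id _))).Homotopic (evalActDiag α) := by
    have e : Φ.comp (torusRight.prodMap (.id _)) =
        .prodMk ((r.comp (loopIncl G)).comp ⟨fun p => p.2.1, by fun_prop⟩) (evalAct α) :=
      ContinuousMap.ext fun p => Prod.ext
        (congrArg r (ContinuousMap.ext fun θ => congrArg p.2.1.1 (add_zero θ))) rfl
    rw [e]
    exact .prodMk (.comp hr.comp_loopIncl (.refl _)) (.refl _)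
  rw [loopProdOperator, h, circleOperator_torus, map_add, circleOperator_congr h2,
    circleOperator_evalActDiag α hΔ,
    circleOperator_kunneth_left (f := loopAction r) (m := .id _) h1, homologyMap_id_apply]
  rfl

end

end
end LoopHomology

open LoopHomology TensorProduct in
theorem mainTheorem4 {k : Type w} [CommRing k] [IsDomain k] [IsPrincipalIdealRing k]
    {G : Type u} [TopologicalSpace G] [HGroup G]
    {X : Type u} [TopologicalSpace X] (α : HomotopyAction G X)
    (r : C(FreeLoops G, Loops G)) (hr : IsLoopRetraction r)
    (htf : Module.IsTorsionFree k (TotalHomology k (Loops G))) :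
    ∃ (hΔ : Function.Bijective (kunneth k (Loops G) (Loops G)))
      (hX : Function.Bijective (kunneth k (Loops G) X)),
      ∀ (a : TotalHomology k (Loops G)) (x : TotalHomology k X),
        (LinearEquiv.ofBijective (kunneth k (Loops G) X) hX).symm
            (loopProdOperator k r α (kunneth k (Loops G) X (a ⊗ₜ[k] x))) =
          loopOperator k r a ⊗ₜ[k] x +
            suspensionTerm k α x (diagonal k (Loops G) hΔ a) := by
  refine ⟨kunneth_bijective k (Loops G) (Loops G) htf, kunneth_bijective k (Loops G) X htf,
    fun a x => ?_⟩
  rw [LinearEquiv.symm_apply_eq]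
  exact loopProdOperator_kunneth α hr _ a x
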